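/- **Setting.** Let $L/K$ be a finite field extension and let $\mathcal P_0$ be a finite poset. Let $A=(\mathrm{End}_K L)^{op}$, so that in $A$ the product $fg$ is "$f$ followed by $g$"; for $a\in L$ let $\mu_a\in A$ be the multiplication by $a$. Consider one of the following two situations. In both of them $\mathcal P_0$ determines subspaces $T_{xy}\subseteq A$ ($x\le y$ in $\mathcal P_0$) with $T_{xy}T_{yz}\subseteq T_{xz}$, and fields $K\subseteq K(x)\subseteq L$ with $T_{xx}=\mathrm{End}_{K(x)}L$. * *Generalized equipped poset.* $L/K$ is Galois, $L=K(\xi)$, and for all $x\le y$ in $\mathcal P_0$ a non-empty set $\Gamma_{xy}\subseteq \mathrm{Gal}(L/K)$ is given, such that for $x\le y\le z$, $\sigma\in\Gamma_{xy}$, $\tau\in\Gamma_{yz}$ one has $\tau\circ\sigma\in\Gamma_{xz}$. Then $T_{xy}$ is the span of all maps $b\mapsto a\,\sigma(b)$ with $a\in L$, $\sigma\in\Gamma_{xy}$, and $K(x)$ is the fixed field of $\Gamma_{xx}$. * *$p$-equipped poset* ($p$ prime). $L=K(\xi)$ is normal of degree $p$ over $K$ with $\xi^p\in K$; $\vartheta$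 is a generator of $\mathrm{Gal}(L/K)$ if $\mathrm{char}\,K\ne p$, and the $K$-derivation of $L$ with $\vartheta(\xi)=1$ if $\mathrm{char}\,K=p$. Each relation $x\le y$ has a level $\ell(x,y)\in\{1,\dots,p\}$, and $\ell(x,z)\ge\min(\ell(x,y)+\ell(y,z)-1,\,p)$ for $x\le y\le z$; we write $x\le^{\ell}y$ if $\ell(x,y)=\ell$. A point $x$ is *strong* if $\ell(x,x)=p$; otherwise it is *weak*, and then $\ell(x,x)=1$. Here $T_{xy}$ is the span of all maps $b\mapsto a\,\vartheta^i(b)$ with $a\in L$, $0\le i<\ell(x,y)$; $K(x)=K$ if $x$ is strong and $K(x)=L$ if $x$ is weak. Put $\mathcal P=\mathcal P_0\cup\{0,m\}$ with a new minimum $0$ and a new maximum $m$, $T_{0x}=T_{xm}=A$ for all $x$ and $K(0)=K(m)=K$ ($m$ counts as strong, and $\ell(x,m)=p$). Let $\varepsilon_x\in A$ be the projection of $L=\bigoplus_{i\ge0}K(x)\xi^i$ (sum over $0\le i<[L:K(x)]$) onto $K(x)$, let $R_{yx}=\varepsilon_yT_{yx}\varepsilon_x$ for $y\le x$, and let $\varphi_x:R_{xx}\to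 K(x)$, $\varepsilon_x\mu_a\varepsilon_x\mapsto a$, which is an isomorphism. Let $\Lambda=\bigoplus_{y\le x}R_{yx}$ be the algebra of $\mathcal P\times\mathcal P$-matrices with $(y,x)$ entry in $R_{yx}$, $S=\bigoplus_xR_{xx}$ its diagonal part, $J=\bigoplus_{y<x}R_{yx}$, ${}^*J=\mathrm{Hom}_S({}_SJ,S)$ (an $S$-bimodule), and $p_k\in J$, $\gamma_k\in{}^*J$ a dual basis of the left $S$-module $J$. The multiplication of $J$ gives the comultiplication ${}^*J\to{}^*J\otimes_S{}^*J$, $\gamma\mapsto\sum\gamma^1\otimes\gamma^2=\sum_{i,j}\gamma_i\otimes\gamma_j\,\gamma(p_jp_i)$. Let $\mathcal D=(T_R(W),d)$ be the Drozd ditalgebra of $\Lambda=S\oplus J$: $R=S\times S$ with $S$-copies $w_1S$ and $w_2S$, $W_0=w_{12}{}^*J$ (a copy of ${}^*J$ with $W_0=w_1W_0w_2$), $W_1=w_1{}^*J\oplus w_2{}^*J$ (copies of ${}^*J$ with left and right action through the first, respectively second, factor), with the differential $d(R)=0$, $$d(w_{12}\gamma)=\sum w_{12}\gamma^1\,w_2\gamma^2-\sum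 w_1\gamma^1\,w_{12}\gamma^2,\quad d(w_1\gamma)=-\sum w_1\gamma^1\,w_1\gamma^2,\quad d(w_2\gamma)=-\sum w_2\gamma^1\,w_2\gamma^2,$$ extended by the graded Leibniz rule. Let $D_n=T_R(W)_n$ be its part of degree $n$. The category $\mathrm{Mod}\,\mathcal D$ has the right $D_0$-modules as objects; a morphism $M\to N$ is a pair $(f^0,f^1)$ of an $R$-linear map $f^0:M\to N$ and a $D_0$-bimodule morphism $f^1:D_1\to\mathrm{Hom}_K(M,N)$ with $f^0(m)a=f^0(ma)+f^1(d(a))(m)$; the composite of $f$ and $g$ is $(gf)^0=g^0f^0$, $(gf)^1(v)=g^1(v)f^0+g^0f^1(v)-\sum_ig^1(v_i^2)f^1(v_i^1)$, where $d(v)=\sum_iv_i^1v_i^2$ with $v_i^1,v_i^2\in D_1$. With $e_x\in S$ the identity of $R_{xx}$, put $e=w_1(1-e_0)+w_2e_0$. The category $\mathrm{mod}\,\mathcal D^e$ consists of the $M\in\mathrm{Mod}\,\mathcal D$ with $\dim_KM<\infty$ and $M(1-e)=0$. For such $M$ let $M_0=Mw_2e_0$ and $M_x=Mw_1e_x$ for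 $x>0$; it is a vector space over $K(x)\cong R_{xx}$. A *local basis* of $M$ consists of ordered bases $(m^x_i)_{1\le i\le d_x}$ of $M_x$ over $K(x)$ for all $x\in\mathcal P$. The *matrix representation* of $M$ in a local basis consists of the $d_0\times d_x$ matrices $\underline M_x$ over $K(x)$ ($x>0$), with $(j,i)$ entry $\sum_k c_k\,p_k(1)$, where $c_k\in K$ is the coordinate at $m^0_j$ of $m_i^x\,w_{12}\gamma_k\in M_0$ and $p_k(1)\in K(x)$ is the value at $1\in L$ of the component of $p_k$ in $R_{0x}$. For $0<y<x$ let $\tau^{y,x}_1,\dots,\tau^{y,x}_{l(y,x)}$ be a basis of $R_{yx}$ as a right vector space over $R_{xx}\cong K(x)$, and let $$u^{y,x}_i:K(y)\to K(x),\qquad u_i^{y,x}(a)=\bigl(\varphi_y^{-1}(a)\,\tau_i^{y,x}\bigr)(1).$$ Maps are applied to matrices entrywise, and a matrix is non-singular if it has a two-sided inverse (so that it is square). **Theorem.** In both situations, let $M,N\in\mathrm{mod}\,\mathcal D^e$ with local bases, of sizes $d_x(M)$ and $d_x(N)$. For every choice of bases $\tau^{y,x}_i$, $M\cong N$ in $\mathrm{mod}\,\mathcal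 D^e$ if and only if there are a non-singular matrix $L^0$ over $K$ (of size $d_0(M)\times d_0(N)$), for each $x>0$ in $\mathcal P$ a non-singular matrix $L^x$ over $K(x)$ (of size $d_x(N)\times d_x(M)$), and for all $0<y<x$ in $\mathcal P$ matrices $L^{y,x}_1,\dots,L^{y,x}_{l(y,x)}$ over $K(x)$ (of size $d_y(N)\times d_x(M)$), such that for all $x>0$ $$\underline M_x=L^0\Bigl(\underline N_xL^x+\sum_{0<y<x}\ \sum_{i=1}^{l(y,x)}u^{y,x}_i(\underline N_y)\,L_i^{y,x}\Bigr).$$ For a $p$-equipped poset, let $\mathrm R:L\to K$, $a_0+a_1\xi+\dots+a_{p-1}\xi^{p-1}\mapsto a_0$. Then $M\cong N$ if and only if there are a non-singular matrix $L^0$ over $K$ and * for each strong $x>0$ a non-singular matrix $L^x$ over $K$ and, for each $0<y<x$, a matrix $L^{y,x}$, over $K$ if $y$ is strong and over $L$ if $y$ is weak, such that $$\underline M_x=L^0\Bigl(\underline N_xL^x+\sum_{y\ \mathrm{strong},\,0<y<x}\underline N_yL^{y,x}+\sum_{y\ \mathrm{weak},\,0<y<x}\mathrm R(\underline N_yL^{y,x})\Bigr);$$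 * for each weak $x$ a non-singular matrix $L^x$ over $L$, for each strong $y$ with $0<y<x$ a matrix $L^{y,x}$ over $L$, and for each weak $y<x$, with $\ell=\ell(y,x)$, matrices $L^{y,x}_1,\dots,L^{y,x}_{\ell}$ over $L$, such that $$\underline M_x=L^0\Bigl(\underline N_xL^x+\sum_{y\ \mathrm{strong},\,0<y<x}\underline N_yL^{y,x}+\sum_{y\ \mathrm{weak},\,y<x}\ \sum_{i=1}^{\ell(y,x)}\vartheta^{i-1}(\underline N_y)\,L_i^{y,x}\Bigr).$$ -/

import Mathlib

open MulOpposite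

set_option linter.unusedSectionVars false

namespace EqPoset

/-! ### The tensor algebra of a graded bimodule over a noncommutative ring -/

section TensorRing

variable (K R W₀ W₁ : Type*) [Field K] [Ring R] [Algebra K R]
  [AddCommGroup W₀] [Module K W₀] [Module R W₀] [Module Rᵐᵒᵖ W₀]
  [AddCommGroup W₁] [Module K W₁] [Module R W₁] [Module Rᵐᵒᵖ W₁]

/-- The relations that turn the free `K`-algebra on the space `R ⊕ W` into the tensor algebra
`T_R(W)` of the `R`-`R`-bimodule `W = W₀ ⊕ W₁`. -/
inductive TensorRel : TensorAlgebra K (R × W₀ × W₁) → TensorAlgebra K (R × W₀ × W₁) → Prop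
  | one : TensorRel (TensorAlgebra.ι K ((1 : R), (0 : W₀ × W₁))) 1
  | mul (r s : R) : TensorRel
      (TensorAlgebra.ι K (r, (0 : W₀ × W₁)) * TensorAlgebra.ι K (s, (0 : W₀ × W₁)))
      (TensorAlgebra.ι K (r * s, (0 : W₀ × W₁)))
  | left (r : R) (w : W₀ × W₁) : TensorRel
      (TensorAlgebra.ι K (r, (0 : W₀ × W₁)) * TensorAlgebra.ι K ((0 : R), w))
      (TensorAlgebra.ι K ((0 : R), r • w))
  | right (r : R) (w : W₀ × W₁) : TensorRel
      (TensorAlgebra.ι K ((0 : R), w) * TensorAlgebra.ι K (r, (0 : W₀ × W₁)))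
      (TensorAlgebra.ι K ((0 : R), op r • w))

/-- The tensor algebra `T_R(W)` of the `R`-`R`-bimodule `W = W₀ ⊕ W₁`. -/
def TensorRing : Type _ := RingQuot (TensorRel K R W₀ W₁)

noncomputable instance : Ring (TensorRing K R W₀ W₁) :=
  inferInstanceAs (Ring (RingQuot (TensorRel K R W₀ W₁)))

noncomputable instance : Algebra K (TensorRing K R W₀ W₁) :=
  inferInstanceAs (Algebra K (RingQuot (TensorRel K R W₀ W₁)))

namespace TensorRing

/-- The canonical map from the generators `R ⊕ W` to `T_R(W)`. -/
noncomputable def gen : (R × W₀ × W₁) →ₗ[K] TensorRing K R W₀ W₁ :=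
  (RingQuot.mkAlgHom K (TensorRel K R W₀ W₁)).toLinearMap ∘ₗ TensorAlgebra.ι K

/-- The canonical map `W → T_R(W)`. -/
noncomputable def ofW : (W₀ × W₁) →ₗ[K] TensorRing K R W₀ W₁ :=
  gen K R W₀ W₁ ∘ₗ LinearMap.inr K R (W₀ × W₁)

theorem gen_rel {x y : TensorAlgebra K (R × W₀ × W₁)} (h : TensorRel K R W₀ W₁ x y) :
    RingQuot.mkAlgHom K (TensorRel K R W₀ W₁) x = RingQuot.mkAlgHom K (TensorRel K R W₀ W₁) y :=
  RingQuot.mkAlgHom_rel K h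

/-- The canonical map `R → T_R(W)`. -/
noncomputable def ofR : R →ₐ[K] TensorRing K R W₀ W₁ :=
  AlgHom.ofLinearMap (gen K R W₀ W₁ ∘ₗ LinearMap.inl K R (W₀ × W₁))
    (by
      have h := gen_rel K R W₀ W₁ (TensorRel.one)
      rw [map_one] at h
      exact h)
    (by
      intro r s
      have h := gen_rel K R W₀ W₁ (TensorRel.mul r s)
      rw [map_mul] at h
      exact h.symm)

variable {K R W₀ W₁}

theorem ofR_mul_ofW (r : R) (w : W₀ × W₁) :
    ofR K R W₀ W₁ r * ofW K R W₀ W₁ w = ofW K R W₀ W₁ (r • w) := by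
  have h := gen_rel K R W₀ W₁ (TensorRel.left r w)
  rw [map_mul] at h
  exact h

theorem ofW_mul_ofR (r : R) (w : W₀ × W₁) :
    ofW K R W₀ W₁ w * ofR K R W₀ W₁ r = ofW K R W₀ W₁ (op r • w) := by
  have h := gen_rel K R W₀ W₁ (TensorRel.right r w)
  rw [map_mul] at h
  exact h

/-- The universal property of `T_R(W)`. -/
noncomputable def lift {B : Type*} [Ring B] [Algebra K B] (f : R →ₐ[K] B) (g : (W₀ × W₁) →ₗ[K] B)
    (hl : ∀ r w, g (r • w) = f r * g w) (hr : ∀ r w, g (op r • w) = g w * f r) :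
    TensorRing K R W₀ W₁ →ₐ[K] B :=
  RingQuot.liftAlgHom K ⟨TensorAlgebra.lift K
    (f.toLinearMap ∘ₗ LinearMap.fst K R (W₀ × W₁) + g ∘ₗ LinearMap.snd K R (W₀ × W₁)), by
      intro x y h
      cases h <;> simp [hl, hr]⟩

section lift

variable {B : Type*} [Ring B] [Algebra K B] (f : R →ₐ[K] B) (g : (W₀ × W₁) →ₗ[K] B)
    (hl : ∀ r w, g (r • w) = f r * g w) (hr : ∀ r w, g (op r • w) = g w * f r)

theorem lift_ofR (r : R) : lift f g hl hr (ofR K R W₀ W₁ r) = f r := by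
  change RingQuot.liftAlgHom K _ (RingQuot.mkAlgHom K (TensorRel K R W₀ W₁) _) = _
  rw [RingQuot.liftAlgHom_mkAlgHom_apply]
  simp

theorem lift_ofW (w : W₀ × W₁) : lift f g hl hr (ofW K R W₀ W₁ w) = g w := by
  change RingQuot.liftAlgHom K _ (RingQuot.mkAlgHom K (TensorRel K R W₀ W₁) _) = _
  rw [RingQuot.liftAlgHom_mkAlgHom_apply]
  simp

end lift

variable (K R W₀ W₁)

/-- `IsHomogeneous n x`: the element `x` is a product of elements of `R`, `W₀` (degree `0`) and
`W₁` (degree `1`) of total degree `n`. -/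
inductive IsHomogeneous : ℕ → TensorRing K R W₀ W₁ → Prop
  | ofR (r : R) : IsHomogeneous 0 (ofR K R W₀ W₁ r)
  | ofW₀ (w : W₀) : IsHomogeneous 0 (ofW K R W₀ W₁ (w, 0))
  | ofW₁ (w : W₁) : IsHomogeneous 1 (ofW K R W₀ W₁ (0, w))
  | mul {m n : ℕ} {x y : TensorRing K R W₀ W₁} :
      IsHomogeneous m x → IsHomogeneous n y → IsHomogeneous (m + n) (x * y)

/-- The homogeneous component `T_R(W)_n`. -/
noncomputable def deg (n : ℕ) : Submodule K (TensorRing K R W₀ W₁) :=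
  Submodule.span K {x | IsHomogeneous K R W₀ W₁ n x}

variable {K R W₀ W₁}

theorem mul_mem_deg {m n : ℕ} {x y : TensorRing K R W₀ W₁} (hx : x ∈ deg K R W₀ W₁ m)
    (hy : y ∈ deg K R W₀ W₁ n) : x * y ∈ deg K R W₀ W₁ (m + n) := by
  induction hx using Submodule.span_induction with
  | zero => simp
  | add a b _ _ ha hb => rw [add_mul]; exact add_mem ha hb
  | smul c a _ ha => rw [smul_mul_assoc]; exact Submodule.smul_mem _ _ ha
  | mem a ha =>
    induction hy using Submodule.span_induction with
    | zero => simp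
    | add a b _ _ ha hb => rw [mul_add]; exact add_mem ha hb
    | smul c a _ ha => rw [mul_smul_comm]; exact Submodule.smul_mem _ _ ha
    | mem b hb => exact Submodule.subset_span (.mul ha hb)

variable (K R W₀ W₁)

/-- The subalgebra `T_R(W)_0`. -/
noncomputable def degZero : Subalgebra K (TensorRing K R W₀ W₁) where
  carrier := deg K R W₀ W₁ 0
  mul_mem' := fun hx hy => mul_mem_deg (m := 0) (n := 0) hx hy
  add_mem' := fun hx hy => (deg K R W₀ W₁ 0).add_mem hx hy
  algebraMap_mem' := fun c => by
    have h : ofR K R W₀ W₁ (algebraMap K R c) ∈ deg K R W₀ W₁ 0 :=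
      Submodule.subset_span (IsHomogeneous.ofR _)
    rw [AlgHom.commutes] at h
    exact h

/-- The canonical map `R → T_R(W)_0`. -/
noncomputable def ofRZero : R →ₐ[K] degZero K R W₀ W₁ :=
  (ofR K R W₀ W₁).codRestrict _ (fun r => Submodule.subset_span (IsHomogeneous.ofR r))

/-- The canonical map `W₀ → T_R(W)_0`. -/
noncomputable def ofWZero (w : W₀) : degZero K R W₀ W₁ :=
  ⟨ofW K R W₀ W₁ (w, 0), Submodule.subset_span (IsHomogeneous.ofW₀ w)⟩

end TensorRing

open TensorRing

/-- A ditalgebra `(T_R(W), d)`: a differential `d` on the graded tensor algebra `T_R(W)`. -/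
structure Ditalgebra where
  /-- the differential -/
  d : TensorRing K R W₀ W₁ →ₗ[K] TensorRing K R W₀ W₁
  d_mem : ∀ n : ℕ, ∀ x ∈ deg K R W₀ W₁ n, d x ∈ deg K R W₀ W₁ (n + 1)
  d_ofR : ∀ r : R, d (ofR K R W₀ W₁ r) = 0
  d_mul : ∀ n : ℕ, ∀ x ∈ deg K R W₀ W₁ n, ∀ y : TensorRing K R W₀ W₁,
    d (x * y) = d x * y + (-1) ^ n * x * d y
  d_sq : ∀ x, d (d x) = 0

variable {K R W₀ W₁}


theorem TensorRing.induction {p : TensorRing K R W₀ W₁ → Prop}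
    (hR : ∀ r, p (ofR K R W₀ W₁ r)) (hW : ∀ w, p (ofW K R W₀ W₁ w))
    (hadd : ∀ x y, p x → p y → p (x + y)) (hmul : ∀ x y, p x → p y → p (x * y))
    (x : TensorRing K R W₀ W₁) : p x := by
  obtain ⟨y, rfl⟩ := RingQuot.mkAlgHom_surjective K (TensorRel K R W₀ W₁) x
  induction y using TensorAlgebra.induction with
  | algebraMap c =>
    have h := hR (algebraMap K R c)
    rw [AlgHom.commutes] at h
    rw [AlgHom.commutes]
    exact h
  | ι z =>
    have h := hadd _ _ (hR z.1) (hW z.2)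
    have e : ofR K R W₀ W₁ z.1 + ofW K R W₀ W₁ z.2
        = RingQuot.mkAlgHom K (TensorRel K R W₀ W₁) (TensorAlgebra.ι K z) := by
      change gen K R W₀ W₁ (z.1, 0) + gen K R W₀ W₁ (0, z.2) = gen K R W₀ W₁ z
      rw [← map_add]; simp
    rw [e] at h
    exact h
  | mul a b ha hb => rw [map_mul]; exact hmul _ _ ha hb
  | add a b ha hb => rw [map_add]; exact hadd _ _ ha hb

section Upper

variable {K T : Type*} [Field K] [Ring T] [Algebra K T]

/-- A triangular matrix of size two. -/
def upper (x y z : T) : Matrix (Fin 2) (Fin 2) T := !![x, y; 0, z]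

theorem upper_add (x y z x' y' z' : T) :
    upper (x + x') (y + y') (z + z') = upper x y z + upper x' y' z' := by
  ext i j; fin_cases i <;> fin_cases j <;> simp [upper]

theorem upper_smul (c : K) (x y z : T) : upper (c • x) (c • y) (c • z) = c • upper x y z := by
  ext i j; fin_cases i <;> fin_cases j <;> simp [upper]

theorem upper_mul (x y z x' y' z' : T) :
    upper x y z * upper x' y' z' = upper (x * x') (x * y' + y * z') (z * z') := by
  ext i j; fin_cases i <;> fin_cases j <;> simp [upper, Matrix.mul_apply]

theorem upper_one : upper (1 : T) 0 1 = 1 := by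
  ext i j; fin_cases i <;> fin_cases j <;> simp [upper]

theorem sign_comm (n : ℕ) (x : T) : x * (-1) ^ n = (-1) ^ n * x := by
  rcases neg_one_pow_eq_or T n with h | h <;> simp [h]

theorem sign_mem (n : ℕ) {V : Submodule K T} {x : T} (hx : x ∈ V) : (-1) ^ n * x ∈ V := by
  rcases neg_one_pow_eq_or T n with h | h
  · rw [h, one_mul]; exact hx
  · rw [h, neg_one_mul]; exact neg_mem hx

end Upper

/-- Every degree preserving bimodule map `W → T_R(W)` of degree one extends to a map on `T_R(W)`
that satisfies the signed Leibniz rule. -/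
theorem exists_differential (dW : (W₀ × W₁) →ₗ[K] TensorRing K R W₀ W₁)
    (hl : ∀ r w, dW (r • w) = ofR K R W₀ W₁ r * dW w)
    (hr : ∀ r w, dW (op r • w) = dW w * ofR K R W₀ W₁ r)
    (h₀ : ∀ w, dW (w, 0) ∈ deg K R W₀ W₁ 1) (h₁ : ∀ w, dW (0, w) ∈ deg K R W₀ W₁ 2) :
    ∃ d : TensorRing K R W₀ W₁ →ₗ[K] TensorRing K R W₀ W₁,
      (∀ n : ℕ, ∀ x ∈ deg K R W₀ W₁ n, d x ∈ deg K R W₀ W₁ (n + 1)) ∧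
      (∀ r : R, d (ofR K R W₀ W₁ r) = 0) ∧
      (∀ n : ℕ, ∀ x ∈ deg K R W₀ W₁ n, ∀ y : TensorRing K R W₀ W₁,
        d (x * y) = d x * y + (-1) ^ n * x * d y) ∧
      (∀ w, d (ofW K R W₀ W₁ w) = dW w) := by
  let f : R →ₐ[K] Matrix (Fin 2) (Fin 2) (TensorRing K R W₀ W₁) :=
    AlgHom.ofLinearMap
      { toFun := fun r => upper (ofR K R W₀ W₁ r) 0 (ofR K R W₀ W₁ r)
        map_add' := fun r s => by rw [← upper_add, map_add, add_zero]
        map_smul' := fun c s => by rw [RingHom.id_apply, ← upper_smul, map_smul, smul_zero] }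
      ((congrArg (fun x => upper x 0 x) (map_one _)).trans upper_one)
      (fun r s => by
        refine Eq.trans ?_ (upper_mul _ _ _ _ _ _).symm
        change upper _ _ _ = _
        rw [map_mul, mul_zero, zero_mul, add_zero])
  let sg : (W₀ × W₁) →ₗ[K] (W₀ × W₁) := LinearMap.id.prodMap (-LinearMap.id)
  have sg_l : ∀ (r : R) w, sg (r • w) = r • sg w := fun r w => Prod.ext rfl (smul_neg r w.2).symm
  have sg_r : ∀ (r : R) w, sg (op r • w) = op r • sg w :=
    fun r w => Prod.ext rfl (smul_neg (op r) w.2).symm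
  let g : (W₀ × W₁) →ₗ[K] Matrix (Fin 2) (Fin 2) (TensorRing K R W₀ W₁) :=
      { toFun := fun w => upper (ofW K R W₀ W₁ (sg w)) (dW w) (ofW K R W₀ W₁ w)
        map_add' := fun r s => by rw [← upper_add, map_add, map_add, map_add, map_add]
        map_smul' := fun c s => by
          rw [RingHom.id_apply, ← upper_smul, map_smul, map_smul, map_smul, map_smul] }
  have gl : ∀ r w, g (r • w) = f r * g w := fun r w => by
    refine Eq.trans ?_ (upper_mul _ _ _ _ _ _).symm
    change upper _ _ _ = _
    rw [sg_l, ofR_mul_ofW, ofR_mul_ofW, hl, zero_mul, add_zero]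
  have gr : ∀ r w, g (op r • w) = g w * f r := fun r w => by
    refine Eq.trans ?_ (upper_mul _ _ _ _ _ _).symm
    change upper _ _ _ = _
    rw [sg_r, ofW_mul_ofR, ofW_mul_ofR, hr, mul_zero, zero_add]
  let Φ := lift f g gl gr
  have Φr : ∀ r, Φ (ofR K R W₀ W₁ r) = upper (ofR K R W₀ W₁ r) 0 (ofR K R W₀ W₁ r) :=
    lift_ofR f g gl gr
  have Φw : ∀ w, Φ (ofW K R W₀ W₁ w) = upper (ofW K R W₀ W₁ (sg w)) (dW w) (ofW K R W₀ W₁ w) :=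
    lift_ofW f g gl gr
  have hup : ∀ x, Φ x = upper (Φ x 0 0) (Φ x 0 1) x := by
    intro x
    induction x using TensorRing.induction with
    | hR r => rw [Φr]; rfl
    | hW w => rw [Φw]; rfl
    | hadd x y hx hy => rw [map_add, hx, hy, ← upper_add]; rfl
    | hmul x y hx hy => rw [map_mul, hx, hy, upper_mul]; rfl
  have hmul : ∀ x y, Φ (x * y) 0 0 = Φ x 0 0 * Φ y 0 0 ∧
      Φ (x * y) 0 1 = Φ x 0 0 * Φ y 0 1 + Φ x 0 1 * y := by
    intro x y
    rw [map_mul, hup x, hup y, upper_mul]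
    exact ⟨rfl, rfl⟩
  have hhom : ∀ n x, IsHomogeneous K R W₀ W₁ n x →
      Φ x 0 0 = (-1) ^ n * x ∧ Φ x 0 1 ∈ deg K R W₀ W₁ (n + 1) := by
    intro n x hx
    induction hx with
    | ofR r =>
      rw [Φr, pow_zero, one_mul]
      exact ⟨rfl, zero_mem _⟩
    | ofW₀ w =>
      rw [Φw, pow_zero, one_mul]
      refine ⟨?_, h₀ w⟩
      have : sg (w, 0) = (w, 0) := Prod.ext rfl neg_zero
      rw [this]
      rfl
    | ofW₁ w =>
      rw [Φw, pow_one, neg_one_mul]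
      refine ⟨?_, h₁ w⟩
      have : sg (0, w) = -((0 : W₀), w) := Prod.ext neg_zero.symm rfl
      rw [this, map_neg]
      rfl
    | @mul m n x y hx' hy' hx hy =>
      have hxd : x ∈ deg K R W₀ W₁ m := Submodule.subset_span hx'
      have hyd : y ∈ deg K R W₀ W₁ n := Submodule.subset_span hy'
      rw [(hmul x y).1, (hmul x y).2, hx.1, hy.1]
      constructor
      · rw [pow_add, mul_assoc, ← mul_assoc x, sign_comm, mul_assoc, mul_assoc]
      · refine add_mem ?_ ?_
        · have h2 := mul_mem_deg (sign_mem m hxd) hy.2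
          rwa [← add_assoc] at h2
        · have h2 := mul_mem_deg hx.2 hyd
          rwa [add_right_comm] at h2
  have hdeg : ∀ n, ∀ x ∈ deg K R W₀ W₁ n,
      Φ x 0 0 = (-1) ^ n * x ∧ Φ x 0 1 ∈ deg K R W₀ W₁ (n + 1) := by
    intro n x hx
    induction hx using Submodule.span_induction with
    | mem x hx => exact hhom n x hx
    | zero =>
      rw [map_zero, mul_zero]
      exact ⟨rfl, zero_mem _⟩
    | add a b _ _ ha hb =>
      rw [map_add, mul_add, ← ha.1, ← hb.1]
      exact ⟨rfl, add_mem ha.2 hb.2⟩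
    | smul c a _ ha =>
      rw [map_smul, mul_smul_comm, ← ha.1]
      exact ⟨rfl, Submodule.smul_mem _ _ ha.2⟩
  refine ⟨(Matrix.entryLinearMap K (TensorRing K R W₀ W₁) 0 1) ∘ₗ Φ.toLinearMap, ?_, ?_, ?_, ?_⟩
  · intro n x hx
    exact (hdeg n x hx).2
  · intro r
    change Φ (ofR K R W₀ W₁ r) 0 1 = 0
    rw [Φr]
    rfl
  · intro n x hx y
    change Φ (x * y) 0 1 = Φ x 0 1 * y + (-1) ^ n * x * Φ y 0 1
    rw [(hmul x y).2, (hdeg n x hx).1, add_comm]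
  · intro w
    change Φ (ofW K R W₀ W₁ w) 0 1 = _
    rw [Φw]
    rfl

end TensorRing
end EqPoset

namespace EqPoset

section Modules

open TensorRing

variable {K R W₀ W₁ : Type*} [Field K] [Ring R] [Algebra K R]
  [AddCommGroup W₀] [Module K W₀] [Module R W₀] [Module Rᵐᵒᵖ W₀]
  [AddCommGroup W₁] [Module K W₁] [Module R W₁] [Module Rᵐᵒᵖ W₁]

/-- A skew derivation of degree one squares to zero if it does so on `W`. -/
theorem TensorRing.sq_eq_zero (d : TensorRing K R W₀ W₁ →ₗ[K] TensorRing K R W₀ W₁)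
    (hd : ∀ n : ℕ, ∀ x ∈ deg K R W₀ W₁ n, d x ∈ deg K R W₀ W₁ (n + 1))
    (hR : ∀ r : R, d (ofR K R W₀ W₁ r) = 0)
    (hm : ∀ n : ℕ, ∀ x ∈ deg K R W₀ W₁ n, ∀ y : TensorRing K R W₀ W₁,
        d (x * y) = d x * y + (-1) ^ n * x * d y)
    (hW : ∀ w, d (d (ofW K R W₀ W₁ w)) = 0) (x : TensorRing K R W₀ W₁) : d (d x) = 0 := by
  have hmem : ∀ n x, IsHomogeneous K R W₀ W₁ n x → x ∈ deg K R W₀ W₁ n :=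
    fun n x h => Submodule.subset_span h
  have h1 : ∀ n x, IsHomogeneous K R W₀ W₁ n x → d (d x) = 0 := by
    intro n x h
    induction h with
    | ofR r => rw [hR, map_zero]
    | ofW₀ w => exact hW _
    | ofW₁ w => exact hW _
    | @mul m n x y hx hy ihx ihy =>
      have e : ∀ z, d ((-1) ^ m * z) = (-1) ^ m * d z := by
        intro z
        rcases neg_one_pow_eq_or (TensorRing K R W₀ W₁) m with h | h <;> simp [h]
      rw [hm m x (hmem _ _ hx), map_add, hm (m + 1) _ (hd _ _ (hmem _ _ hx)), ihx,
        mul_assoc ((-1) ^ m) x (d y), e, hm m x (hmem _ _ hx), ihy, pow_succ]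
      simp [mul_assoc]
  have h2 : x ∈ Submodule.span K {x | ∃ n, IsHomogeneous K R W₀ W₁ n x} := by
    induction x using TensorRing.induction with
    | hR r => exact Submodule.subset_span ⟨0, .ofR r⟩
    | hW w =>
      have e : w = (w.1, 0) + (0, w.2) := by simp
      rw [e, map_add]
      exact add_mem (Submodule.subset_span ⟨0, .ofW₀ _⟩) (Submodule.subset_span ⟨1, .ofW₁ _⟩)
    | hadd x y hx hy => exact add_mem hx hy
    | hmul x y hx hy =>
      induction hx using Submodule.span_induction with
      | zero => simp
      | add a b _ _ ha hb => rw [add_mul]; exact add_mem ha hb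
      | smul c a _ ha => rw [smul_mul_assoc]; exact Submodule.smul_mem _ _ ha
      | mem a ha =>
        induction hy using Submodule.span_induction with
        | zero => simp
        | add a b _ _ ha hb => rw [mul_add]; exact add_mem ha hb
        | smul c a _ ha => rw [mul_smul_comm]; exact Submodule.smul_mem _ _ ha
        | mem b hb =>
          obtain ⟨m, ha⟩ := ha
          obtain ⟨n, hb⟩ := hb
          exact Submodule.subset_span ⟨m + n, .mul ha hb⟩
  induction h2 using Submodule.span_induction with
  | mem a ha => obtain ⟨n, hn⟩ := ha; exact h1 n a hn
  | zero => simp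
  | add a b _ _ ha hb => simp [ha, hb]
  | smul c a _ ha => simp [ha]

/-- Left multiplication of `T_R(W)_1` by `T_R(W)_0`. -/
noncomputable def TensorRing.lmul (a : degZero K R W₀ W₁) (v : deg K R W₀ W₁ 1) : deg K R W₀ W₁ 1 :=
  ⟨a.1 * v.1, mul_mem_deg (m := 0) (n := 1) a.2 v.2⟩

/-- Right multiplication of `T_R(W)_1` by `T_R(W)_0`. -/
noncomputable def TensorRing.rmul (v : deg K R W₀ W₁ 1) (a : degZero K R W₀ W₁) : deg K R W₀ W₁ 1 :=
  ⟨v.1 * a.1, mul_mem_deg (m := 1) (n := 0) v.2 a.2⟩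

/-- The differential `T_R(W)_0 → T_R(W)_1`. -/
noncomputable def Ditalgebra.dZero (D : Ditalgebra K R W₀ W₁) (a : degZero K R W₀ W₁) : deg K R W₀ W₁ 1 :=
  ⟨D.d a.1, D.d_mem 0 _ a.2⟩

variable (D : Ditalgebra K R W₀ W₁)
  (M : Type*) [AddCommGroup M] [Module K M] [Module (degZero K R W₀ W₁)ᵐᵒᵖ M]
  (N : Type*) [AddCommGroup N] [Module K N] [Module (degZero K R W₀ W₁)ᵐᵒᵖ N]
  (L : Type*) [AddCommGroup L] [Module K L] [Module (degZero K R W₀ W₁)ᵐᵒᵖ L]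

/-- The objects of the category `Mod D` are the right `T_R(W)_0`-modules, and a morphism `M → N`
is a pair `(f⁰, f¹)` with `f⁰ : M → N` a morphism of right `R`-modules and
`f¹ : T_R(W)_1 → Hom_K(M, N)` a morphism of `T_R(W)_0`-bimodules such that
`f⁰(m) a = f⁰(m a) + f¹(d(a))(m)`. -/
structure Ditalgebra.Hom where
  f₀ : M →ₗ[K] N
  f₁ : deg K R W₀ W₁ 1 →ₗ[K] (M →ₗ[K] N)
  map_smul : ∀ (r : R) (m : M),
    f₀ (op (ofRZero K R W₀ W₁ r) • m) = op (ofRZero K R W₀ W₁ r) • f₀ m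
  map_lmul : ∀ (a : degZero K R W₀ W₁) (v : deg K R W₀ W₁ 1) (m : M),
    f₁ (lmul a v) m = f₁ v (op a • m)
  map_rmul : ∀ (v : deg K R W₀ W₁ 1) (a : degZero K R W₀ W₁) (m : M),
    f₁ (rmul v a) m = op a • f₁ v m
  compat : ∀ (a : degZero K R W₀ W₁) (m : M),
    op a • f₀ m = f₀ (op a • m) + f₁ (D.dZero a) m

/-- The identity `(id_M, 0)`. -/
noncomputable def Ditalgebra.Hom.id : D.Hom M M where
  f₀ := LinearMap.id
  f₁ := 0
  map_smul := by simp
  map_lmul := by simp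
  map_rmul := by simp
  compat := by simp

variable {D M N L}

/-- `IsComp g f h`: the morphism `h` is the composition `g f`, that is `h⁰ = g⁰ f⁰` and
`h¹(v) = g¹(v) f⁰ + g⁰ f¹(v) - ∑ i, g¹(vᵢ²) f¹(vᵢ¹)` for `d(v) = ∑ i, vᵢ¹ vᵢ²` with
`vᵢ¹, vᵢ²` of degree one.  The value of the last sum does not depend on the way in which `d(v)`
is written, since `T_R(W)_2` is the tensor square of `T_R(W)_1` over `T_R(W)_0`.  The sign is the
one that the Leibniz rule `d(a b) = d(a) b + (-1) ^ deg a • a d(b)` forces for right modules: with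
it `h¹` is again a morphism of bimodules. -/
def Ditalgebra.IsComp (g : D.Hom N L) (f : D.Hom M N) (h : D.Hom M L) : Prop :=
  h.f₀ = g.f₀ ∘ₗ f.f₀ ∧
  ∀ v : deg K R W₀ W₁ 1, ∃ (n : ℕ) (a b : Fin n → deg K R W₀ W₁ 1),
    D.d v.1 = ∑ i, (a i).1 * (b i).1 ∧
    h.f₁ v = g.f₁ v ∘ₗ f.f₀ + g.f₀ ∘ₗ f.f₁ v - ∑ i, g.f₁ (b i) ∘ₗ f.f₁ (a i)

variable (D M N)

/-- `M` and `N` are isomorphic in the category `Mod D`. -/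
def Ditalgebra.IsIso : Prop :=
  ∃ (f : D.Hom M N) (g : D.Hom N M),
    Ditalgebra.IsComp g f (Ditalgebra.Hom.id D M) ∧ Ditalgebra.IsComp f g (Ditalgebra.Hom.id D N)

end Modules
end EqPoset

namespace EqPoset

section Drozd

open TensorRing

variable {K Λ : Type*} [Field K] [Ring Λ] [Algebra K Λ] (S : Subalgebra K Λ) (J : Ideal Λ)

/-- The dual `*J = Hom_S(_S J, S)` of an ideal `J` of `Λ`, for a subalgebra `S` of `Λ`. -/
def LDual : Type _ := J →ₗ[S] S

instance : AddCommGroup (LDual S J) := inferInstanceAs (AddCommGroup (J →ₗ[S] S))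
instance : Module K (LDual S J) := inferInstanceAs (Module K (J →ₗ[S] S))
instance : FunLike (LDual S J) J S := inferInstanceAs (FunLike (J →ₗ[S] S) J S)

variable {S J}

/-- The product of an element of the two-sided ideal `J` by an element of `Λ`. -/
def mulR [J.IsTwoSided] (j : J) (a : Λ) : J := ⟨j.1 * a, J.mul_mem_right a j.2⟩

namespace LDual

theorem ext {γ δ : LDual S J} (h : ∀ j, γ j = δ j) : γ = δ := DFunLike.ext _ _ h
@[simp] theorem add_app (γ δ : LDual S J) (j : J) : (γ + δ) j = γ j + δ j := rfl
@[simp] theorem zero_app (j : J) : (0 : LDual S J) j = 0 := rfl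
@[simp] theorem smul_app (c : K) (γ : LDual S J) (j : J) : (c • γ) j = c • γ j := rfl
theorem map_add (γ : LDual S J) (i j : J) : γ (i + j) = γ i + γ j := LinearMap.map_add γ i j
theorem map_smul (γ : LDual S J) (s : S) (j : J) : γ (s • j) = s * γ j := LinearMap.map_smul γ s j
theorem map_sum (γ : LDual S J) {ι : Type*} (t : Finset ι) (f : ι → J) :
    γ (∑ i ∈ t, f i) = ∑ i ∈ t, γ (f i) := _root_.map_sum (show J →ₗ[S] S from γ) f t
theorem sum_app {ι : Type*} (t : Finset ι) (f : ι → LDual S J) (j : J) :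
    (∑ i ∈ t, f i) j = ∑ i ∈ t, f i j := LinearMap.sum_apply t f j

/-- The right `S`-module structure of `*J`: `(γ s)(j) = γ(j) s`. -/
instance : Module Sᵐᵒᵖ (LDual S J) := inferInstanceAs (Module Sᵐᵒᵖ (J →ₗ[S] S))

@[simp] theorem op_smul_app (s : S) (γ : LDual S J) (j : J) : (op s • γ) j = γ j * s := rfl

variable [J.IsTwoSided]

/-- The left `S`-module structure of `*J`: `(s γ)(j) = γ(j s)`. -/
instance : SMul S (LDual S J) where
  smul s γ :=
    { toFun := fun j => γ (mulR j (s : Λ))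
      map_add' := fun i j => by
        rw [← LDual.map_add]; congr 1; exact Subtype.ext (add_mul _ _ _)
      map_smul' := fun c j => by
        change γ _ = c * γ _
        rw [← LDual.map_smul]; congr 1; exact Subtype.ext (mul_assoc _ _ _) }

@[simp] theorem left_smul_app (s : S) (γ : LDual S J) (j : J) : (s • γ) j = γ (mulR j (s : Λ)) := rfl

instance : Module S (LDual S J) where
  one_smul γ := LDual.ext fun j => by
    rw [left_smul_app]; congr 1; exact Subtype.ext (mul_one _)
  mul_smul r s γ := LDual.ext fun j => by
    simp only [left_smul_app]; congr 1; exact Subtype.ext (mul_assoc _ _ _).symm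
  smul_zero s := LDual.ext fun j => by simp
  smul_add s γ δ := LDual.ext fun j => by simp
  add_smul r s γ := LDual.ext fun j => by
    rw [add_app]
    simp only [left_smul_app]
    rw [← LDual.map_add]; congr 1; exact Subtype.ext (mul_add _ _ _)
  zero_smul γ := LDual.ext fun j => by
    have h : mulR j ((0 : S) : Λ) = (0 : S) • j := Subtype.ext (by simp [mulR])
    rw [left_smul_app, h, LDual.map_smul, zero_mul, zero_app]

end LDual

variable (S J)

/-- A dual basis `{pᵢ, γᵢ}` of the left `S`-module `J`. -/
structure DualBasis where
  n : ℕ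
  p : Fin n → J
  γ : Fin n → LDual S J
  sum_smul : ∀ j : J, ∑ i, γ i j • p i = j

theorem DualBasis.nonempty [Module.Finite S J] [Module.Projective S J] : Nonempty (DualBasis S J) := by
  obtain ⟨n, f, g, -, -, hfg⟩ := Module.Finite.exists_comp_eq_id_of_projective S J
  refine ⟨⟨n, fun i => f (Pi.single i 1), fun i => (LinearMap.proj i ∘ₗ g : J →ₗ[S] S), ?_⟩⟩
  intro j
  have h : f (g j) = j := LinearMap.congr_fun hfg j
  conv_rhs => rw [← h, ← Finset.univ_sum_single (g j), _root_.map_sum]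
  refine Finset.sum_congr rfl fun i _ => ?_
  rw [← _root_.map_smul]
  congr 1
  ext k
  by_cases hk : k = i
  · subst hk; simp; rfl
  · simp [hk]

variable {S J} (B : DualBasis S J)

namespace DualBasis

theorem dual_sum (δ : LDual S J) : ∑ j, op (δ (B.p j)) • B.γ j = δ := by
  refine LDual.ext fun q => ?_
  rw [LDual.sum_app]
  conv_rhs => rw [← B.sum_smul q, LDual.map_sum]
  simp [LDual.map_smul]

variable [J.IsTwoSided]

/-- The elements `γ(pⱼ pᵢ)` of `S`. -/
def coef (γ : LDual S J) (i j : Fin B.n) : S := γ (mulR (B.p j) (B.p i : Λ))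

variable {T : Type*} [Ring T] [Algebra K T]

/-- The composition of the comultiplication `*J → *J ⊗ *J`, `γ ↦ ∑ i j, γᵢ ⊗ γⱼ γ(pⱼ pᵢ)`, with the
map `*J ⊗ *J → T` given by `a`, `b` and the multiplication of `T`. -/
def comul (a b : LDual S J →ₗ[K] T) : LDual S J →ₗ[K] T where
  toFun γ := ∑ i, ∑ j, a (B.γ i) * b (op (B.coef γ i j) • B.γ j)
  map_add' γ δ := by
    simp only [coef, LDual.add_app, op_add, add_smul, _root_.map_add, mul_add,
      Finset.sum_add_distrib]
  map_smul' c γ := by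
    have h : ∀ (s : S) (δ : LDual S J), op (c • s) • δ = c • (op s • δ) := by
      intro s δ
      refine LDual.ext fun q => ?_
      change δ q * (c • s) = c • (δ q * s)
      exact mul_smul_comm c (δ q) s
    simp only [coef, LDual.smul_app, h, _root_.map_smul, mul_smul_comm, Finset.smul_sum,
      RingHom.id_apply]

theorem comul_apply (a b : LDual S J →ₗ[K] T) (γ : LDual S J) :
    B.comul a b γ = ∑ i, ∑ j, a (B.γ i) * b (op (B.coef γ i j) • B.γ j) := rfl

theorem comul_right (a b : LDual S J →ₗ[K] T) (s : S) (t : T)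
    (hb : ∀ γ, b (op s • γ) = b γ * t) (γ : LDual S J) :
    B.comul a b (op s • γ) = B.comul a b γ * t := by
  simp only [comul_apply, Finset.sum_mul]
  refine Finset.sum_congr rfl fun i _ => Finset.sum_congr rfl fun j _ => ?_
  rw [mul_assoc, ← hb, smul_smul, ← op_mul]
  rfl

/-- `∑ j, γⱼ γ(pⱼ q) = q γ`, in the form that is used below. -/
theorem sum_coef (γ : LDual S J) (q : J) (b : LDual S J →ₗ[K] T) :
    ∑ j, b (op (γ (mulR (B.p j) (q : Λ))) • B.γ j) =
      ∑ i, ∑ j, b (op (B.coef γ i j) • (B.γ i q • B.γ j)) := by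
  have h1 : ∀ c : S, ∀ i, ∑ j, op (B.coef γ i j) • (c • B.γ j)
      = ∑ j, op (γ (mulR (B.p j) (c * (B.p i : Λ)))) • B.γ j := by
    intro c i
    refine LDual.ext fun x => ?_
    simp only [LDual.sum_app, LDual.op_smul_app, LDual.left_smul_app, coef, ← LDual.map_smul]
    rw [← LDual.map_sum, ← LDual.map_sum]
    congr 1
    refine Subtype.ext ?_
    have e1 := congrArg Subtype.val (B.sum_smul (mulR x (c : Λ)))
    have e2 := congrArg Subtype.val (B.sum_smul x)
    rw [AddSubmonoidClass.coe_finsetSum] at e1 e2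
    rw [AddSubmonoidClass.coe_finsetSum, AddSubmonoidClass.coe_finsetSum]
    have l : ∀ (s : S) (j : J) (a : Λ), ((s • mulR j a : J) : Λ) = (s • j : J).1 * a :=
      fun s j a => (mul_assoc (s : Λ) (j : Λ) a).symm
    simp only [l]
    rw [← Finset.sum_mul, ← Finset.sum_mul, e1, e2]
    simp [mulR, mul_assoc]
  have h2 : ∑ j, op (γ (mulR (B.p j) (q : Λ))) • B.γ j =
      ∑ i, ∑ j, op (B.coef γ i j) • (B.γ i q • B.γ j) := by
    simp only [h1]
    rw [Finset.sum_comm]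
    refine Finset.sum_congr rfl fun j _ => ?_
    rw [← Finset.sum_smul, ← Finset.op_sum, ← LDual.map_sum]
    congr 3
    refine Subtype.ext ?_
    have e := congrArg Subtype.val (B.sum_smul q)
    rw [AddSubmonoidClass.coe_finsetSum] at e ⊢
    simp only [mulR, ← Finset.mul_sum]
    rw [← e]
    rfl
  rw [← _root_.map_sum, h2]
  simp only [_root_.map_sum]

theorem comul_left (a b : LDual S J →ₗ[K] T) (s : S) (t : T)
    (ha : ∀ γ, a (s • γ) = t * a γ)
    (hab : ∀ (c : S) γ δ, a (op c • γ) * b δ = a γ * b (c • δ)) (γ : LDual S J) :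
    B.comul a b (s • γ) = t * B.comul a b γ := by
  have h1 : ∀ i j, B.coef (s • γ) i j = γ (mulR (B.p j) ((mulR (B.p i) (s : Λ) : J) : Λ)) := by
    intro i j
    simp only [coef, LDual.left_smul_app]
    congr 1
    exact Subtype.ext (mul_assoc _ _ _)
  have h2 : ∀ k, ∑ i, a (op ((s • B.γ k) (B.p i)) • B.γ i) = t * a (B.γ k) := by
    intro k
    rw [← _root_.map_sum, B.dual_sum, ha]
  simp only [comul_apply, h1, ← Finset.mul_sum, sum_coef]
  rw [Finset.mul_sum]
  simp only [← mul_assoc, ← h2, Finset.sum_mul, Finset.mul_sum]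
  rw [Finset.sum_comm]
  refine Finset.sum_congr rfl fun k _ => ?_
  rw [Finset.sum_comm]
  refine Finset.sum_congr rfl fun j _ => Finset.sum_congr rfl fun i _ => ?_
  rw [hab]
  rfl

theorem coassoc (a b c : LDual S J →ₗ[K] T)
    (hbc : ∀ (s : S) γ δ, b (op s • γ) * c δ = b γ * c (s • δ)) (γ : LDual S J) :
    ∑ i, ∑ j, B.comul a b (B.γ i) * c (op (B.coef γ i j) • B.γ j) =
      ∑ i, ∑ j, a (B.γ i) * B.comul b c (op (B.coef γ i j) • B.γ j) := by
  have hR : ∀ i, ∑ j, a (B.γ i) * B.comul b c (op (B.coef γ i j) • B.γ j) =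
      ∑ t, a (B.γ i) * (b (B.γ t) *
        ∑ j, c (op (γ (mulR (B.p j) ((mulR (B.p t) (B.p i : Λ) : J) : Λ))) • B.γ j)) := by
    intro i
    rw [← Finset.mul_sum, ← _root_.map_sum, ← Finset.mul_sum, comul_apply]
    congr 1
    refine Finset.sum_congr rfl fun t _ => ?_
    rw [← Finset.mul_sum]
    congr 1
    refine Finset.sum_congr rfl fun j _ => ?_
    congr 3
    rw [coef, LDual.sum_app]
    simp only [LDual.op_smul_app, coef, ← LDual.map_smul]
    rw [← LDual.map_sum]
    congr 1
    refine Subtype.ext ?_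
    have e := congrArg Subtype.val (B.sum_smul (mulR (B.p j) (B.p t : Λ)))
    rw [AddSubmonoidClass.coe_finsetSum] at e ⊢
    have l : ∀ (s : S) (j : J) (a : Λ), ((s • mulR j a : J) : Λ) = (s • j : J).1 * a :=
      fun s j a => (mul_assoc (s : Λ) (j : Λ) a).symm
    simp only [l]
    rw [← Finset.sum_mul, e]
    exact mul_assoc _ _ _
  rw [Finset.sum_congr rfl fun i _ => hR i]
  have hL : ∀ i j, B.comul a b (B.γ i) * c (op (B.coef γ i j) • B.γ j) =
      ∑ r, ∑ t, a (B.γ r) * (b (B.γ t) *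
        c (op (B.coef γ i j) • (B.γ i (mulR (B.p t) (B.p r : Λ)) • B.γ j))) := by
    intro i j
    simp only [comul_apply, Finset.sum_mul, mul_assoc, hbc]
    rfl
  simp only [hL, sum_coef, Finset.mul_sum]
  rw [Finset.sum_congr rfl fun i _ => Finset.sum_comm, Finset.sum_comm]
  refine Finset.sum_congr rfl fun r _ => ?_
  rw [Finset.sum_congr rfl fun i _ => Finset.sum_comm, Finset.sum_comm]

end DualBasis

end Drozd
end EqPoset

namespace EqPoset

section Pull

/-- The bimodule obtained from an `S`-`S`-bimodule `B` by letting a ring `R` act on the left through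
`f : R → S` and on the right through `g : R → S`. -/
def Pull {R S : Type*} [Ring R] [Ring S] (_f _g : R →+* S) (B : Type*) : Type _ := B

variable {R S : Type*} [Ring R] [Ring S] (f g : R →+* S) (B : Type*) [AddCommGroup B]

instance : AddCommGroup (Pull f g B) := inferInstanceAs (AddCommGroup B)
instance {K : Type*} [Field K] [Module K B] : Module K (Pull f g B) := inferInstanceAs (Module K B)
instance [Module S B] : Module R (Pull f g B) := Module.compHom B f
instance [Module Sᵐᵒᵖ B] : Module Rᵐᵒᵖ (Pull f g B) := Module.compHom B (RingHom.op g)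

end Pull

section Drozd

open TensorRing

variable {K Λ : Type*} [Field K] [Ring Λ] [Algebra K Λ] (S : Subalgebra K Λ) (J : Ideal Λ)
  [J.IsTwoSided]

/-- The bimodule `W₀ = w₁₂ *J` over `S × S`. -/
abbrev DrozdW₀ : Type _ := Pull (RingHom.fst S S) (RingHom.snd S S) (LDual S J)

/-- The bimodule `W₁ = w₁ *J ⊕ w₂ *J` over `S × S`. -/
abbrev DrozdW₁ : Type _ :=
  Pull (RingHom.fst S S) (RingHom.fst S S) (LDual S J) ×
    Pull (RingHom.snd S S) (RingHom.snd S S) (LDual S J)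

/-- The graded tensor algebra of the Drozd ditalgebra. -/
abbrev DrozdRing : Type _ := TensorRing K (S × S) (DrozdW₀ S J) (DrozdW₁ S J)

/-- `γ ↦ w₁₂ γ`. -/
noncomputable def drozdW₁₂ : LDual S J →ₗ[K] DrozdRing S J where
  toFun γ := ofW K (S × S) (DrozdW₀ S J) (DrozdW₁ S J) (γ, 0)
  map_add' γ δ := by rw [← map_add]; exact congrArg _ (Prod.ext rfl (add_zero 0).symm)
  map_smul' c γ := by
    rw [RingHom.id_apply, ← map_smul]; exact congrArg _ (Prod.ext rfl (smul_zero c).symm)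

/-- `γ ↦ w₁ γ`. -/
noncomputable def drozdW₁₁ : LDual S J →ₗ[K] DrozdRing S J where
  toFun γ := ofW K (S × S) (DrozdW₀ S J) (DrozdW₁ S J) (0, (γ, 0))
  map_add' γ δ := by
    rw [← map_add]
    exact congrArg _ (Prod.ext (add_zero 0).symm (Prod.ext rfl (add_zero 0).symm))
  map_smul' c γ := by
    rw [RingHom.id_apply, ← map_smul]
    exact congrArg _ (Prod.ext (smul_zero c).symm (Prod.ext rfl (smul_zero c).symm))

/-- `γ ↦ w₂ γ`. -/
noncomputable def drozdW₂₂ : LDual S J →ₗ[K] DrozdRing S J where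
  toFun γ := ofW K (S × S) (DrozdW₀ S J) (DrozdW₁ S J) (0, (0, γ))
  map_add' γ δ := by
    rw [← map_add]
    exact congrArg _ (Prod.ext (add_zero 0).symm (Prod.ext (add_zero 0).symm rfl))
  map_smul' c γ := by
    rw [RingHom.id_apply, ← map_smul]
    exact congrArg _ (Prod.ext (smul_zero c).symm (Prod.ext (smul_zero c).symm rfl))

theorem drozd_ofW (w : DrozdW₀ S J × DrozdW₁ S J) :
    ofW K (S × S) (DrozdW₀ S J) (DrozdW₁ S J) w =
      drozdW₁₂ S J w.1 + drozdW₁₁ S J w.2.1 + drozdW₂₂ S J w.2.2 := by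
  change _ = ofW K _ _ _ _ + ofW K _ _ _ _ + ofW K _ _ _ _
  rw [← map_add, ← map_add]
  congr 1
  refine Prod.ext ?_ (Prod.ext ?_ ?_) <;> simp

section rules

theorem mul_balanced {T : Type*} [Ring T] {x t y x' y' : T} (h : x * t = x') (h' : t * y = y') :
    x' * y = x * y' := by
  rw [← h, ← h', mul_assoc]

variable {S J} (r : S × S) (s : S) (γ δ : LDual S J)

theorem drozd_l₁₂ : ofR K (S × S) (DrozdW₀ S J) (DrozdW₁ S J) r * drozdW₁₂ S J γ =
    drozdW₁₂ S J (r.1 • γ) :=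
  (ofR_mul_ofW _ _).trans (congrArg _ (Prod.ext rfl (smul_zero _)))

theorem drozd_r₁₂ : drozdW₁₂ S J γ * ofR K (S × S) (DrozdW₀ S J) (DrozdW₁ S J) r =
    drozdW₁₂ S J (op r.2 • γ) :=
  (ofW_mul_ofR _ _).trans (congrArg _ (Prod.ext rfl (smul_zero _)))

theorem drozd_l₁₁ : ofR K (S × S) (DrozdW₀ S J) (DrozdW₁ S J) r * drozdW₁₁ S J γ =
    drozdW₁₁ S J (r.1 • γ) :=
  (ofR_mul_ofW _ _).trans (congrArg _ (Prod.ext (smul_zero _) (Prod.ext rfl (smul_zero _))))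

theorem drozd_r₁₁ : drozdW₁₁ S J γ * ofR K (S × S) (DrozdW₀ S J) (DrozdW₁ S J) r =
    drozdW₁₁ S J (op r.1 • γ) :=
  (ofW_mul_ofR _ _).trans (congrArg _ (Prod.ext (smul_zero _) (Prod.ext rfl (smul_zero _))))

theorem drozd_l₂₂ : ofR K (S × S) (DrozdW₀ S J) (DrozdW₁ S J) r * drozdW₂₂ S J γ =
    drozdW₂₂ S J (r.2 • γ) :=
  (ofR_mul_ofW _ _).trans (congrArg _ (Prod.ext (smul_zero _) (Prod.ext (smul_zero _) rfl)))

theorem drozd_r₂₂ : drozdW₂₂ S J γ * ofR K (S × S) (DrozdW₀ S J) (DrozdW₁ S J) r =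
    drozdW₂₂ S J (op r.2 • γ) :=
  (ofW_mul_ofR _ _).trans (congrArg _ (Prod.ext (smul_zero _) (Prod.ext (smul_zero _) rfl)))

theorem drozd_b1 : drozdW₁₁ S J (op s • γ) * drozdW₁₂ S J δ =
    drozdW₁₁ S J γ * drozdW₁₂ S J (s • δ) :=
  mul_balanced (drozd_r₁₁ (s, (0 : S)) γ) (drozd_l₁₂ (s, (0 : S)) δ)

theorem drozd_b2 : drozdW₁₂ S J (op s • γ) * drozdW₂₂ S J δ =
    drozdW₁₂ S J γ * drozdW₂₂ S J (s • δ) :=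
  mul_balanced (drozd_r₁₂ ((0 : S), s) γ) (drozd_l₂₂ ((0 : S), s) δ)

theorem drozd_b3 : drozdW₁₁ S J (op s • γ) * drozdW₁₁ S J δ =
    drozdW₁₁ S J γ * drozdW₁₁ S J (s • δ) :=
  mul_balanced (drozd_r₁₁ (s, (0 : S)) γ) (drozd_l₁₁ (s, (0 : S)) δ)

theorem drozd_b4 : drozdW₂₂ S J (op s • γ) * drozdW₂₂ S J δ =
    drozdW₂₂ S J γ * drozdW₂₂ S J (s • δ) :=
  mul_balanced (drozd_r₂₂ ((0 : S), s) γ) (drozd_l₂₂ ((0 : S), s) δ)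

end rules

variable {S J}

section gens

variable {T : Type*} [Ring T] [Algebra K T] (B : DualBasis S J) (a b c : LDual S J →ₗ[K] T)

/-- The sum of `∑ a(x¹) c(x²) - ∑ b(x¹) a(x²)`, `- ∑ b(y¹) b(y²)` and `- ∑ c(z¹) c(z²)`, where
`∑ γ¹ ⊗ γ²` is the image of `γ` under the comultiplication of `*J`. -/
noncomputable def drozdGen (x y z : LDual S J) : T :=
  (B.comul a c x - B.comul b a x) - B.comul b b y - B.comul c c z

variable (x y z x' y' z' : LDual S J)

theorem drozdGen_add : drozdGen B a b c (x + x') (y + y') (z + z') =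
    drozdGen B a b c x y z + drozdGen B a b c x' y' z' := by
  simp only [drozdGen, map_add]
  abel

theorem drozdGen_smul (k : K) :
    drozdGen B a b c (k • x) (k • y) (k • z) = k • drozdGen B a b c x y z := by
  simp only [drozdGen, map_smul, smul_sub]

theorem drozdGen_left (r s : S) (t : T) (ha : ∀ γ, a (r • γ) = t * a γ)
    (hb : ∀ γ, b (r • γ) = t * b γ) (hc : ∀ γ, c (s • γ) = t * c γ)
    (hbb : ∀ (s : S) γ δ, b (op s • γ) * b δ = b γ * b (s • δ))
    (hba : ∀ (s : S) γ δ, b (op s • γ) * a δ = b γ * a (s • δ))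
    (hac : ∀ (s : S) γ δ, a (op s • γ) * c δ = a γ * c (s • δ))
    (hcc : ∀ (s : S) γ δ, c (op s • γ) * c δ = c γ * c (s • δ)) :
    drozdGen B a b c (r • x) (r • y) (s • z) = t * drozdGen B a b c x y z := by
  simp only [drozdGen]
  rw [B.comul_left _ _ r t ha hac, B.comul_left _ _ r t hb hba, B.comul_left _ _ r t hb hbb,
    B.comul_left _ _ s t hc hcc, mul_sub, mul_sub, mul_sub]

theorem drozdGen_right (r s : S) (t : T) (ha : ∀ γ, a (op s • γ) = a γ * t)
    (hb : ∀ γ, b (op r • γ) = b γ * t) (hc : ∀ γ, c (op s • γ) = c γ * t) :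
    drozdGen B a b c (op s • x) (op r • y) (op s • z) = drozdGen B a b c x y z * t := by
  simp only [drozdGen]
  rw [B.comul_right _ _ s t hc, B.comul_right _ _ s t ha, B.comul_right _ _ r t hb,
    B.comul_right _ _ s t hc, sub_mul, sub_mul, sub_mul]

theorem drozdGen₁₂ : drozdGen B a b c x 0 0 = B.comul a c x - B.comul b a x := by
  simp only [drozdGen, map_zero, sub_zero]

theorem drozdGen₁₁ : drozdGen B a b c 0 y 0 = - B.comul b b y := by
  simp only [drozdGen, map_zero, sub_zero, zero_sub]

theorem drozdGen₂₂ : drozdGen B a b c 0 0 z = - B.comul c c z := by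
  simp only [drozdGen, map_zero, sub_zero, zero_sub]

end gens

/-- The differential of the Drozd ditalgebra on `W`: if `∑ γ¹ ⊗ γ²` is the image of `γ`
under the comultiplication of `*J`, then `w₁₂ γ ↦ ∑ (w₁₂ γ¹) (w₂ γ²) - ∑ (w₁ γ¹) (w₁₂ γ²)`,
`w₁ γ ↦ - ∑ (w₁ γ¹) (w₁ γ²)` and `w₂ γ ↦ - ∑ (w₂ γ¹) (w₂ γ²)`. -/
noncomputable def drozdDW (B : DualBasis S J) :
    (DrozdW₀ S J × DrozdW₁ S J) →ₗ[K] DrozdRing S J where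
  toFun w := drozdGen B (drozdW₁₂ S J) (drozdW₁₁ S J) (drozdW₂₂ S J) w.1 w.2.1 w.2.2
  map_add' v w := drozdGen_add B _ _ _ v.1 v.2.1 v.2.2 w.1 w.2.1 w.2.2
  map_smul' c w := drozdGen_smul B _ _ _ w.1 w.2.1 w.2.2 c

theorem drozdDW_left (B : DualBasis S J) (r : S × S) (w : DrozdW₀ S J × DrozdW₁ S J) :
    drozdDW B (r • w) = ofR K _ _ _ r * drozdDW B w :=
  drozdGen_left B _ _ _ w.1 w.2.1 w.2.2 r.1 r.2 _ (fun γ => (drozd_l₁₂ r γ).symm)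
    (fun γ => (drozd_l₁₁ r γ).symm) (fun γ => (drozd_l₂₂ r γ).symm)
    drozd_b3 drozd_b1 drozd_b2 drozd_b4

theorem drozdDW_right (B : DualBasis S J) (r : S × S) (w : DrozdW₀ S J × DrozdW₁ S J) :
    drozdDW B (op r • w) = drozdDW B w * ofR K _ _ _ r :=
  drozdGen_right B _ _ _ w.1 w.2.1 w.2.2 r.1 r.2 _ (fun γ => (drozd_r₁₂ r γ).symm)
    (fun γ => (drozd_r₁₁ r γ).symm) (fun γ => (drozd_r₂₂ r γ).symm)

theorem comul_mem {B : DualBasis S J} {m n : ℕ} {a b : LDual S J →ₗ[K] DrozdRing S J}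
    (ha : ∀ γ, a γ ∈ deg K (S × S) (DrozdW₀ S J) (DrozdW₁ S J) m)
    (hb : ∀ γ, b γ ∈ deg K (S × S) (DrozdW₀ S J) (DrozdW₁ S J) n) (γ : LDual S J) :
    B.comul a b γ ∈ deg K (S × S) (DrozdW₀ S J) (DrozdW₁ S J) (m + n) := by
  rw [B.comul_apply]
  exact sum_mem fun i _ => sum_mem fun j _ => mul_mem_deg (ha _) (hb _)

theorem drozdW₁₂_mem (γ : LDual S J) :
    drozdW₁₂ S J γ ∈ deg K (S × S) (DrozdW₀ S J) (DrozdW₁ S J) 0 :=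
  Submodule.subset_span (IsHomogeneous.ofW₀ _)

theorem drozdW₁₁_mem (γ : LDual S J) :
    drozdW₁₁ S J γ ∈ deg K (S × S) (DrozdW₀ S J) (DrozdW₁ S J) 1 :=
  Submodule.subset_span (IsHomogeneous.ofW₁ _)

theorem drozdW₂₂_mem (γ : LDual S J) :
    drozdW₂₂ S J γ ∈ deg K (S × S) (DrozdW₀ S J) (DrozdW₁ S J) 1 :=
  Submodule.subset_span (IsHomogeneous.ofW₁ _)

theorem drozdDW_mem₀ (B : DualBasis S J) (w : DrozdW₀ S J) :
    drozdDW B (w, 0) ∈ deg K (S × S) (DrozdW₀ S J) (DrozdW₁ S J) 1 := by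
  have h : drozdDW B (w, 0) = _ := drozdGen₁₂ B _ _ _ w
  rw [h]
  exact sub_mem (comul_mem drozdW₁₂_mem drozdW₂₂_mem _) (comul_mem drozdW₁₁_mem drozdW₁₂_mem _)

theorem drozdDW_mem₁ (B : DualBasis S J) (w : DrozdW₁ S J) :
    drozdDW B (0, w) ∈ deg K (S × S) (DrozdW₀ S J) (DrozdW₁ S J) 2 := by
  have e : ((0, w) : DrozdW₀ S J × DrozdW₁ S J) = (0, (w.1, 0)) + (0, (0, w.2)) := by
    refine Prod.ext (add_zero 0).symm (Prod.ext ?_ ?_)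
    · exact (add_zero w.1).symm
    · exact (zero_add w.2).symm
  have h1 : drozdDW B (0, (w.1, 0)) = _ := drozdGen₁₁ B _ _ _ w.1
  have h2 : drozdDW B (0, (0, w.2)) = _ := drozdGen₂₂ B _ _ _ w.2
  rw [e, map_add, h1, h2]
  exact add_mem (neg_mem (comul_mem drozdW₁₁_mem drozdW₁₁_mem _))
    (neg_mem (comul_mem drozdW₂₂_mem drozdW₂₂_mem _))

theorem leibniz_zero {T : Type*} [Ring T] {z u x v y : T} (h : z = u * y + (-1) ^ 0 * x * v) :
    z = u * y + x * v := by
  rw [h, pow_zero, one_mul]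

theorem leibniz_one {T : Type*} [Ring T] {z u x v y : T} (h : z = u * y + (-1) ^ 1 * x * v) :
    z = u * y - x * v := by
  rw [h, pow_one, neg_one_mul, neg_mul, ← sub_eq_add_neg]

theorem drozd_sq {T : Type*} [Ring T] [Algebra K T] (B : DualBasis S J) (d : T →ₗ[K] T)
    (a b c : LDual S J →ₗ[K] T)
    (hbb : ∀ (s : S) γ δ, b (op s • γ) * b δ = b γ * b (s • δ))
    (hba : ∀ (s : S) γ δ, b (op s • γ) * a δ = b γ * a (s • δ))
    (hac : ∀ (s : S) γ δ, a (op s • γ) * c δ = a γ * c (s • δ))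
    (hcc : ∀ (s : S) γ δ, c (op s • γ) * c δ = c γ * c (s • δ))
    (d12 : ∀ γ, d (a γ) = B.comul a c γ - B.comul b a γ)
    (d11 : ∀ γ, d (b γ) = - B.comul b b γ)
    (d22 : ∀ γ, d (c γ) = - B.comul c c γ)
    (m0 : ∀ γ y, d (a γ * y) = d (a γ) * y + a γ * d y)
    (m1 : ∀ γ y, d (b γ * y) = d (b γ) * y - b γ * d y)
    (m2 : ∀ γ y, d (c γ * y) = d (c γ) * y - c γ * d y) :
    (∀ γ, d (d (a γ)) = 0) ∧ (∀ γ, d (d (b γ)) = 0) ∧ (∀ γ, d (d (c γ)) = 0) := by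
  have c1 := B.coassoc a c c hcc
  have c2 := B.coassoc b a c hac
  have c3 := B.coassoc b b a hba
  have c4 := B.coassoc b b b hbb
  have c5 := B.coassoc c c c hcc
  refine ⟨fun γ => ?_, fun γ => ?_, fun γ => ?_⟩
  · rw [d12, map_sub, B.comul_apply, B.comul_apply]
    simp only [map_sum, m0, m1, d12, d11, d22, sub_mul, mul_sub, neg_mul, mul_neg,
      Finset.sum_add_distrib, Finset.sum_sub_distrib, Finset.sum_neg_distrib, c1, c2, c3]
    abel
  · rw [d11, map_neg, B.comul_apply]
    simp only [map_sum, m1, d11, neg_mul, mul_neg, sub_neg_eq_add,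
      Finset.sum_add_distrib, Finset.sum_neg_distrib, c4]
    abel
  · rw [d22, map_neg, B.comul_apply]
    simp only [map_sum, m2, d22, neg_mul, mul_neg, sub_neg_eq_add,
      Finset.sum_add_distrib, Finset.sum_neg_distrib, c5]
    abel

theorem drozd_exists (B : DualBasis S J) :
    ∃ D : Ditalgebra K (S × S) (DrozdW₀ S J) (DrozdW₁ S J),
      ∀ w, D.d (ofW K _ _ _ w) = drozdDW B w := by
  obtain ⟨d, h1, h2, h3, h4⟩ := exists_differential (drozdDW B) (drozdDW_left B) (drozdDW_right B)
    (drozdDW_mem₀ B) (drozdDW_mem₁ B)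
  have d12 : ∀ γ, d (drozdW₁₂ S J γ) = B.comul (drozdW₁₂ S J) (drozdW₂₂ S J) γ
      - B.comul (drozdW₁₁ S J) (drozdW₁₂ S J) γ := fun γ => (h4 _).trans (drozdGen₁₂ B _ _ _ γ)
  have d11 : ∀ γ, d (drozdW₁₁ S J γ) = - B.comul (drozdW₁₁ S J) (drozdW₁₁ S J) γ :=
    fun γ => (h4 _).trans (drozdGen₁₁ B _ _ _ γ)
  have d22 : ∀ γ, d (drozdW₂₂ S J γ) = - B.comul (drozdW₂₂ S J) (drozdW₂₂ S J) γ :=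
    fun γ => (h4 _).trans (drozdGen₂₂ B _ _ _ γ)
  obtain ⟨e12, e11, e22⟩ := drozd_sq B d _ _ _ drozd_b3 drozd_b1 drozd_b2 drozd_b4 d12 d11 d22
    (fun γ y => leibniz_zero (h3 0 _ (drozdW₁₂_mem γ) y))
    (fun γ y => leibniz_one (h3 1 _ (drozdW₁₁_mem γ) y))
    (fun γ y => leibniz_one (h3 1 _ (drozdW₂₂_mem γ) y))
  refine ⟨⟨d, h1, h2, h3, sq_eq_zero d h1 h2 h3 fun w => ?_⟩, h4⟩
  rw [drozd_ofW, map_add, map_add, map_add, map_add]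
  refine (congrArg₂ (· + ·) (congrArg₂ (· + ·) (e12 w.1) (e11 w.2.1)) (e22 w.2.2)).trans ?_
  simp

/-- The Drozd ditalgebra of `Λ = S ⊕ J`: the ditalgebra with `R = S × S`, `W₀ = w₁₂ *J` and
`W₁ = w₁ *J ⊕ w₂ *J`, whose differential on the generators is given by the comultiplication
of `*J`. -/
noncomputable def drozd (B : DualBasis S J) : Ditalgebra K (S × S) (DrozdW₀ S J) (DrozdW₁ S J) :=
  Classical.choose (drozd_exists B)

theorem drozd_d_ofW (B : DualBasis S J) (w : DrozdW₀ S J × DrozdW₁ S J) :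
    (drozd B).d (ofW K _ _ _ w) = drozdDW B w :=
  Classical.choose_spec (drozd_exists B) w

end Drozd
end EqPoset

namespace EqPoset

open scoped IntermediateField

section Alg

variable {K L : Type*} [Field K] [Field L] [Algebra K L]

/-- The algebra `A` that is opposite to the algebra of `K`-linear endomorphisms of `L`.  So `L` is a
right `A`-module and the product `f g` in `A` is `f` followed by `g`. -/
abbrev Alg (K L : Type*) [Field K] [Field L] [Algebra K L] : Type _ := (Module.End K L)ᵐᵒᵖ

theorem alg_ext {f g : Alg K L} (h : ∀ b, f.unop b = g.unop b) : f = g :=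
  unop_injective (LinearMap.ext h)

theorem unop_mul_apply (f g : Alg K L) (b : L) : (f * g).unop b = g.unop (f.unop b) := rfl

end Alg

section Equipment

variable {K L : Type*} [Field K] [Field L] [Algebra K L] [FiniteDimensional K L]

theorem algebraAdjoin_eq_top (F : IntermediateField K L) {ξ : L} (h : K⟮ξ⟯ = ⊤) :
    Algebra.adjoin F {ξ} = ⊤ := by
  have h1 : (Algebra.adjoin K {ξ} : Subalgebra K L) = ⊤ := by
    rw [← IntermediateField.adjoin_simple_toSubalgebra_of_isAlgebraic
      (Algebra.IsAlgebraic.isAlgebraic ξ), h, IntermediateField.top_toSubalgebra]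
  refine eq_top_iff.2 fun x _ => ?_
  have hx : x ∈ Algebra.adjoin K {ξ} := h1 ▸ Algebra.mem_top
  have h2 : Algebra.adjoin K {ξ} ≤ (Algebra.adjoin F {ξ}).restrictScalars K :=
    Algebra.adjoin_le Algebra.subset_adjoin
  exact h2 hx

/-- The powers of `ξ`, as a basis of `L` over an intermediate field `F`. -/
noncomputable def powerBasisOver (F : IntermediateField K L) (ξ : L) (h : K⟮ξ⟯ = ⊤) :
    PowerBasis F L :=
  PowerBasis.ofAdjoinEqTop (Algebra.IsIntegral.isIntegral ξ) (algebraAdjoin_eq_top F h)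

/-- The projection of `L = F ⊕ ξ F ⊕ ξ² F ⊕ ⋯` onto `F`. -/
noncomputable def proj (F : IntermediateField K L) (ξ : L) (h : K⟮ξ⟯ = ⊤) : L →ₗ[F] F :=
  (powerBasisOver F ξ h).basis.coord ⟨0, (powerBasisOver F ξ h).dim_pos⟩

theorem proj_one (F : IntermediateField K L) (ξ : L) (h : K⟮ξ⟯ = ⊤) : proj F ξ h 1 = 1 := by
  have e : (powerBasisOver F ξ h).basis ⟨0, (powerBasisOver F ξ h).dim_pos⟩ = 1 := by simp
  conv_lhs => rw [← e]
  simp only [proj, Module.Basis.coord_apply, Module.Basis.repr_self, Finsupp.single_eq_same]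

theorem proj_mul (F : IntermediateField K L) (ξ : L) (h : K⟮ξ⟯ = ⊤) (c : F) (b : L) :
    proj F ξ h (c * b) = c * proj F ξ h b :=
  (proj F ξ h).map_smul c b

theorem proj_coe (F : IntermediateField K L) (ξ : L) (h : K⟮ξ⟯ = ⊤) (c : F) :
    proj F ξ h c = c := by
  have h1 := proj_mul F ξ h c 1
  rwa [mul_one, proj_one, mul_one] at h1

/-- A poset `P` that is equipped with a multiplicative system of subspaces `T x y` (`x ≤ y`) of the
algebra `A`, such that `T x x` is the set of the endomorphisms of `L` that are linear over an
intermediate field `K(x)`.  A generator `ξ` of `L` over `K` is fixed. -/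
structure AlgEquipment (K L P : Type*) [Field K] [Field L] [Algebra K L] [PartialOrder P] where
  ξ : L
  adjoin_ξ : K⟮ξ⟯ = ⊤
  T : P → P → Submodule K (Alg K L)
  fld : P → IntermediateField K L
  mul_mem : ∀ {x y z : P}, x ≤ y → y ≤ z → ∀ {f g : Alg K L}, f ∈ T x y → g ∈ T y z → f * g ∈ T x z
  mem_self : ∀ (x : P) (f : Module.End K L), op f ∈ T x x ↔ ∀ c ∈ fld x, ∀ b, f (c * b) = c * f b

variable {P : Type*} [PartialOrder P]

/-- The equipment of `{0} ∪ P ∪ {m}`, where `0` (here `⊥`) is a new minimum and `m` (here `⊤`) is a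
new maximum, with `T 0 x = T x m = A` and `K(0) = K(m) = K`. -/
def AlgEquipment.ext (E : AlgEquipment K L P) : AlgEquipment K L (WithBot (WithTop P)) where
  ξ := E.ξ
  adjoin_ξ := E.adjoin_ξ
  T
    | some (some x), some (some y) => E.T x y
    | _, _ => ⊤
  fld
    | some (some x) => E.fld x
    | _ => ⊥
  mul_mem {x y z} hxy hyz {f g} hf hg := by
    match x, y, z with
    | some (some x), some (some y), some (some z) =>
      exact E.mul_mem (WithTop.coe_le_coe.1 (WithBot.coe_le_coe.1 hxy))
        (WithTop.coe_le_coe.1 (WithBot.coe_le_coe.1 hyz)) hf hg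
    | some (some x), none, some (some z) => exact absurd hxy (WithBot.not_coe_le_bot _)
    | some (some x), some none, some (some z) =>
      exact absurd (WithBot.coe_le_coe.1 hyz) (WithTop.not_top_le_coe _)
    | none, _, _ => exact Submodule.mem_top
    | some none, _, _ => exact Submodule.mem_top
    | some (some x), _, none => exact Submodule.mem_top
    | some (some x), _, some none => exact Submodule.mem_top
  mem_self x f := by
    have key : op f ∈ (⊤ : Submodule K (Alg K L)) ↔
        ∀ c ∈ (⊥ : IntermediateField K L), ∀ b, f (c * b) = c * f b := by
      refine ⟨fun _ c hc b => ?_, fun _ => Submodule.mem_top⟩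
      obtain ⟨k, rfl⟩ := IntermediateField.mem_bot.1 hc
      rw [← Algebra.smul_def, ← Algebra.smul_def, map_smul]
    match x with
    | some (some x) => exact E.mem_self x f
    | none => exact key
    | some none => exact key

namespace AlgEquipment

variable (E : AlgEquipment K L P)

/-- The element `φ⁻¹(c) = ε μ_c ε` of `A`, where `ε` is the projection of `L` onto `K(x)`, regarded
as an endomorphism of `L`, and `μ_c` is the multiplication by `c`. -/
noncomputable def phi (x : P) (c : E.fld x) : Alg K L :=
  op (((E.fld x).val.toLinearMap ∘ₗ (proj (E.fld x) E.ξ E.adjoin_ξ).restrictScalars K) ∘ₗ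
    LinearMap.mulLeft K (c : L) ∘ₗ
    ((E.fld x).val.toLinearMap ∘ₗ (proj (E.fld x) E.ξ E.adjoin_ξ).restrictScalars K))

/-- The projection `ε` of `L` onto `K(x)`, as an element of `A`. -/
noncomputable def eps (x : P) : Alg K L :=
  op ((E.fld x).val.toLinearMap ∘ₗ (proj (E.fld x) E.ξ E.adjoin_ξ).restrictScalars K)

theorem unop_eps (x : P) (b : L) : (E.eps x).unop b = proj (E.fld x) E.ξ E.adjoin_ξ b := rfl

theorem unop_phi (x : P) (c : E.fld x) (b : L) :
    (E.phi x c).unop b = c * proj (E.fld x) E.ξ E.adjoin_ξ b := by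
  have h := proj_coe (E.fld x) E.ξ E.adjoin_ξ (c * proj (E.fld x) E.ξ E.adjoin_ξ b)
  exact congrArg Subtype.val h

theorem phi_one (x : P) : E.phi x 1 = E.eps x :=
  alg_ext fun b => by rw [unop_phi, unop_eps]; simp

theorem phi_add (x : P) (c d : E.fld x) : E.phi x (c + d) = E.phi x c + E.phi x d :=
  alg_ext fun b => by
    rw [unop_add, LinearMap.add_apply, unop_phi, unop_phi, unop_phi]; push_cast; ring

theorem phi_mul (x : P) (c d : E.fld x) : E.phi x (c * d) = E.phi x c * E.phi x d :=
  alg_ext fun b => by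
    have h := proj_coe (E.fld x) E.ξ E.adjoin_ξ (c * proj (E.fld x) E.ξ E.adjoin_ξ b)
    push_cast at h
    rw [unop_mul_apply, unop_phi, unop_phi, unop_phi, h]; push_cast; ring

theorem phi_zero (x : P) : E.phi x 0 = 0 :=
  alg_ext fun b => by rw [unop_phi]; simp

theorem phi_smul (x : P) (k : K) (c : E.fld x) : E.phi x (k • c) = k • E.phi x c :=
  alg_ext fun b => by
    rw [unop_smul, LinearMap.smul_apply, unop_phi, unop_phi, Algebra.smul_def, Algebra.smul_def]
    push_cast
    rw [mul_assoc]

theorem phi_mem (x : P) (c : E.fld x) : E.phi x c ∈ E.T x x := by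
  refine (E.mem_self x (E.phi x c).unop).2 fun a ha b => ?_
  have h := proj_mul (E.fld x) E.ξ E.adjoin_ξ ⟨a, ha⟩ b
  rw [unop_phi, unop_phi]
  dsimp only at h
  rw [h]
  push_cast
  ring

/-- The space `R x y = ε T x y ε'`, where `ε` and `ε'` are the projections of `L` onto `K(x)` and
`K(y)`, for `x ≤ y`; it is zero if `x ≤ y` does not hold. -/
noncomputable def R (x y : P) : Submodule K (Alg K L) :=
  haveI := Classical.propDecidable (x ≤ y)
  if x ≤ y then (E.T x y).map (LinearMap.mulLeft K (E.eps x) ∘ₗ LinearMap.mulRight K (E.eps y))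
  else ⊥

theorem mem_R_of_le {x y : P} (h : x ≤ y) {f : Alg K L} :
    f ∈ E.R x y ↔ ∃ t ∈ E.T x y, E.eps x * (t * E.eps y) = f := by
  rw [R, if_pos h]
  rfl

theorem mem_R_of_not_le {x y : P} (h : ¬ x ≤ y) {f : Alg K L} : f ∈ E.R x y ↔ f = 0 := by
  rw [R, if_neg h]
  rfl

theorem eps_mul_eps (x : P) : E.eps x * E.eps x = E.eps x := by
  rw [← phi_one, ← phi_mul, mul_one]

theorem eps_mul {x y : P} {f : Alg K L} (hf : f ∈ E.R x y) : E.eps x * f = f := by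
  by_cases h : x ≤ y
  · obtain ⟨t, -, rfl⟩ := (E.mem_R_of_le h).1 hf
    rw [← mul_assoc, eps_mul_eps]
  · rw [(E.mem_R_of_not_le h).1 hf, mul_zero]

theorem mul_eps {x y : P} {f : Alg K L} (hf : f ∈ E.R x y) : f * E.eps y = f := by
  by_cases h : x ≤ y
  · obtain ⟨t, -, rfl⟩ := (E.mem_R_of_le h).1 hf
    rw [mul_assoc, mul_assoc, eps_mul_eps]
  · rw [(E.mem_R_of_not_le h).1 hf, zero_mul]

theorem R_mul {x y z : P} {f g : Alg K L} (hf : f ∈ E.R x y) (hg : g ∈ E.R y z) :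
    f * g ∈ E.R x z := by
  by_cases h : x ≤ y
  · by_cases h' : y ≤ z
    · obtain ⟨t, ht, rfl⟩ := (E.mem_R_of_le h).1 hf
      obtain ⟨u, hu, rfl⟩ := (E.mem_R_of_le h').1 hg
      refine (E.mem_R_of_le (h.trans h')).2 ⟨t * E.eps y * u, ?_, ?_⟩
      · refine E.mul_mem h h' (E.mul_mem h le_rfl ht ?_) hu
        rw [← phi_one]
        exact E.phi_mem y 1
      · calc _ = E.eps x * (t * (E.eps y * (u * E.eps z))) := by simp only [mul_assoc]
          _ = E.eps x * (t * ((E.eps y * E.eps y) * (u * E.eps z))) := by rw [eps_mul_eps]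
          _ = _ := by simp only [mul_assoc]
    · rw [(E.mem_R_of_not_le h').1 hg, mul_zero]; exact zero_mem _
  · rw [(E.mem_R_of_not_le h).1 hf, zero_mul]; exact zero_mem _

theorem phi_mem_R (x : P) (c : E.fld x) : E.phi x c ∈ E.R x x := by
  refine (E.mem_R_of_le le_rfl).2 ⟨E.phi x c, E.phi_mem x c, ?_⟩
  rw [← phi_one, ← phi_mul, ← phi_mul, mul_one, one_mul]

/-- The value of an element of `R x y` at `1 ∈ L`, which is an element of `K(y)`. -/
noncomputable def val {x y : P} (f : E.R x y) : E.fld y :=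
  proj (E.fld y) E.ξ E.adjoin_ξ ((f : Alg K L).unop 1)

theorem coe_val {x y : P} (f : E.R x y) : (E.val f : L) = (f : Alg K L).unop 1 := by
  conv_rhs => rw [← E.mul_eps f.2]
  rfl

theorem phi_val {x : P} (f : E.R x x) : E.phi x (E.val f) = f := by
  obtain ⟨t, ht, h⟩ := (E.mem_R_of_le le_rfl).1 f.2
  refine alg_ext fun b => ?_
  have ht' := (E.mem_self x t.unop).1 ht
  have e : ∀ b, (f : Alg K L).unop b = proj (E.fld x) E.ξ E.adjoin_ξ
      (t.unop (proj (E.fld x) E.ξ E.adjoin_ξ b)) := fun b => by rw [← h]; rfl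
  rw [unop_phi, coe_val, e, e, proj_one]
  have h2 := ht' _ (proj (E.fld x) E.ξ E.adjoin_ξ b).2 ((1 : E.fld x) : L)
  have h3 : ((1 : E.fld x) : L) = 1 := rfl
  rw [h3, mul_one] at h2
  rw [h2, proj_mul, h3]
  push_cast
  ring

/-- The right `K(x)`-module structure of `R y x`, given by the isomorphism of `K(x)` with
`R x x`. -/
noncomputable instance (y x : P) : Module (E.fld x) (E.R y x) where
  smul c f := ⟨f * E.phi x c, E.R_mul f.2 (E.phi_mem_R x c)⟩
  one_smul f := Subtype.ext (by
    change (f : Alg K L) * E.phi x 1 = f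
    rw [phi_one, E.mul_eps f.2])
  mul_smul c d f := Subtype.ext (by
    change (f : Alg K L) * E.phi x (c * d) = f * E.phi x d * E.phi x c
    rw [mul_comm c d, phi_mul, mul_assoc])
  smul_zero c := Subtype.ext (zero_mul _)
  smul_add c f g := Subtype.ext (add_mul _ _ _)
  add_smul c d f := Subtype.ext (by
    change (f : Alg K L) * E.phi x (c + d) = f * E.phi x c + f * E.phi x d
    rw [phi_add, mul_add])
  zero_smul f := Subtype.ext (by
    change (f : Alg K L) * E.phi x 0 = 0
    rw [phi_zero, mul_zero])

theorem coe_smul_R {y x : P} (c : E.fld x) (f : E.R y x) :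
    ((c • f : E.R y x) : Alg K L) = f * E.phi x c := rfl

/-- The element `φ⁻¹(f(1))` of `R x x` plays the same role as `f` after the projection of `L`
onto `K`. -/
theorem ext_eps_bot_mul {P : Type*} [PartialOrder P] (E : AlgEquipment K L P)
    {y x : WithBot (WithTop P)} (f : E.ext.R y x) :
    E.ext.eps ⊥ * (f : Alg K L) = E.ext.eps ⊥ * E.ext.phi x (E.ext.val f) := by
  refine alg_ext fun b => ?_
  have hk : (E.ext.eps ⊥).unop b ∈ (⊥ : IntermediateField K L) :=
    (proj (E.ext.fld ⊥) E.ext.ξ E.ext.adjoin_ξ b).2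
  obtain ⟨k, hk⟩ := IntermediateField.mem_bot.1 hk
  have hp : proj (E.ext.fld x) E.ext.ξ E.ext.adjoin_ξ (algebraMap K L k)
      = algebraMap K (E.ext.fld x) k := proj_coe _ _ _ (algebraMap K (E.ext.fld x) k)
  rw [unop_mul_apply, unop_mul_apply, unop_phi, coe_val, ← hk, hp, Algebra.algebraMap_eq_smul_one,
    map_smul, Algebra.smul_def, mul_comm]
  rfl

/-- The map `u : K(y) → K(x)` that is given by an element `τ` of `R y x`: it maps `a` to the value
of `φ⁻¹(a) τ ∈ R y x` at `1 ∈ L`. -/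
noncomputable def uMap {y x : P} (τ : E.R y x) (a : E.fld y) : E.fld x :=
  E.val (⟨E.phi y a * τ, E.R_mul (E.phi_mem_R y a) τ.2⟩ : E.R y x)

end AlgEquipment

end Equipment
end EqPoset

namespace EqPoset

section Lambda

variable {K L : Type*} [Field K] [Field L] [Algebra K L] [FiniteDimensional K L]
variable {P : Type*} [PartialOrder P]

namespace AlgEquipment

variable (E : AlgEquipment K L P)

/-- The space `Λ = ⨁ e_{x y} R x y` of the matrices with entries in the spaces `R x y`. -/
def lamSub : Submodule K (Matrix P P (Alg K L)) where
  carrier := {F | ∀ x y, F x y ∈ E.R x y}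
  add_mem' hF hG x y := add_mem (hF x y) (hG x y)
  zero_mem' _ _ := zero_mem _
  smul_mem' c _ hF x y := Submodule.smul_mem _ c (hF x y)

/-- The algebra `Λ = ⨁ e_{x y} R x y`. -/
def Lam : Type _ := E.lamSub

noncomputable instance : AddCommGroup E.Lam := inferInstanceAs (AddCommGroup E.lamSub)
noncomputable instance : Module K E.Lam := inferInstanceAs (Module K E.lamSub)

variable {E} in
/-- The entry of an element of `Λ` in `R x y`. -/
def Lam.entry (F : E.Lam) (x y : P) : E.R x y := ⟨F.1 x y, F.2 x y⟩

variable {E} in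
theorem Lam.ext {F G : E.Lam} (h : ∀ x y, F.1 x y = G.1 x y) : F = G :=
  Subtype.ext (Matrix.ext h)

variable [Fintype P]

noncomputable instance : Mul E.Lam where
  mul F G := ⟨F.1 * G.1, fun x y => by
    rw [Matrix.mul_apply]
    exact sum_mem fun z _ => E.R_mul (F.2 x z) (G.2 z y)⟩

variable [DecidableEq P]

noncomputable instance : One E.Lam where
  one := ⟨Matrix.diagonal E.eps, fun x y => by
    by_cases h : x = y
    · subst h
      rw [Matrix.diagonal_apply_eq, ← E.phi_one]
      exact E.phi_mem_R x 1
    · rw [Matrix.diagonal_apply_ne _ h]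
      exact zero_mem _⟩

noncomputable instance : Ring E.Lam where
  __ := (inferInstance : AddCommGroup E.Lam)
  mul_assoc F G H := Subtype.ext (Matrix.mul_assoc F.1 G.1 H.1)
  left_distrib F G H := Subtype.ext (Matrix.mul_add F.1 G.1 H.1)
  right_distrib F G H := Subtype.ext (Matrix.add_mul F.1 G.1 H.1)
  zero_mul F := Subtype.ext (Matrix.zero_mul F.1)
  mul_zero F := Subtype.ext (Matrix.mul_zero F.1)
  one_mul F := Lam.ext fun x y => by
    change (Matrix.diagonal E.eps * F.1) x y = F.1 x y
    rw [Matrix.diagonal_mul, E.eps_mul (F.2 x y)]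
  mul_one F := Lam.ext fun x y => by
    change (F.1 * Matrix.diagonal E.eps) x y = F.1 x y
    rw [Matrix.mul_diagonal, E.mul_eps (F.2 x y)]

noncomputable instance : Algebra K E.Lam :=
  Algebra.ofModule (fun c F G => Subtype.ext (Matrix.smul_mul c F.1 G.1))
    (fun c F G => Subtype.ext (Matrix.mul_smul F.1 c G.1))

instance : Module.Finite K E.Lam := inferInstanceAs (Module.Finite K E.lamSub)

/-- The diagonal subalgebra `S = ⨁ e_{x x} R x x` of `Λ`. -/
noncomputable def S : Subalgebra K E.Lam where
  carrier := {F | ∀ x y, x ≠ y → F.1 x y = 0}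
  mul_mem' {F G} hF hG x y h := by
    change (F.1 * G.1) x y = 0
    rw [Matrix.mul_apply]
    refine Finset.sum_eq_zero fun z _ => ?_
    by_cases hz : x = z
    · subst hz; rw [hG x y h, mul_zero]
    · rw [hF x z hz, zero_mul]
  add_mem' {F G} hF hG x y h := by
    change F.1 x y + G.1 x y = 0
    rw [hF x y h, hG x y h, add_zero]
  algebraMap_mem' c x y h := by
    have e : algebraMap K E.Lam c = c • 1 := Algebra.algebraMap_eq_smul_one c
    rw [e]
    change c • (Matrix.diagonal E.eps x y) = 0
    rw [Matrix.diagonal_apply_ne _ h, smul_zero]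

theorem mul_self (F G : E.Lam) (x : P) : (F * G).1 x x = F.1 x x * G.1 x x := by
  change (F.1 * G.1) x x = _
  rw [Matrix.mul_apply]
  refine Finset.sum_eq_single x (fun z _ hz => ?_) (fun h => absurd (Finset.mem_univ x) h)
  by_cases h : x ≤ z
  · have h' : ¬ z ≤ x := fun h' => hz (le_antisymm h' h)
    rw [(E.mem_R_of_not_le h').1 (G.2 z x), mul_zero]
  · rw [(E.mem_R_of_not_le h).1 (F.2 x z), zero_mul]

/-- The ideal `J = ⨁ e_{x y} R x y` (`x < y`) of `Λ`. -/
noncomputable def J : Ideal E.Lam where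
  carrier := {F | ∀ x, F.1 x x = 0}
  add_mem' {F G} hF hG x := by
    change F.1 x x + G.1 x x = 0
    rw [hF x, hG x, add_zero]
  zero_mem' _ := rfl
  smul_mem' F G hG x := by
    change (F * G).1 x x = 0
    rw [mul_self, hG x, mul_zero]

instance : E.J.IsTwoSided where
  mul_mem_of_left {F} G hF x := by
    rw [mul_self, hF x, zero_mul]

/-- The diagonal matrix with the entries `φ⁻¹(c x)`. -/
noncomputable def diag (c : ∀ x, E.fld x) : E.S :=
  ⟨⟨Matrix.diagonal fun x => E.phi x (c x), fun x y => by
    by_cases h : x = y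
    · subst h
      rw [Matrix.diagonal_apply_eq]
      exact E.phi_mem_R x _
    · rw [Matrix.diagonal_apply_ne _ h]
      exact zero_mem _⟩, fun _ _ h => Matrix.diagonal_apply_ne _ h⟩

theorem diag_add (c d : ∀ x, E.fld x) : E.diag (c + d) = E.diag c + E.diag d := by
  refine Subtype.ext (Subtype.ext ?_)
  change Matrix.diagonal _ = Matrix.diagonal _ + Matrix.diagonal _
  rw [Matrix.diagonal_add]
  exact congrArg _ (funext fun x => E.phi_add x _ _)

theorem diag_mul (c d : ∀ x, E.fld x) : E.diag (c * d) = E.diag c * E.diag d := by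
  refine Subtype.ext (Subtype.ext ?_)
  change Matrix.diagonal _ = Matrix.diagonal _ * Matrix.diagonal _
  rw [Matrix.diagonal_mul_diagonal]
  exact congrArg _ (funext fun x => E.phi_mul x _ _)

theorem diag_smul (k : K) (c : ∀ x, E.fld x) : E.diag (k • c) = k • E.diag c := by
  refine Subtype.ext (Subtype.ext ?_)
  change Matrix.diagonal _ = k • Matrix.diagonal _
  rw [← Matrix.diagonal_smul]
  exact congrArg _ (funext fun x => E.phi_smul x k _)

theorem diag_val (F : E.S) : E.diag (fun x => E.val (F.1.entry x x)) = F := by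
  refine Subtype.ext (Lam.ext fun x y => ?_)
  by_cases h : x = y
  · subst h
    exact (Matrix.diagonal_apply_eq _ _).trans (E.phi_val _)
  · exact (Matrix.diagonal_apply_ne _ h).trans (F.2 x y h).symm

theorem val_diag (c : ∀ x, E.fld x) (x : P) : E.val ((E.diag c).1.entry x x) = c x := by
  refine Subtype.ext ?_
  rw [coe_val]
  change (Matrix.diagonal (fun x => E.phi x (c x)) x x).unop 1 = _
  rw [Matrix.diagonal_apply_eq, unop_phi, proj_one]
  simp

/-- The isomorphism of `S` with the product of the fields `K(x)`. -/
noncomputable def diagEquiv : (∀ x, E.fld x) ≃+* E.S where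
  toFun := E.diag
  invFun F x := E.val (F.1.entry x x)
  left_inv c := funext fun x => E.val_diag c x
  right_inv F := E.diag_val F
  map_mul' := E.diag_mul
  map_add' := E.diag_add

instance : IsSemisimpleRing E.S := E.diagEquiv.isSemisimpleRing

theorem dualBasis_nonempty : Nonempty (DualBasis E.S E.J) := by
  have h1 : Module.Projective E.S E.J := Module.projective_of_isSemisimpleRing E.S E.J
  have h2 : Module.Finite K E.J := inferInstanceAs (Module.Finite K (E.J.restrictScalars K))
  have h3 : Module.Finite E.S E.J := Module.Finite.of_restrictScalars_finite K E.S E.J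
  exact DualBasis.nonempty E.S E.J

/-- A dual basis of the left `S`-module `J`. -/
noncomputable def dualBasis : DualBasis E.S E.J := Classical.choice E.dualBasis_nonempty

/-- The Drozd ditalgebra of `Λ = S ⊕ J`. -/
noncomputable def drozd : Ditalgebra K (E.S × E.S) (DrozdW₀ E.S E.J) (DrozdW₁ E.S E.J) :=
  EqPoset.drozd E.dualBasis

/-- The algebra `D₀` of the elements of degree zero of the Drozd ditalgebra. -/
def D₀ : Type _ := TensorRing.degZero K (E.S × E.S) (DrozdW₀ E.S E.J) (DrozdW₁ E.S E.J)

noncomputable instance : Ring E.D₀ :=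
  inferInstanceAs (Ring (TensorRing.degZero K (E.S × E.S) (DrozdW₀ E.S E.J) (DrozdW₁ E.S E.J)))

noncomputable instance : Algebra K E.D₀ :=
  inferInstanceAs (Algebra K (TensorRing.degZero K (E.S × E.S) (DrozdW₀ E.S E.J) (DrozdW₁ E.S E.J)))

/-- The map `R = S × S → D₀`, `(s, t) ↦ w₁ s + w₂ t`. -/
noncomputable def inR : E.S × E.S →ₐ[K] E.D₀ :=
  TensorRing.ofRZero K (E.S × E.S) (DrozdW₀ E.S E.J) (DrozdW₁ E.S E.J)

/-- The map `*J → D₀`, `γ ↦ w₁₂ γ`. -/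
noncomputable def inW₁₂ (γ : LDual E.S E.J) : E.D₀ :=
  TensorRing.ofWZero K (E.S × E.S) (DrozdW₀ E.S E.J) (DrozdW₁ E.S E.J) γ

/-- The element `φ⁻¹(c)` of `R x x`, as an element of `S`. -/
noncomputable def scal (x : P) (c : E.fld x) : E.S := E.diag (Pi.single x c)

/-- The idempotent `e_{x x}` of `S`. -/
noncomputable def idem (x : P) : E.S := E.scal x 1

end AlgEquipment

end Lambda
end EqPoset

namespace EqPoset

section Reps

open TensorRing

universe u₁ u₂ u₃ w

variable {K : Type u₁} {L : Type u₂} {P : Type u₃} [Field K] [Field L] [Algebra K L]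
  [FiniteDimensional K L] [PartialOrder P] [Fintype P] [DecidableEq P]

/-- A rectangular matrix with a two-sided inverse (so it is in fact a square matrix over a
commutative ring that is not zero). -/
def NonSingular {m n R : Type*} [Fintype m] [Fintype n] [DecidableEq m] [DecidableEq n]
    [CommRing R] (A : Matrix m n R) : Prop :=
  ∃ B : Matrix n m R, A * B = 1 ∧ B * A = 1

section generic

variable {D M F : Type*} [Ring D] [AddCommGroup M] [Module Dᵐᵒᵖ M] [Field F]

theorem op_smul_op_smul (a b : D) (m : M) : op a • op b • m = op (b * a) • m := by
  rw [smul_smul, ← op_mul]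

/-- The `F`-module structure on `M e` that is given by a map `s : F → D` which is compatible with
sums and products, where `e = s 1` and `M` is a right `D`-module. -/
@[reducible] def cornerModule (s : F → D) (h0 : s 0 = 0) (ha : ∀ c d, s (c + d) = s c + s d)
    (hm : ∀ c d, s (c * d) = s c * s d) (N : AddSubgroup M)
    (hN : ∀ m, m ∈ N ↔ op (s 1) • m = m) : Module F N where
  smul c m := ⟨op (s c) • m.1, (hN _).2 (by rw [op_smul_op_smul, ← hm, mul_one])⟩
  one_smul m := Subtype.ext ((hN _).1 m.2)
  mul_smul c d m := Subtype.ext (by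
    change op (s (c * d)) • m.1 = op (s c) • op (s d) • m.1
    rw [op_smul_op_smul, ← hm, mul_comm])
  smul_zero c := Subtype.ext (smul_zero _)
  smul_add c m n := Subtype.ext (smul_add _ _ _)
  add_smul c d m := Subtype.ext (by
    change op (s (c + d)) • m.1 = op (s c) • m.1 + op (s d) • m.1
    rw [ha, op_add, add_smul])
  zero_smul m := Subtype.ext (by
    change op (s 0) • m.1 = 0
    rw [h0, op_zero, zero_smul])

end generic

namespace AlgEquipment

theorem scal_add {E : AlgEquipment K L P} (x : P) (c d : E.fld x) :
    E.scal x (c + d) = E.scal x c + E.scal x d := by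
  rw [scal, Pi.single_add, diag_add]; rfl

theorem scal_mul {E : AlgEquipment K L P} (x : P) (c d : E.fld x) :
    E.scal x (c * d) = E.scal x c * E.scal x d := by
  rw [scal, Pi.single_mul, diag_mul]; rfl

theorem scal_zero {E : AlgEquipment K L P} (x : P) : E.scal x 0 = 0 := by
  have h := E.scal_add x 0 0
  rw [add_zero] at h
  exact left_eq_add.1 h

variable (E : AlgEquipment K L P)

theorem inR_add (a b : E.S × E.S) : E.inR (a + b) = E.inR a + E.inR b := map_add _ _ _

theorem inR_mul (a b : E.S × E.S) : E.inR (a * b) = E.inR a * E.inR b := map_mul _ _ _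

/-- The idempotent `e' = 1 - e` of the Drozd ditalgebra `D` of the extended poset, where
`e = w₁ (1 - e₀) + w₂ e₀`. -/
noncomputable def compl : E.ext.D₀ :=
  E.ext.inR (E.ext.idem ⊥, 1 - E.ext.idem ⊥)

/-- The objects of `mod Dᵉ`, where `D` is the Drozd ditalgebra of the extended poset: the right
`D₀`-modules `M` of finite dimension over `K` such that `M e' = 0`, for `e' = 1 - e`. -/
structure ModDe where
  carrier : Type w
  [addCommGroup : AddCommGroup carrier]
  [moduleK : Module K carrier]
  [module : Module (E.ext.D₀)ᵐᵒᵖ carrier]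
  [isScalarTower : IsScalarTower K (E.ext.D₀)ᵐᵒᵖ carrier]
  [finite : Module.Finite K carrier]
  smul_compl : ∀ m : carrier, op E.compl • m = 0

attribute [instance] ModDe.addCommGroup ModDe.moduleK ModDe.module ModDe.isScalarTower ModDe.finite

/-- `M ≅ N` in `mod Dᵉ`. -/
def ModDe.Iso {E : AlgEquipment K L P} (M N : ModDe.{u₁, u₂, u₃, w} E) : Prop :=
  letI : Module (degZero K (E.ext.S × E.ext.S) (DrozdW₀ E.ext.S E.ext.J)
    (DrozdW₁ E.ext.S E.ext.J))ᵐᵒᵖ M.carrier := M.module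
  letI : Module (degZero K (E.ext.S × E.ext.S) (DrozdW₀ E.ext.S E.ext.J)
    (DrozdW₁ E.ext.S E.ext.J))ᵐᵒᵖ N.carrier := N.module
  Ditalgebra.IsIso E.ext.drozd M.carrier N.carrier

/-- The element of `e D₀ e` that is given by `c ∈ K(x)`: it is `w₁ φ⁻¹(c)` if `x` is not the minimum
`0` and `w₂ φ⁻¹(c)` if `x = 0`. -/
noncomputable def locScal (x : WithBot (WithTop P)) (c : E.ext.fld x) : E.ext.D₀ :=
  E.ext.inR
    (if x = ⊥ then (0, E.ext.scal x c) else (E.ext.scal x c, 0))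

theorem locScal_add (x : WithBot (WithTop P)) (c d : E.ext.fld x) :
    E.locScal x (c + d) = E.locScal x c + E.locScal x d := by
  unfold locScal
  rw [← inR_add, scal_add]
  congr 1
  split_ifs <;> simp

theorem locScal_mul (x : WithBot (WithTop P)) (c d : E.ext.fld x) :
    E.locScal x (c * d) = E.locScal x c * E.locScal x d := by
  unfold locScal
  rw [← inR_mul, scal_mul]
  congr 1
  split_ifs <;> simp

theorem locScal_zero (x : WithBot (WithTop P)) : E.locScal x 0 = 0 := by
  have h := E.locScal_add x 0 0
  rw [add_zero] at h
  exact left_eq_add.1 h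

variable {E}

/-- The space `M_x = M e_x`. -/
def ModDe.comp (M : ModDe.{u₁, u₂, u₃, w} E) (x : WithBot (WithTop P)) :
    Submodule K M.carrier where
  carrier := {m | op (E.locScal x 1) • m = m}
  add_mem' {m n} hm hn := by
    change op (E.locScal x 1) • (m + n) = m + n
    rw [smul_add, hm, hn]
  zero_mem' := smul_zero _
  smul_mem' c m hm := by
    change op (E.locScal x 1) • (c • m) = c • m
    rw [smul_comm, hm]

/-- The map `m ↦ m e_x` from `M` to `M_x`. -/
noncomputable def ModDe.toComp (M : ModDe.{u₁, u₂, u₃, w} E) (x : WithBot (WithTop P))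
    (m : M.carrier) : M.comp x :=
  ⟨op (E.locScal x 1) • m, by
    exact (op_smul_op_smul _ _ m).trans (by rw [← locScal_mul, mul_one])⟩

/-- The structure of a vector space over `K(x)` on `M_x`. -/
noncomputable instance (M : ModDe.{u₁, u₂, u₃, w} E) (x : WithBot (WithTop P)) :
    Module (E.ext.fld x) (M.comp x) :=
  cornerModule (E.locScal x) (E.locScal_zero x) (E.locScal_add x) (E.locScal_mul x)
    (M.comp x).toAddSubgroup (fun _ => Iff.rfl)

/-- Ordered bases of `M_0` over `K` and of the spaces `M_x` over `K(x)`, `x ≠ 0`. -/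
structure ModDe.LocalBases (M : ModDe.{u₁, u₂, u₃, w} E) where
  rank₀ : ℕ
  basis₀ : Module.Basis (Fin rank₀) K (M.comp ⊥)
  rank : WithTop P → ℕ
  basis : ∀ x : WithTop P, Module.Basis (Fin (rank x)) (E.ext.fld x) (M.comp x)

/-- The matrix representation of `M`: the entry at `j, i` of the matrix at `x` is the coefficient
`∑ k, cⱼₖ pₖ(1)`, where `cⱼₖ` is the coordinate of `mᵢˣ w₁₂ γₖ ∈ M_0` at the basis vector `mⱼ⁰`,
and `pₖ(1)` is the value at `1 ∈ L` of the component of `pₖ` in `R 0 x`. -/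
noncomputable def ModDe.LocalBases.matrix {M : ModDe.{u₁, u₂, u₃, w} E} (b : M.LocalBases)
    (x : WithTop P) : Matrix (Fin b.rank₀) (Fin (b.rank x)) (E.ext.fld x) :=
  Matrix.of fun j i => ∑ k,
    b.basis₀.repr (M.toComp ⊥ (op (E.ext.inW₁₂ (E.ext.dualBasis.γ k)) • (b.basis x i : M.carrier))) j •
    E.ext.val ((E.ext.dualBasis.p k : E.ext.Lam).entry ⊥ x)

variable (E)

/-- Ordered bases over `K(x)` of the spaces `R y x`. -/
structure RBases where
  rank : WithTop P → WithTop P → ℕ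
  basis : ∀ y x : WithTop P, Module.Basis (Fin (rank y x)) (E.ext.fld x) (E.ext.R y x)

end AlgEquipment

end Reps
end EqPoset

namespace EqPoset

open scoped IntermediateField

section Hom

variable {K L : Type*} [Field K] [Field L] [Algebra K L]

/-- The endomorphism `μ_a f` of `L`, where `μ_a` is the multiplication by `a`, as an element of
`A`. -/
def muComp (a : L) (f : Module.End K L) : Alg K L := op (LinearMap.mulLeft K a ∘ₗ f)

theorem muComp_apply (a : L) (f : Module.End K L) (b : L) : (muComp a f).unop b = a * f b := rfl

end Hom

section Generalized

variable {K L P : Type*} [Field K] [Field L] [Algebra K L] [PartialOrder P]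

/-- A generalized equipped poset over the Galois group of `L` over `K`: a collection of non-empty
subsets `Γ x y` of the group, for `x ≤ y`, such that `Γ x y * Γ y z ⊆ Γ x z` for `x ≤ y ≤ z`, where
the product of `σ ∈ Γ x y` and `τ ∈ Γ y z` is `σ` followed by `τ`, as in the algebra `A`. -/
structure GenEquipped (K L P : Type*) [Field K] [Field L] [Algebra K L] [PartialOrder P] where
  Γ : P → P → Set (L ≃ₐ[K] L)
  nonempty : ∀ {x y : P}, x ≤ y → (Γ x y).Nonempty
  mul_mem : ∀ {x y z : P}, x ≤ y → y ≤ z → ∀ {σ τ : L ≃ₐ[K] L}, σ ∈ Γ x y → τ ∈ Γ y z → τ * σ ∈ Γ x z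

namespace GenEquipped

variable (G : GenEquipped K L P)

/-- The subspace `T x y` of `A` that is spanned by the endomorphisms `μ_a σ` with `a ∈ L` and
`σ ∈ Γ x y`. -/
def T (x y : P) : Submodule K (Alg K L) :=
  Submodule.span K {f | ∃ (a : L) (σ : L ≃ₐ[K] L), σ ∈ G.Γ x y ∧ f = muComp a σ.toLinearMap}

/-- The subfield `K(x)` of `L` of the elements that are fixed by the group `Γ x x`. -/
def fld (x : P) : IntermediateField K L := IntermediateField.fixedField (Subgroup.closure (G.Γ x x))

theorem mul_mem_T {x y z : P} (hxy : x ≤ y) (hyz : y ≤ z) {f g : Alg K L} (hf : f ∈ G.T x y)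
    (hg : g ∈ G.T y z) : f * g ∈ G.T x z := by
  induction hf using Submodule.span_induction with
  | zero => rw [zero_mul]; exact zero_mem _
  | add a b _ _ ha hb => rw [add_mul]; exact add_mem ha hb
  | smul c a _ ha => rw [smul_mul_assoc]; exact Submodule.smul_mem _ _ ha
  | mem f hf =>
    induction hg using Submodule.span_induction with
    | zero => rw [mul_zero]; exact zero_mem _
    | add a b _ _ ha hb => rw [mul_add]; exact add_mem ha hb
    | smul c a _ ha => rw [mul_smul_comm]; exact Submodule.smul_mem _ _ ha
    | mem g hg =>
      obtain ⟨a, σ, hσ, rfl⟩ := hf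
      obtain ⟨b, τ, hτ, rfl⟩ := hg
      refine Submodule.subset_span ⟨b * τ a, τ * σ, G.mul_mem hxy hyz hσ hτ, ?_⟩
      refine alg_ext fun c => ?_
      change b * τ (a * σ c) = b * τ a * τ (σ c)
      rw [map_mul, mul_assoc]

variable [FiniteDimensional K L]

theorem mem_closure {x : P} {σ : L ≃ₐ[K] L} (h : σ ∈ Subgroup.closure (G.Γ x x)) : σ ∈ G.Γ x x := by
  obtain ⟨τ, hτ⟩ := G.nonempty (le_refl x)
  have hpow : ∀ n : ℕ, τ ^ (n + 1) ∈ G.Γ x x := by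
    intro n
    induction n with
    | zero => simpa using hτ
    | succ n ih =>
      rw [pow_succ']
      exact G.mul_mem le_rfl le_rfl ih hτ
  have h1 : (1 : L ≃ₐ[K] L) ∈ G.Γ x x := by
    obtain ⟨n, hn, h⟩ := (isOfFinOrder_of_finite τ).exists_pow_eq_one
    obtain ⟨m, rfl⟩ := Nat.exists_eq_succ_of_ne_zero hn.ne'
    rw [← h]
    exact hpow m
  let N : Submonoid (L ≃ₐ[K] L) :=
    { carrier := G.Γ x x
      one_mem' := h1
      mul_mem' := fun ha hb => G.mul_mem le_rfl le_rfl hb ha }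
  have h2 : σ ∈ Submonoid.closure (G.Γ x x) := by
    rw [← Subgroup.closure_toSubmonoid_of_finite]
    exact h
  exact (Submonoid.closure_le (S := N)).2 subset_rfl h2

theorem mem_T_self [IsGalois K L] (x : P) (f : Module.End K L) :
    op f ∈ G.T x x ↔ ∀ c ∈ G.fld x, ∀ b, f (c * b) = c * f b := by
  constructor
  · intro h c hc
    have key : ∀ g ∈ G.T x x, ∀ b, g.unop (c * b) = c * g.unop b := by
      intro g hg
      induction hg using Submodule.span_induction with
      | zero => intro b; simp
      | add a b _ _ ha hb => intro d; simp only [unop_add, LinearMap.add_apply, ha, hb]; ring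
      | smul k a _ ha =>
        intro d
        rw [unop_smul, LinearMap.smul_apply, LinearMap.smul_apply, ha, mul_smul_comm]
      | mem g hg =>
        obtain ⟨a, σ, hσ, rfl⟩ := hg
        intro b
        have e : σ c = c :=
          (IntermediateField.mem_fixedField_iff _ c).1 hc σ (Subgroup.subset_closure hσ)
        change a * σ (c * b) = c * (a * σ b)
        rw [map_mul, e]
        ring
    exact key _ h
  · intro h
    let F := G.fld x
    let f' : L →ₗ[F] L :=
      { toFun := f
        map_add' := f.map_add
        map_smul' := fun c b => h c c.2 b }
    have hli : LinearIndependent L (fun σ : L ≃ₐ[F] L => (σ : L →ₐ[F] L).toLinearMap) :=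
      (linearIndependent_toLinearMap F L L).comp (fun σ : L ≃ₐ[F] L => (σ : L →ₐ[F] L))
        (fun σ τ h => AlgEquiv.ext fun b => DFunLike.congr_fun h b)
    have hcard : Fintype.card (L ≃ₐ[F] L) = Module.finrank L (L →ₗ[F] L) := by
      rw [Module.finrank_linearMap_self, ← IsGalois.card_aut_eq_finrank, Nat.card_eq_fintype_card]
    have hmem : f' ∈ Submodule.span L
        (Set.range fun σ : L ≃ₐ[F] L => (σ : L →ₐ[F] L).toLinearMap) := by
      rw [hli.span_eq_top_of_card_eq_finrank' hcard]
      exact Submodule.mem_top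
    obtain ⟨c, hc⟩ := (Submodule.mem_span_range_iff_exists_fun L).1 hmem
    have e : op f = ∑ σ : L ≃ₐ[F] L, muComp (c σ) (σ.restrictScalars K).toLinearMap := by
      refine alg_ext fun b => ?_
      have h1 := LinearMap.congr_fun hc b
      rw [← MulOpposite.coe_opLinearEquiv_symm (R := K), map_sum, LinearMap.sum_apply]
      rw [LinearMap.sum_apply] at h1
      exact h1.symm
    rw [e]
    refine sum_mem fun σ _ => Submodule.subset_span ⟨_, _, G.mem_closure ?_, rfl⟩
    rw [← IntermediateField.fixingSubgroup_fixedField (Subgroup.closure (G.Γ x x))]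
    refine (IntermediateField.mem_fixingSubgroup_iff _ _).2 fun a ha => ?_
    exact σ.commutes ⟨a, ha⟩

/-- The equipment, over the algebra `A`, of a generalized equipped poset. -/
def toAlg [IsGalois K L] (ξ : L) (hξ : K⟮ξ⟯ = ⊤) : AlgEquipment K L P where
  ξ := ξ
  adjoin_ξ := hξ
  T := G.T
  fld := G.fld
  mul_mem := G.mul_mem_T
  mem_self := G.mem_T_self

end GenEquipped

end Generalized

end EqPoset

namespace EqPoset

open scoped IntermediateField

section PEquipped

/-- A `p`-equipped poset: every relation `x ≤ y` has a level `ℓ x y ∈ {1, …, p}`, and if `x ≤ y ≤ z`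
then `ℓ x z ≥ min (ℓ x y + ℓ y z - 1) p`.  (The values of `ℓ` at other pairs are not used.) -/
structure PEquipped (p : ℕ) (P : Type*) [PartialOrder P] where
  lev : P → P → ℕ
  one_le : ∀ {x y : P}, x ≤ y → 1 ≤ lev x y
  le_p : ∀ {x y : P}, x ≤ y → lev x y ≤ p
  min_le : ∀ {x y z : P}, x ≤ y → y ≤ z → min (lev x y + lev y z - 1) p ≤ lev x z

variable {K L : Type*} [Field K] [Field L] [Algebra K L]

/-- A normal extension `L = K(ξ)` of degree `p` with `ξ ^ p ∈ K`, together with the endomorphism `ϑ`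
of `L`: a generator of the Galois group if the characteristic of `K` is not `p`, and the derivation
over `K` with value `1` at `ξ` if it is `p`. -/
structure PExtension (p : ℕ) (K L : Type*) [Field K] [Field L] [Algebra K L] where
  ξ : L
  adjoin_ξ : K⟮ξ⟯ = ⊤
  finrank_eq : Module.finrank K L = p
  normal : Normal K L
  pow_mem : ξ ^ p ∈ (algebraMap K L).range
  θ : Module.End K L
  θ_spec : (¬ CharP K p ∧ ∃ σ : L ≃ₐ[K] L, (∀ τ : L ≃ₐ[K] L, τ ∈ Subgroup.zpowers σ) ∧
      θ = σ.toLinearMap) ∨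
    (CharP K p ∧ ∃ D : Derivation K L L, D ξ = 1 ∧ θ = D)

namespace PExtension

variable {p : ℕ} [Fact p.Prime] (X : PExtension p K L)

/-- The subspace `A_ℓ` of `A` that is spanned by the endomorphisms `μ_a ϑ ^ i` with `a ∈ L` and
`i < ℓ`. -/
def T (l : ℕ) : Submodule K (Alg K L) :=
  Submodule.span K {f | ∃ (a : L) (i : ℕ), i < l ∧ f = muComp a (X.θ ^ i)}

theorem T_mono {l m : ℕ} (h : l ≤ m) : X.T l ≤ X.T m :=
  Submodule.span_mono fun _ ⟨a, i, hi, e⟩ => ⟨a, i, hi.trans_le h, e⟩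

theorem finite (X : PExtension p K L) : FiniteDimensional K L :=
  FiniteDimensional.of_finrank_pos (X.finrank_eq ▸ (Fact.out : p.Prime).pos)

theorem eq_on_powers {f g : Module.End K L} (h : ∀ j : ℕ, f (X.ξ ^ j) = g (X.ξ ^ j)) : f = g := by
  have := X.finite
  refine LinearMap.ext fun b => ?_
  have h1 : (Algebra.adjoin K {X.ξ} : Subalgebra K L) = ⊤ := by
    rw [← IntermediateField.adjoin_simple_toSubalgebra_of_isAlgebraic
      (Algebra.IsAlgebraic.isAlgebraic X.ξ), X.adjoin_ξ, IntermediateField.top_toSubalgebra]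
  have hb : b ∈ Algebra.adjoin K {X.ξ} := h1 ▸ Algebra.mem_top
  rw [Algebra.adjoin_singleton_eq_range_aeval] at hb
  obtain ⟨q, rfl⟩ := hb
  change f (Polynomial.aeval X.ξ q) = g (Polynomial.aeval X.ξ q)
  rw [Polynomial.aeval_eq_sum_range, map_sum, map_sum]
  simp only [map_smul, h]

theorem isGalois (X : PExtension p K L) (hp : ¬ CharP K p) : IsGalois K L := by
  have hpp : p.Prime := Fact.out
  have := X.finite
  have := X.normal
  obtain ⟨q, hq⟩ := X.pow_mem
  have hξ : X.ξ ≠ 0 := by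
    intro h0
    have h1 := X.adjoin_ξ
    rw [h0, IntermediateField.adjoin_zero] at h1
    have h2 := IntermediateField.finrank_top (F := K) (E := L)
    have h3 : Module.finrank K L = 1 := by
      rw [← IntermediateField.finrank_top' (F := K) (E := L), ← h1, IntermediateField.finrank_bot]
    have := X.finrank_eq
    exact hpp.one_lt.ne' (this.symm.trans h3)
  have hq0 : q ≠ 0 := by
    rintro rfl
    rw [map_zero] at hq
    exact hξ (pow_eq_zero_iff hpp.ne_zero |>.1 hq.symm)
  have hpK : (p : K) ≠ 0 := by
    intro h
    exact hp ((CharP.charP_iff_prime_eq_zero hpp).2 h)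
  have hsep : IsSeparable K X.ξ := by
    refine Polynomial.Separable.of_dvd (Polynomial.separable_X_pow_sub_C q hpK hq0) ?_
    refine minpoly.dvd K X.ξ ?_
    simp [← hq]
  have h2 : Algebra.IsSeparable K K⟮X.ξ⟯ :=
    (IntermediateField.isSeparable_adjoin_simple_iff_isSeparable K L).2 hsep
  have h3 : Algebra.IsSeparable K L := by
    rw [X.adjoin_ξ] at h2
    exact Algebra.IsSeparable.of_algHom K _ (IntermediateField.topEquiv (F := K) (E := L)).symm.toAlgHom
  exact ⟨⟩

theorem derivation_pow (D : Derivation K L L) (hD : D X.ξ = 1) (k j : ℕ) :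
    ((D : Module.End K L) ^ k) (X.ξ ^ j) = (j.descFactorial k : L) * X.ξ ^ (j - k) := by
  induction k with
  | zero => simp
  | succ k ih =>
    rw [pow_succ', Module.End.mul_apply, ih]
    change D _ = _
    rw [D.leibniz, D.leibniz_pow, hD, D.map_natCast, Nat.descFactorial_succ, Nat.sub_sub]
    push_cast
    simp only [smul_eq_mul, nsmul_eq_mul, mul_one]
    ring

theorem pow_p : X.θ ^ p = 1 ∨ X.θ ^ p = 0 := by
  have hpp : p.Prime := Fact.out
  rcases X.θ_spec with ⟨hp, σ, hσ, e⟩ | ⟨hp, D, hD, e⟩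
  · left
    have := X.finite
    have := X.isGalois hp
    have h1 : σ ^ p = 1 := by
      rw [← X.finrank_eq, ← IsGalois.card_aut_eq_finrank]
      exact pow_card_eq_one'
    have h2 : ∀ n : ℕ, ∀ b, (σ.toLinearMap ^ n) b = (σ ^ n) b := by
      intro n
      induction n with
      | zero => intro b; rfl
      | succ n ih => intro b; rw [pow_succ', pow_succ', Module.End.mul_apply, ih]; rfl
    refine LinearMap.ext fun b => ?_
    rw [e, h2, h1]
    rfl
  · right
    refine X.eq_on_powers fun j => ?_
    rw [e, X.derivation_pow D hD]
    have h1 : p ∣ j.descFactorial p := (Nat.dvd_factorial hpp.pos le_rfl).trans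
      (Nat.factorial_dvd_descFactorial j p)
    have := charP_of_injective_algebraMap (algebraMap K L).injective p
    rw [(CharP.cast_eq_zero_iff L p _).2 h1, zero_mul]
    rfl

theorem comp_mem {l : ℕ} {f : Alg K L} (hf : f ∈ X.T l) : f * op X.θ ∈ X.T (l + 1) := by
  induction hf using Submodule.span_induction with
  | zero => rw [zero_mul]; exact zero_mem _
  | add a b _ _ ha hb => rw [add_mul]; exact add_mem ha hb
  | smul c a _ ha => rw [smul_mul_assoc]; exact Submodule.smul_mem _ _ ha
  | mem f hf =>
    obtain ⟨a, i, hi, rfl⟩ := hf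
    rcases X.θ_spec with ⟨hp, σ, hσ, e⟩ | ⟨hp, D, hD, e⟩
    · refine Submodule.subset_span ⟨σ a, i + 1, Nat.succ_lt_succ hi, ?_⟩
      refine alg_ext fun b => ?_
      change X.θ (a * (X.θ ^ i) b) = σ a * (X.θ ^ (i + 1)) b
      rw [pow_succ', Module.End.mul_apply, e]
      exact map_mul σ _ _
    · have h : muComp a (X.θ ^ i) * op X.θ = muComp a (X.θ ^ (i + 1)) + muComp (D a) (X.θ ^ i) := by
        refine alg_ext fun b => ?_
        change X.θ (a * (X.θ ^ i) b) = a * (X.θ ^ (i + 1)) b + D a * (X.θ ^ i) b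
        have h2 : ∀ c, X.θ c = D c := fun c => by rw [e]; rfl
        rw [pow_succ', Module.End.mul_apply, h2, h2, D.leibniz, smul_eq_mul, smul_eq_mul,
          mul_comm (D a)]
      rw [h]
      exact add_mem (Submodule.subset_span ⟨a, i + 1, Nat.succ_lt_succ hi, rfl⟩)
        (Submodule.subset_span ⟨D a, i, hi.trans (Nat.lt_succ_self _), rfl⟩)

theorem mul_mem_T {l m : ℕ} (hm : 1 ≤ m) {f g : Alg K L} (hf : f ∈ X.T l) (hg : g ∈ X.T m) :
    f * g ∈ X.T (l + m - 1) := by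
  induction hg using Submodule.span_induction with
  | zero => rw [mul_zero]; exact zero_mem _
  | add a b _ _ ha hb => rw [mul_add]; exact add_mem ha hb
  | smul c a _ ha => rw [mul_smul_comm]; exact Submodule.smul_mem _ _ ha
  | mem g hg =>
    obtain ⟨a, i, hi, rfl⟩ := hg
    have h1 : ∀ i, f * op (X.θ ^ i) ∈ X.T (l + i) := by
      intro i
      induction i with
      | zero => simpa using hf
      | succ i ih =>
        rw [pow_succ', op_mul, ← mul_assoc]
        exact X.comp_mem ih
    have h2 : ∀ {k : ℕ} {h : Alg K L}, h ∈ X.T k → h * op (LinearMap.mulLeft K a) ∈ X.T k := by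
      intro k h hh
      induction hh using Submodule.span_induction with
      | zero => rw [zero_mul]; exact zero_mem _
      | add a b _ _ ha hb => rw [add_mul]; exact add_mem ha hb
      | smul c a _ ha => rw [smul_mul_assoc]; exact Submodule.smul_mem _ _ ha
      | mem f hf =>
        obtain ⟨b, i, hi, rfl⟩ := hf
        refine Submodule.subset_span ⟨a * b, i, hi, alg_ext fun c => ?_⟩
        exact (mul_assoc a b _).symm
    have h3 := X.T_mono (show l + i ≤ l + m - 1 by omega) (h2 (h1 i))
    rwa [mul_assoc] at h3

theorem T_le (l : ℕ) : X.T l ≤ X.T p := by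
  have hpp : p.Prime := Fact.out
  refine Submodule.span_le.2 ?_
  rintro _ ⟨a, i, -, rfl⟩
  by_cases hi : i < p
  · exact Submodule.subset_span ⟨a, i, hi, rfl⟩
  · rcases X.pow_p with h | h
    · refine Submodule.subset_span ⟨a, i % p, Nat.mod_lt _ hpp.pos, ?_⟩
      have e : X.θ ^ i = X.θ ^ (i % p) := by
        conv_lhs => rw [← Nat.mod_add_div i p, pow_add, pow_mul, h, one_pow, mul_one]
      rw [e]
    · have e : X.θ ^ i = 0 := by
        rw [← Nat.add_sub_cancel' (not_lt.1 hi), pow_add, h, zero_mul]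
      have e2 : muComp a (X.θ ^ i) = 0 := alg_ext fun b => by
        rw [muComp_apply, e]; simp
      rw [e2]
      exact zero_mem _

theorem linearIndependent : LinearIndependent L (fun i : Fin p => (X.θ ^ (i : ℕ) : L →ₗ[K] L)) := by
  have hpp : p.Prime := Fact.out
  rcases X.θ_spec with ⟨hp, σ, hσ, e⟩ | ⟨hp, D, hD, e⟩
  · have := X.finite
    have := X.isGalois hp
    have h1 : orderOf σ = p := by
      rw [orderOf_eq_card_of_forall_mem_zpowers hσ, IsGalois.card_aut_eq_finrank, X.finrank_eq]
    have h2 : ∀ n : ℕ, (X.θ ^ n : L →ₗ[K] L) = ((σ ^ n : L ≃ₐ[K] L) : L →ₐ[K] L).toLinearMap := by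
      intro n
      rw [e]
      induction n with
      | zero => rfl
      | succ n ih => rw [pow_succ', pow_succ', ih]; rfl
    simp only [h2]
    refine (linearIndependent_toLinearMap K L L).comp
      (fun i : Fin p => ((σ ^ (i : ℕ) : L ≃ₐ[K] L) : L →ₐ[K] L)) ?_
    intro i j hij
    have h3 : σ ^ (i : ℕ) = σ ^ (j : ℕ) := AlgEquiv.ext fun b => DFunLike.congr_fun hij b
    refine Fin.ext (pow_injOn_Iio_orderOf ?_ ?_ h3)
    · rw [h1]; exact i.2
    · rw [h1]; exact j.2
  · rw [Fintype.linearIndependent_iff]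
    intro c hc
    have := charP_of_injective_algebraMap (algebraMap K L).injective p
    have key : ∀ n : ℕ, ∀ i : Fin p, (i : ℕ) = n → c i = 0 := by
      intro n
      induction n using Nat.strong_induction_on with
      | _ n ih =>
        intro i hi
        have h1 := LinearMap.congr_fun hc (X.ξ ^ n)
        rw [LinearMap.sum_apply, Finset.sum_eq_single i] at h1
        · rw [LinearMap.smul_apply, e, X.derivation_pow D hD, hi, Nat.descFactorial_self,
            Nat.sub_self, pow_zero, mul_one, smul_eq_mul, LinearMap.zero_apply] at h1
          refine (mul_eq_zero.1 h1).resolve_right fun h2 => ?_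
          rw [CharP.cast_eq_zero_iff L p, hpp.dvd_factorial] at h2
          exact absurd i.2 (by omega)
        · intro j _ hj
          rw [LinearMap.smul_apply]
          rcases lt_trichotomy (j : ℕ) n with h | h | h
          · rw [ih j h j rfl, zero_smul]
          · exact absurd (Fin.ext (h.trans hi.symm)) hj
          · rw [e, X.derivation_pow D hD, Nat.descFactorial_of_lt h, Nat.cast_zero, zero_mul,
              smul_zero]
        · exact fun h => absurd (Finset.mem_univ _) h
    exact fun i => key i i rfl

theorem T_p : X.T p = ⊤ := by
  have := X.finite
  refine eq_top_iff.2 fun f _ => ?_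
  have hcard : Fintype.card (Fin p) = Module.finrank L (L →ₗ[K] L) := by
    rw [Module.finrank_linearMap_self, X.finrank_eq, Fintype.card_fin]
  have hmem : f.unop ∈ Submodule.span L (Set.range fun i : Fin p => (X.θ ^ (i : ℕ) : L →ₗ[K] L)) := by
    rw [X.linearIndependent.span_eq_top_of_card_eq_finrank' hcard]
    exact Submodule.mem_top
  obtain ⟨c, hc⟩ := (Submodule.mem_span_range_iff_exists_fun L).1 hmem
  have e : f = ∑ i : Fin p, muComp (c i) (X.θ ^ (i : ℕ)) := by
    refine alg_ext fun b => ?_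
    have h1 := LinearMap.congr_fun hc b
    rw [← MulOpposite.coe_opLinearEquiv_symm (R := K), map_sum, LinearMap.sum_apply]
    rw [LinearMap.sum_apply] at h1
    exact h1.symm
  rw [e]
  exact sum_mem fun i _ => Submodule.subset_span ⟨_, _, i.2, rfl⟩

theorem mem_T_one (f : Module.End K L) : op f ∈ X.T 1 ↔ ∀ c b, f (c * b) = c * f b := by
  constructor
  · intro h c
    have key : ∀ g ∈ X.T 1, ∀ b, g.unop (c * b) = c * g.unop b := by
      intro g hg
      induction hg using Submodule.span_induction with
      | zero => intro b; simp
      | add a b _ _ ha hb => intro d; simp only [unop_add, LinearMap.add_apply, ha, hb]; ring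
      | smul k a _ ha =>
        intro d
        rw [unop_smul, LinearMap.smul_apply, LinearMap.smul_apply, ha, mul_smul_comm]
      | mem g hg =>
        obtain ⟨a, i, hi, rfl⟩ := hg
        obtain rfl : i = 0 := by omega
        intro b
        exact mul_left_comm a c b
    exact key _ h
  · intro h
    refine Submodule.subset_span ⟨f 1, 0, Nat.zero_lt_one, alg_ext fun b => ?_⟩
    have h1 := h b 1
    rw [mul_one] at h1
    change f b = f 1 * b
    rw [h1, mul_comm]

end PExtension

namespace PEquipped

variable {p : ℕ} [Fact p.Prime] {P : Type*} [PartialOrder P] (Q : PEquipped p P)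

/-- The point `x` is strong; a point that is not strong is weak, that is `ℓ x x = 1`. -/
def Strong (x : P) : Prop := Q.lev x x = p

theorem weak_of_not_strong {x : P} (h : ¬ Q.Strong x) : Q.lev x x = 1 := by
  have h1 := Q.one_le (le_refl x)
  have h2 := Q.le_p (le_refl x)
  have h3 := Q.min_le (le_refl x) (le_refl x)
  have h4 : Q.lev x x ≠ p := h
  omega

/-- The field `K(x)`: it is `K` if `x` is strong and `L` if `x` is weak. -/
noncomputable def fld (K L : Type*) [Field K] [Field L] [Algebra K L] (x : P) :
    IntermediateField K L :=
  haveI := Classical.propDecidable (Q.Strong x)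
  if Q.Strong x then ⊥ else ⊤

/-- The equipment, over the algebra `A`, of a `p`-equipped poset. -/
noncomputable def toAlg (X : PExtension p K L) : AlgEquipment K L P where
  ξ := X.ξ
  adjoin_ξ := X.adjoin_ξ
  T x y := X.T (Q.lev x y)
  fld := Q.fld K L
  mul_mem {x y z} hxy hyz f g hf hg := by
    have h := X.mul_mem_T (Q.one_le hyz) hf hg
    have h2 := Q.min_le hxy hyz
    rcases min_choice (Q.lev x y + Q.lev y z - 1) p with h3 | h3
    · rw [h3] at h2
      exact X.T_mono h2 h
    · rw [h3] at h2
      exact X.T_mono h2 (X.T_le _ h)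
  mem_self x f := by
    by_cases h : Q.Strong x
    · have e : Q.lev x x = p := h
      rw [fld, if_pos h, e, X.T_p]
      refine ⟨fun _ c hc b => ?_, fun _ => Submodule.mem_top⟩
      obtain ⟨k, rfl⟩ := IntermediateField.mem_bot.1 hc
      rw [← Algebra.smul_def, ← Algebra.smul_def, map_smul]
    · rw [fld, if_neg h, Q.weak_of_not_strong h, X.mem_T_one]
      exact ⟨fun h c _ b => h c b, fun h c b => h c IntermediateField.mem_top b⟩

/-- The extension of a `p`-equipped poset by a maximum `m`, which is a strong point. -/
def lev' : WithTop P → WithTop P → ℕ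
  | some x, some y => Q.lev x y
  | _, _ => p

/-- The strong points of the extension of the poset by a maximum `m`. -/
def Strong' (x : WithTop P) : Prop := Q.lev' x x = p

end PEquipped

end PEquipped

end EqPoset

namespace EqPoset

section Problems

universe u₁ u₂ u₃ w

variable {K : Type u₁} {L : Type u₂} {P : Type u₃} [Field K] [Field L] [Algebra K L]
  [FiniteDimensional K L] [PartialOrder P] [Fintype P] [DecidableEq P]

open scoped Classical in
/-- The matrix representations of `M` and `N` are equivalent: there are non-singular matrices `L⁰`
over `K` and `Lˣ` over `K(x)`, for all `x > 0`, and matrices `L_i^{y,x}` over `K(x)`, for all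
`0 < y < x`, such that `M_x = L⁰ (N_x Lˣ + ∑_{y<x} ∑_i u_i^{y,x}(N_y) L_i^{y,x})`. -/
def MatrixEquiv {E : AlgEquipment K L P} (τ : E.RBases)
    {M N : AlgEquipment.ModDe.{u₁, u₂, u₃, w} E} (bM : M.LocalBases) (bN : N.LocalBases) : Prop :=
  ∃ (L₀ : Matrix (Fin bM.rank₀) (Fin bN.rank₀) K)
    (L₁ : ∀ x : WithTop P, Matrix (Fin (bN.rank x)) (Fin (bM.rank x)) (E.ext.fld x))
    (L₂ : ∀ y x : WithTop P, Fin (τ.rank y x) →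
      Matrix (Fin (bN.rank y)) (Fin (bM.rank x)) (E.ext.fld x)),
    NonSingular L₀ ∧ (∀ x, NonSingular (L₁ x)) ∧
    ∀ x : WithTop P, bM.matrix x = L₀.map (algebraMap K (E.ext.fld x)) *
      (bN.matrix x * L₁ x +
        ∑ y with y < x, ∑ i, (bN.matrix y).map (E.ext.uMap (τ.basis y x i)) * L₂ y x i)

/-- The matrix representation, with the entries regarded as elements of `L`. -/
noncomputable def matrixL {E : AlgEquipment K L P} {M : AlgEquipment.ModDe.{u₁, u₂, u₃, w} E}
    (b : M.LocalBases) (x : WithTop P) : Matrix (Fin b.rank₀) (Fin (b.rank x)) L :=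
  (b.matrix x).map fun a => (a : L)

/-- The map `L → K ⊆ L`, `a₀ + a₁ ξ + ⋯ + a_{p-1} ξ ^ (p-1) ↦ a₀`. -/
noncomputable def PExtension.constCoeff {p : ℕ} (X : PExtension p K L) (b : L) : L :=
  (proj (⊥ : IntermediateField K L) X.ξ X.adjoin_ξ b : L)

open scoped Classical in
/-- The explicit form of the equivalence of the matrix representations of `M` and `N` for a
`p`-equipped poset. -/
def PMatrixEquiv {p : ℕ} [Fact p.Prime] (Q : PEquipped p P) (X : PExtension p K L)
    {M N : AlgEquipment.ModDe.{u₁, u₂, u₃, w} (Q.toAlg X)} (bM : M.LocalBases)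
    (bN : N.LocalBases) : Prop :=
  ∃ L₀ : Matrix (Fin bM.rank₀) (Fin bN.rank₀) K, NonSingular L₀ ∧
    (∀ x : WithTop P, Q.Strong' x →
      ∃ (L₁ : Matrix (Fin (bN.rank x)) (Fin (bM.rank x)) K)
        (A : ∀ y : WithTop P, Matrix (Fin (bN.rank y)) (Fin (bM.rank x)) K)
        (B : ∀ y : WithTop P, Matrix (Fin (bN.rank y)) (Fin (bM.rank x)) L),
        NonSingular L₁ ∧
        matrixL bM x = L₀.map (algebraMap K L) *
          (matrixL bN x * L₁.map (algebraMap K L) +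
            ∑ y with Q.Strong' y ∧ y < x, matrixL bN y * (A y).map (algebraMap K L) +
            ∑ y with ¬ Q.Strong' y ∧ y < x, (matrixL bN y * B y).map X.constCoeff)) ∧
    ∀ x : WithTop P, ¬ Q.Strong' x →
      ∃ (L₁ : Matrix (Fin (bN.rank x)) (Fin (bM.rank x)) L)
        (A : ∀ y : WithTop P, Matrix (Fin (bN.rank y)) (Fin (bM.rank x)) L)
        (B : ∀ y : WithTop P, ℕ → Matrix (Fin (bN.rank y)) (Fin (bM.rank x)) L),
        NonSingular L₁ ∧
        matrixL bM x = L₀.map (algebraMap K L) *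
          (matrixL bN x * L₁ +
            ∑ y with Q.Strong' y ∧ y < x, matrixL bN y * A y +
            ∑ y with ¬ Q.Strong' y ∧ y < x, ∑ i ∈ Finset.range (Q.lev' y x),
              (matrixL bN y).map (X.θ ^ i) * B y i)

end Problems

end EqPoset

/-! A module `M` in `mod Dᵉ` is the sum of `M_0` and the spaces `M_x`, `x > 0`. Since `D₀` is
generated by `R` and `w₁₂ *J`, the only further structure on `M` is the action of `w₁₂ *J`, which
carries the `M_x` into `M_0` and kills `M_0`.

Let `(f⁰, f¹)` be a morphism `M → N`. As `D₁` is generated as a `D₀`-bimodule by `w₁ *J` and `w₂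
*J`, the map `f¹` is known from its values there. The values on `w₂ *J` are irrelevant: the
compatibility with `d` only evaluates them on `M_0`, and there they vanish because `e₀ *J = 0`, no
point lying strictly below the minimum. What is left is `f⁰`, the bimodule map `a(γ) = f¹(w₁ γ)`,
and one equation, which comes from `d(w₁₂ γ)`: f⁰(m w₁₂γ) = f⁰(m) w₁₂γ + ∑ a(γ¹)(m) w₁₂γ².
Conversely, such a pair extends to a morphism with `f¹(w₂ γ) = 0`. If `f⁰` is bijective, the
morphism is invertible: transported to `M`, the equation says that the action of `w₁₂ *J` on `M` is
`1 + t` times that of `N`, for the convolution product dual to the multiplication of `J` and for `t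
= (f⁰)⁻¹ a`; since `J` is nilpotent, a finite Neumann series inverts `1 + t`. So an isomorphism in
`mod Dᵉ` exists if and only if a `RepEquiv` does (`exists_convInverse`, `RepEquiv.exists_symm`,
`IsDrozd.isIso_iff`).

Matrices appear by dualizing `*J` once more. A functional on `*J` with values in `K(y)` that is
linear for the right action of `S` at `y` is evaluation at a unique element of the row of `J` at `y`
(`sval_assemble`, `eq_assemble`). So a coordinate of `n w₁₂γ` in `N_0` is a row at the minimum, and
a coordinate of `a(γ)(m)` in `N_y` is a row at `y`. An element of `R_{0x}` is determined by its
value at `1`; these values are the entries of the matrix representation. For `f` in `R_{0y}` and `g`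
in `R_{yx}` the value of `f g` at `1` is `u_g(f(1))`, because on `K` the map `f` agrees with
`φ_y⁻¹(f(1))` (`val_mul`). Hence the sum over the comultiplication becomes multiplication of a row
at `0` by rows of `J`, and the equation becomes M_x = L⁰ (N_x Lˣ + ∑_{y<x} u_H(N_y)), where `H` is a
matrix of arbitrary elements of `R_{yx}`, `L⁰` is the matrix of the inverse of `f⁰` at `0`, and `Lˣ`
is the matrix of `f⁰` at `x` (`eqn_iff`, `nonempty_repEquiv_iff`). Since `u_h` is `K(x)`-linear in
`h`, expanding `H` in the bases `τ` gives the general criterion.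

For a `p`-equipped poset it remains to list the maps `u_h`. They are the maps `a ↦ π(t(a))` with `t`
in `T_{yx}` and `π` the projection of `L` onto `K(x)`. From a strong point, `K`-linearity leaves
only `t(1)`. From a weak to a strong point, every `K`-linear map `L → K` has the form `a ↦ R(a c)`,
because the form `(a, b) ↦ R(a b)` is not degenerate. From a weak to a weak point, the spanning set
of `T_{yx}` gives sums of terms `ϑⁱ(a) cᵢ` with `i < ℓ(y,x)`. -/

namespace EqPoset

/-! ### Degrees zero and one of the tensor algebra; morphisms given on generators -/

section GradedModules

open TensorRing

variable {K R W₀ W₁ : Type*} [Field K] [Ring R] [Algebra K R]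
  [AddCommGroup W₀] [Module K W₀] [Module R W₀] [Module Rᵐᵒᵖ W₀]
  [AddCommGroup W₁] [Module K W₁] [Module R W₁] [Module Rᵐᵒᵖ W₁]

namespace TensorRing

/-- The canonical map `W₁ → T_R(W)_1`. -/
noncomputable def ofWOne (w : W₁) : deg K R W₀ W₁ 1 :=
  ⟨ofW K R W₀ W₁ (0, w), Submodule.subset_span (IsHomogeneous.ofW₁ w)⟩

/-- Degrees are natural numbers, so a product of total degree zero has both factors of degree zero.
Hence `R` and `W₀` generate `T_R(W)_0` as a ring; scalars are covered because `K` maps to `R`. -/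
theorem degZero_induction {p : degZero K R W₀ W₁ → Prop}
    (hR : ∀ r, p (ofRZero K R W₀ W₁ r)) (hW : ∀ w, p (ofWZero K R W₀ W₁ w))
    (hadd : ∀ a b, p a → p b → p (a + b)) (hmul : ∀ a b, p a → p b → p (a * b))
    (a : degZero K R W₀ W₁) : p a := by
  have key : ∀ n x, IsHomogeneous K R W₀ W₁ n x → n = 0 →
      ∀ hx : x ∈ degZero K R W₀ W₁, p ⟨x, hx⟩ := by
    intro n x h
    induction h with
    | ofR r => exact fun _ _ => hR r
    | ofW₀ w => exact fun _ _ => hW w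
    | ofW₁ w => exact fun h => absurd h one_ne_zero
    | @mul m n x y hx hy ihx ihy =>
      intro h _
      obtain ⟨rfl, rfl⟩ := Nat.add_eq_zero_iff.1 h
      exact hmul ⟨x, Submodule.subset_span hx⟩ ⟨y, Submodule.subset_span hy⟩ (ihx rfl _) (ihy rfl _)
  obtain ⟨x, hx⟩ := a
  have hx' : x ∈ deg K R W₀ W₁ 0 := hx
  induction hx' using Submodule.span_induction with
  | mem x h => exact key 0 x h rfl hx
  | zero =>
    have := hR 0
    rwa [map_zero] at this
  | add a b ha hb iha ihb => exact hadd ⟨a, ha⟩ ⟨b, hb⟩ (iha ha) (ihb hb)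
  | smul c a ha iha =>
    have h := hmul _ ⟨a, ha⟩ (hR (algebraMap K R c)) (iha ha)
    have e : ofRZero K R W₀ W₁ (algebraMap K R c) * (⟨a, ha⟩ : degZero K R W₀ W₁) = ⟨c • a, hx⟩ := by
      rw [AlgHom.commutes, ← Algebra.smul_def]
      rfl
    rwa [e] at h

/-- In a product of total degree one, exactly one factor has degree one and the other has degree
zero, so `W₁` generates `T_R(W)_1` as a bimodule over `T_R(W)_0`. -/
theorem degOne_induction {p : deg K R W₀ W₁ 1 → Prop} (hW : ∀ w, p (ofWOne w))
    (hadd : ∀ v w, p v → p w → p (v + w)) (hl : ∀ a v, p v → p (lmul a v))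
    (hr : ∀ v a, p v → p (rmul v a)) (v : deg K R W₀ W₁ 1) : p v := by
  have key : ∀ n x, IsHomogeneous K R W₀ W₁ n x → n = 1 →
      ∀ hx : x ∈ deg K R W₀ W₁ 1, p ⟨x, hx⟩ := by
    intro n x h
    induction h with
    | ofR r => exact fun h => absurd h zero_ne_one
    | ofW₀ w => exact fun h => absurd h zero_ne_one
    | ofW₁ w => exact fun _ _ => hW w
    | @mul m n x y hx hy ihx ihy =>
      intro h _
      rcases Nat.add_eq_one_iff.1 h with ⟨rfl, rfl⟩ | ⟨rfl, rfl⟩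
      · exact hl ⟨x, Submodule.subset_span hx⟩ ⟨y, Submodule.subset_span hy⟩ (ihy rfl _)
      · exact hr ⟨x, Submodule.subset_span hx⟩ ⟨y, Submodule.subset_span hy⟩ (ihx rfl _)
  obtain ⟨x, hx⟩ := v
  induction hx using Submodule.span_induction with
  | mem x h => exact key 1 x h rfl _
  | zero =>
    have := hl 0 _ (hW 0)
    have e : lmul 0 (ofWOne (0 : W₁)) = (0 : deg K R W₀ W₁ 1) := Subtype.ext (zero_mul _)
    rwa [e] at this
  | add a b ha hb iha ihb => exact hadd ⟨a, ha⟩ ⟨b, hb⟩ iha ihb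
  | smul c a ha iha =>
    have h := hl (algebraMap K _ c) ⟨a, ha⟩ iha
    have e : lmul (algebraMap K _ c) (⟨a, ha⟩ : deg K R W₀ W₁ 1) =
        ⟨c • a, Submodule.smul_mem _ _ ha⟩ :=
      Subtype.ext (Algebra.smul_def c a).symm
    rwa [e] at h

theorem ofRZero_mul_ofWZero (r : R) (w : W₀) :
    ofRZero K R W₀ W₁ r * ofWZero K R W₀ W₁ w = ofWZero K R W₀ W₁ (r • w) :=
  Subtype.ext ((ofR_mul_ofW _ _).trans (congrArg _ (Prod.ext rfl (smul_zero _))))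

theorem ofWZero_mul_ofRZero (w : W₀) (r : R) :
    ofWZero K R W₀ W₁ w * ofRZero K R W₀ W₁ r = ofWZero K R W₀ W₁ (op r • w) :=
  Subtype.ext ((ofW_mul_ofR _ _).trans (congrArg _ (Prod.ext rfl (smul_zero _))))

end TensorRing

variable (M : Type*) [AddCommGroup M] [Module K M] [Module (degZero K R W₀ W₁)ᵐᵒᵖ M]
  [IsScalarTower K (degZero K R W₀ W₁)ᵐᵒᵖ M]
  (N : Type*) [AddCommGroup N] [Module K N] [Module (degZero K R W₀ W₁)ᵐᵒᵖ N]
  [IsScalarTower K (degZero K R W₀ W₁)ᵐᵒᵖ N]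

/-- The action of `T_R(W)_0` on a right module. -/
noncomputable def actZero : degZero K R W₀ W₁ →ₗ[K] Module.End K M where
  toFun a :=
    { toFun := fun m => op a • m
      map_add' := smul_add _
      map_smul' := fun c m => smul_comm _ _ _ }
  map_add' a b := LinearMap.ext fun m => by
    simp [add_smul]
  map_smul' c a := LinearMap.ext fun m => by
    simp

variable {M N}

theorem actZero_apply (a : degZero K R W₀ W₁) (m : M) : actZero M a m = op a • m := rfl

theorem actZero_mul (a b : degZero K R W₀ W₁) (m : M) :
    actZero M (a * b) m = actZero M b (actZero M a m) :=
  (op_smul_op_smul b a m).symm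

theorem actZero_one (m : M) : actZero M (1 : degZero K R W₀ W₁) m = m := one_smul _ m

/-- Every bimodule morphism `W₁ → Hom_K(M, N)` extends to `T_R(W)_1`. -/
theorem exists_extension (φ : W₁ →ₗ[K] (M →ₗ[K] N))
    (hl : ∀ (r : R) w m, φ (r • w) m = φ w (op (ofRZero K R W₀ W₁ r) • m))
    (hr : ∀ (r : R) w m, φ (op r • w) m = op (ofRZero K R W₀ W₁ r) • φ w m) :
    ∃ f : deg K R W₀ W₁ 1 →ₗ[K] (M →ₗ[K] N),
      (∀ a v m, f (lmul a v) m = f v (op a • m)) ∧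
      (∀ v (a : degZero K R W₀ W₁) m, f (rmul v a) m = op a • f v m) ∧
      ∀ w, f (ofWOne w) = φ w := by
  -- The extension is the corner of a block triangular representation of `T_R(W)` on `M × N`: degree
  -- zero acts diagonally through `A`, and `W₁` acts through `φ` as the off-diagonal block `off`.
  -- The opposite ring appears because the modules are right modules.
  let A : degZero K R W₀ W₁ →ₗ[K] (Module.End K (M × N))ᵐᵒᵖ :=
    { toFun := fun a => op ((actZero M a).prodMap (actZero N a))
      map_add' := fun a b => by
        rw [map_add, map_add, ← op_add]; rfl
      map_smul' := fun c a => by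
        rw [map_smul, map_smul, RingHom.id_apply, ← op_smul]; rfl }
  have Amul : ∀ a b, A (a * b) = A a * A b := fun a b => unop_injective <|
    LinearMap.ext fun x => Prod.ext (actZero_mul a b x.1) (actZero_mul a b x.2)
  have Aone : A 1 = 1 := unop_injective <|
    LinearMap.ext fun x => Prod.ext (actZero_one x.1) (actZero_one x.2)
  let f : R →ₐ[K] (Module.End K (M × N))ᵐᵒᵖ :=
    (AlgHom.ofLinearMap A Aone Amul).comp (ofRZero K R W₀ W₁)
  let ofWZ : W₀ →ₗ[K] degZero K R W₀ W₁ :=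
    { toFun := ofWZero K R W₀ W₁
      map_add' := fun v w => Subtype.ext (by
        change ofW K R W₀ W₁ (v + w, 0) = ofW K R W₀ W₁ (v, 0) + ofW K R W₀ W₁ (w, 0)
        rw [← map_add, Prod.mk_add_mk, add_zero])
      map_smul' := fun c w => Subtype.ext (by
        change ofW K R W₀ W₁ (c • w, 0) = c • ofW K R W₀ W₁ (w, 0)
        rw [← map_smul, Prod.smul_mk, smul_zero]) }
  let off : W₁ →ₗ[K] (Module.End K (M × N))ᵐᵒᵖ :=
    { toFun := fun w => op (LinearMap.inr K M N ∘ₗ φ w ∘ₗ LinearMap.fst K M N)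
      map_add' := fun v w => unop_injective <| LinearMap.ext fun x => by simp
      map_smul' := fun c w => unop_injective <| LinearMap.ext fun x => by simp }
  let g : (W₀ × W₁) →ₗ[K] (Module.End K (M × N))ᵐᵒᵖ := (A ∘ₗ ofWZ).coprod off
  have gl : ∀ r w, g (r • w) = f r * g w := fun r w => by
    have h1 : A (ofWZ (r • w.1)) = A (ofRZero K R W₀ W₁ r) * A (ofWZ w.1) := by
      rw [← Amul]; exact congrArg A (ofRZero_mul_ofWZero r w.1).symm
    have h2 : off (r • w.2) = A (ofRZero K R W₀ W₁ r) * off w.2 :=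
      unop_injective <| LinearMap.ext fun x => Prod.ext rfl (hl r w.2 x.1)
    change A (ofWZ (r • w.1)) + off (r • w.2) =
      A (ofRZero K R W₀ W₁ r) * (A (ofWZ w.1) + off w.2)
    rw [h1, h2, mul_add]
  have gr : ∀ r w, g (op r • w) = g w * f r := fun r w => by
    have h1 : A (ofWZ (op r • w.1)) = A (ofWZ w.1) * A (ofRZero K R W₀ W₁ r) := by
      rw [← Amul]; exact congrArg A (ofWZero_mul_ofRZero w.1 r).symm
    have h2 : off (op r • w.2) = off w.2 * A (ofRZero K R W₀ W₁ r) :=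
      unop_injective <| LinearMap.ext fun x => Prod.ext (smul_zero _).symm (hr r w.2 x.1)
    change A (ofWZ (op r • w.1)) + off (op r • w.2) =
      (A (ofWZ w.1) + off w.2) * A (ofRZero K R W₀ W₁ r)
    rw [h1, h2, add_mul]
  let Φ := lift f g gl gr
  have ΦW : ∀ w, Φ (ofW K R W₀ W₁ w) = g w := lift_ofW f g gl gr
  -- Elements of degree zero stay block diagonal, so multiplying by them on either side changes the
  -- corner only through their action on `M` or on `N`. This is the bimodule property.
  have hA : ∀ a : degZero K R W₀ W₁, Φ a.1 = A a := by
    intro a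
    induction a using degZero_induction with
    | hR r => exact lift_ofR f g gl gr r
    | hW w => exact (ΦW (w, 0)).trans (by simp [g, ofWZ])
    | hadd a b ha hb => rw [map_add, ← ha, ← hb]; exact map_add Φ _ _
    | hmul a b ha hb => rw [Amul, ← ha, ← hb]; exact map_mul Φ _ _
  refine ⟨
    { toFun := fun v => LinearMap.snd K M N ∘ₗ (Φ v.1).unop ∘ₗ LinearMap.inl K M N
      map_add' := fun v w => LinearMap.ext fun m => by simp
      map_smul' := fun c v => LinearMap.ext fun m => by simp }, ?_, ?_, ?_⟩
  · intro a v m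
    change ((Φ (a.1 * v.1)).unop (m, 0)).2 = ((Φ v.1).unop (op a • m, 0)).2
    rw [map_mul, hA, unop_mul, Module.End.mul_apply]
    change ((Φ v.1).unop (op a • m, op a • 0)).2 = _
    rw [smul_zero]
  · intro v a m
    change ((Φ (v.1 * a.1)).unop (m, 0)).2 = op a • ((Φ v.1).unop (m, 0)).2
    rw [map_mul, hA, unop_mul, Module.End.mul_apply]
    rfl
  · intro w
    refine LinearMap.ext fun m => ?_
    change ((Φ (ofW K R W₀ W₁ (0, w))).unop (m, 0)).2 = _
    rw [ΦW]
    simp [g, off]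

variable (D : Ditalgebra K R W₀ W₁)

/-- The compatibility of a pair `(f⁰, f¹)` with the differential need only be checked on `W₀`. -/
theorem compat_of_ofWZero (f₀ : M →ₗ[K] N) (f₁ : deg K R W₀ W₁ 1 →ₗ[K] (M →ₗ[K] N))
    (h₀ : ∀ (r : R) (m : M), f₀ (op (ofRZero K R W₀ W₁ r) • m) = op (ofRZero K R W₀ W₁ r) • f₀ m)
    (hl : ∀ (a : degZero K R W₀ W₁) (v : deg K R W₀ W₁ 1) (m : M),
      f₁ (lmul a v) m = f₁ v (op a • m))
    (hr : ∀ (v : deg K R W₀ W₁ 1) (a : degZero K R W₀ W₁) (m : M),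
      f₁ (rmul v a) m = op a • f₁ v m)
    (hW : ∀ (w : W₀) (m : M), op (ofWZero K R W₀ W₁ w) • f₀ m =
      f₀ (op (ofWZero K R W₀ W₁ w) • m) + f₁ (D.dZero (ofWZero K R W₀ W₁ w)) m)
    (a : degZero K R W₀ W₁) : ∀ m : M, op a • f₀ m = f₀ (op a • m) + f₁ (D.dZero a) m := by
  induction a using degZero_induction with
  | hR r =>
    intro m
    have e : D.dZero (ofRZero K R W₀ W₁ r) = 0 := Subtype.ext (D.d_ofR r)
    rw [e, h₀, map_zero, LinearMap.zero_apply, add_zero]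
  | hW w => exact hW w
  | hadd a b ha hb =>
    intro m
    have e : D.dZero (a + b) = D.dZero a + D.dZero b := Subtype.ext (map_add D.d _ _)
    rw [e, op_add, add_smul, add_smul, ha, hb, map_add, map_add, LinearMap.add_apply]
    abel
  | hmul a b ha hb =>
    intro m
    -- The defect of `a` is acted on by `b` afterwards, and the defect of `b` is evaluated at `m a`.
    -- These are the two terms of the Leibniz rule.
    have e : D.dZero (a * b) = rmul (D.dZero a) b + lmul a (D.dZero b) :=
      Subtype.ext (leibniz_zero (D.d_mul 0 a.1 a.2 b.1))
    rw [e, map_add, LinearMap.add_apply, hl, hr, op_mul, mul_smul, mul_smul, ha, smul_add, hb]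
    abel

variable {D} {L : Type*} [AddCommGroup L] [Module K L] [Module (degZero K R W₀ W₁)ᵐᵒᵖ L]

/-- The space of the pairs `(∑ vᵢ¹ vᵢ², ∑ g¹(vᵢ²) f¹(vᵢ¹))`. -/
noncomputable def Ditalgebra.pairSpan (g : D.Hom N L) (f : D.Hom M N) :
    Submodule K (TensorRing K R W₀ W₁ × (M →ₗ[K] L)) :=
  Submodule.span K {x | ∃ v w : deg K R W₀ W₁ 1, x = (v.1 * w.1, g.f₁ w ∘ₗ f.f₁ v)}

theorem Ditalgebra.mem_pairSpan {g : D.Hom N L} {f : D.Hom M N} (v w : deg K R W₀ W₁ 1) :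
    (v.1 * w.1, g.f₁ w ∘ₗ f.f₁ v) ∈ Ditalgebra.pairSpan g f :=
  Submodule.subset_span ⟨v, w, rfl⟩

/-- A left factor `a` is absorbed by the first factor of each product `v w`; on the side of the
maps, `f¹(a v)(m) = f¹(v)(m a)` turns it into a precomposition. The right-hand version uses `g¹` on
the second factor in the same way. -/
theorem Ditalgebra.lmul_mem_pairSpan {g : D.Hom N L} {f : D.Hom M N} (a : degZero K R W₀ W₁)
    {x : TensorRing K R W₀ W₁ × (M →ₗ[K] L)} (hx : x ∈ Ditalgebra.pairSpan g f) :
    (a.1 * x.1, x.2 ∘ₗ actZero M a) ∈ Ditalgebra.pairSpan g f := by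
  induction hx using Submodule.span_induction with
  | mem x hx =>
    obtain ⟨v, w, rfl⟩ := hx
    have h := mem_pairSpan (g := g) (f := f) (lmul a v) w
    convert h using 2
    · exact (mul_assoc _ _ _).symm
    · exact LinearMap.ext fun m => congrArg (g.f₁ w) (f.map_lmul a v m).symm
  | zero =>
    convert zero_mem (Ditalgebra.pairSpan g f) using 1
    exact Prod.ext (mul_zero _) (LinearMap.zero_comp _)
  | add x y _ _ hx hy =>
    have := add_mem hx hy
    rwa [Prod.mk_add_mk, ← mul_add, ← LinearMap.add_comp] at this
  | smul c x _ hx =>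
    have := Submodule.smul_mem _ c hx
    rwa [Prod.smul_mk, ← mul_smul_comm, ← LinearMap.smul_comp] at this

theorem Ditalgebra.rmul_mem_pairSpan [IsScalarTower K (degZero K R W₀ W₁)ᵐᵒᵖ L]
    {g : D.Hom N L} {f : D.Hom M N} (a : degZero K R W₀ W₁)
    {x : TensorRing K R W₀ W₁ × (M →ₗ[K] L)} (hx : x ∈ Ditalgebra.pairSpan g f) :
    (x.1 * a.1, actZero L a ∘ₗ x.2) ∈ Ditalgebra.pairSpan g f := by
  induction hx using Submodule.span_induction with
  | mem x hx =>
    obtain ⟨v, w, rfl⟩ := hx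
    have h := mem_pairSpan (g := g) (f := f) v (rmul w a)
    convert h using 2
    · exact mul_assoc _ _ _
    · exact LinearMap.ext fun m => (g.map_rmul w a _).symm
  | zero =>
    convert zero_mem (Ditalgebra.pairSpan g f) using 1
    exact Prod.ext (zero_mul _) (LinearMap.comp_zero _)
  | add x y _ _ hx hy =>
    have := add_mem hx hy
    rwa [Prod.mk_add_mk, ← add_mul, ← LinearMap.comp_add] at this
  | smul c x _ hx =>
    have := Submodule.smul_mem _ c hx
    rwa [Prod.smul_mk, ← smul_mul_assoc, ← LinearMap.comp_smul] at this

/-- A criterion for `g f = id`, in terms of the values of `f¹` and `g¹` on `W₁`. -/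
theorem Ditalgebra.isComp_id (g : D.Hom N M) (f : D.Hom M N) (h₀ : ∀ m, g.f₀ (f.f₀ m) = m)
    (hW : ∀ w : W₁, (D.d (ofWOne (K := K) (R := R) (W₀ := W₀) w).1,
      g.f₁ (ofWOne w) ∘ₗ f.f₀ + g.f₀ ∘ₗ f.f₁ (ofWOne w)) ∈ Ditalgebra.pairSpan g f) :
    Ditalgebra.IsComp g f (Ditalgebra.Hom.id D M) := by
  refine ⟨LinearMap.ext fun m => (h₀ m).symm, fun v => ?_⟩
  -- The identity has second component zero, so `IsComp` asks for one expression `d(v) = ∑ vᵢ¹ vᵢ²`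
  -- whose correction term `∑ g¹(vᵢ²) f¹(vᵢ¹)` equals `g¹(v) f⁰ + g⁰ f¹(v)`. As membership in a
  -- subspace, this passes from `W₁` to all of degree one.
  have key : (D.d v.1, g.f₁ v ∘ₗ f.f₀ + g.f₀ ∘ₗ f.f₁ v) ∈ Ditalgebra.pairSpan g f := by
    induction v using degOne_induction with
    | hW w => exact hW w
    | hadd v w hv hw =>
      have := add_mem hv hw
      convert this using 1
      refine Prod.ext (map_add D.d _ _) ?_
      simp only [map_add, LinearMap.add_comp, LinearMap.comp_add, Prod.snd_add]
      abel
    | hl a v hv =>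
      -- The new summand `d(a) v` of `d(a v)` brings in `g¹(v) f¹(d(a))`, which is exactly the
      -- failure of `f⁰` to commute with `a`.
      have := add_mem (lmul_mem_pairSpan a hv) (mem_pairSpan (g := g) (f := f) (D.dZero a) v)
      convert this using 1
      refine Prod.ext ((leibniz_zero (D.d_mul 0 a.1 a.2 v.1)).trans (add_comm _ _)) ?_
      refine LinearMap.ext fun m => ?_
      have h1 := f.compat a m
      simp only [Prod.snd_add, LinearMap.add_apply, LinearMap.comp_apply, g.map_lmul, f.map_lmul,
        actZero_apply, h1, map_add]
      abel
    | hr v a hv =>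
      -- Here `d(v a) = d(v) a - v d(a)`, and the minus sign matches `g⁰(m' a) = g⁰(m') a -
      -- g¹(d(a))(m')` for `m' = f¹(v)(m)`. This fixes the sign in the composition rule.
      have := sub_mem (rmul_mem_pairSpan a hv) (mem_pairSpan (g := g) (f := f) v (D.dZero a))
      convert this using 1
      refine Prod.ext (leibniz_one (D.d_mul 1 v.1 v.2 a.1)) ?_
      refine LinearMap.ext fun m => ?_
      have h1 := g.compat a (f.f₁ v m)
      simp only [Prod.snd_sub, LinearMap.add_apply, LinearMap.sub_apply, LinearMap.comp_apply,
        g.map_rmul, f.map_rmul, actZero_apply, smul_add, h1]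
      abel
  obtain ⟨n, c, x, hx⟩ := (Submodule.mem_span_set').1 key
  choose a b hab using fun i => (x i).2
  have h1 := congrArg Prod.fst hx
  have h2 := congrArg Prod.snd hx
  simp only [hab, Prod.fst_sum, Prod.snd_sum, Prod.smul_mk] at h1 h2
  -- The coefficients of the linear combination are moved into the left factors.
  refine ⟨n, fun i => c i • a i, b, ?_, ?_⟩
  · rw [← h1]
    exact Finset.sum_congr rfl fun i _ => (smul_mul_assoc _ _ _).symm
  · rw [← h2, eq_comm]
    refine sub_eq_zero.2 (Finset.sum_congr rfl fun i _ => ?_)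
    rw [map_smul, LinearMap.comp_smul]

end GradedModules

end EqPoset

namespace EqPoset

/-! ### The convolution product dual to the multiplication of `J` -/

section Convolution

variable {K Λ : Type*} [Field K] [Ring Λ] [Algebra K Λ] {S : Subalgebra K Λ} {J : Ideal Λ}
  [J.IsTwoSided] (B : DualBasis S J) {T : Type*} [Ring T] [Algebra K T]

namespace DualBasis

theorem comul_add_left (a b c : LDual S J →ₗ[K] T) :
    B.comul (a + b) c = B.comul a c + B.comul b c := by
  refine LinearMap.ext fun γ => ?_
  simp only [LinearMap.add_apply, comul_apply, add_mul, Finset.sum_add_distrib]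

theorem comul_add_right (a b c : LDual S J →ₗ[K] T) :
    B.comul a (b + c) = B.comul a b + B.comul a c := by
  refine LinearMap.ext fun γ => ?_
  simp only [LinearMap.add_apply, comul_apply, mul_add, Finset.sum_add_distrib]

theorem comul_neg_left (a b : LDual S J →ₗ[K] T) : B.comul (-a) b = -B.comul a b := by
  refine LinearMap.ext fun γ => ?_
  simp only [LinearMap.neg_apply, comul_apply, neg_mul, Finset.sum_neg_distrib]

theorem comul_neg_right (a b : LDual S J →ₗ[K] T) : B.comul a (-b) = -B.comul a b := by
  refine LinearMap.ext fun γ => ?_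
  simp only [LinearMap.neg_apply, comul_apply, mul_neg, Finset.sum_neg_distrib]

theorem comul_assoc (a b c : LDual S J →ₗ[K] T)
    (hbc : ∀ (s : S) γ δ, b (op s • γ) * c δ = b γ * c (s • δ)) :
    B.comul (B.comul a b) c = B.comul a (B.comul b c) :=
  LinearMap.ext fun γ => B.coassoc a b c hbc γ

/-- `∑ j, γⱼ γ(pⱼ pᵢ) = pᵢ γ`. -/
theorem sum_coef_app (γ : LDual S J) (i : Fin B.n) (q : J) :
    (∑ j, op (B.coef γ i j) • B.γ j) q = γ (mulR q (B.p i : Λ)) := by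
  have e := congrArg Subtype.val (B.sum_smul q)
  rw [AddSubmonoidClass.coe_finsetSum] at e
  simp only [LDual.sum_app, LDual.op_smul_app, coef, ← LDual.map_smul]
  rw [← LDual.map_sum]
  congr 1
  refine Subtype.ext ?_
  rw [AddSubmonoidClass.coe_finsetSum]
  change ∑ j, (B.γ j q : Λ) * ((B.p j : Λ) * (B.p i : Λ)) = (q : Λ) * (B.p i : Λ)
  simp only [← mul_assoc]
  rw [← Finset.sum_mul]
  exact congrArg (· * (B.p i : Λ)) e

/-- `t` is a morphism of bimodules, if `S` acts on `T` through `ρ`. -/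
structure IsBimod (ρ : S → T) (t : LDual S J →ₗ[K] T) : Prop where
  left : ∀ s γ, t (s • γ) = ρ s * t γ
  right : ∀ s γ, t (op s • γ) = t γ * ρ s

theorem IsBimod.balanced {ρ : S → T} {t u : LDual S J →ₗ[K] T} (ht : IsBimod ρ t)
    (hu : ∀ s γ, u (s • γ) = ρ s * u γ) (s : S) (γ δ : LDual S J) :
    t (op s • γ) * u δ = t γ * u (s • δ) := by
  rw [ht.right, hu, mul_assoc]

theorem IsBimod.comul {ρ : S → T} {t u : LDual S J →ₗ[K] T} (ht : IsBimod ρ t)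
    (hu : IsBimod ρ u) : IsBimod ρ (B.comul t u) :=
  ⟨fun s => B.comul_left t u s _ (ht.left s) (ht.balanced hu.left),
    fun s => B.comul_right t u s _ (hu.right s)⟩

theorem IsBimod.neg {ρ : S → T} {t : LDual S J →ₗ[K] T} (ht : IsBimod ρ t) : IsBimod ρ (-t) :=
  ⟨fun s γ => by simp [ht.left], fun s γ => by simp [ht.right]⟩

theorem IsBimod.sub {ρ : S → T} {t u : LDual S J →ₗ[K] T} (ht : IsBimod ρ t)
    (hu : IsBimod ρ u) : IsBimod ρ (t - u) :=
  ⟨fun s γ => by simp [ht.left, hu.left, mul_sub], fun s γ => by simp [ht.right, hu.right, sub_mul]⟩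

theorem IsBimod.zero {ρ : S → T} : IsBimod ρ (0 : LDual S J →ₗ[K] T) :=
  ⟨fun s γ => by simp, fun s γ => by simp⟩

/-- If `J` is nilpotent, then `1 + t` is invertible for the convolution product. -/
theorem exists_convInverse {ρ : S → T} {t : LDual S J →ₗ[K] T} (ht : IsBimod ρ t)
    (F : ℕ → J → Prop) (F_zero : ∀ j, F 0 j)
    (F_succ : ∀ n j (q : J), F n j → F (n + 1) (mulR j (q : Λ))) (N : ℕ)
    (F_last : ∀ j, F N j → j = 0) :
    ∃ s : LDual S J →ₗ[K] T, IsBimod ρ s ∧ s + t + B.comul t s = 0 ∧ s + t + B.comul s t = 0 := by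
  -- These are the partial sums of the Neumann series `-t + t² - t³ + ⋯` of `(1 + t)⁻¹ - 1`, powers
  -- being taken for convolution.
  let u : ℕ → (LDual S J →ₗ[K] T) := fun n => Nat.rec 0 (fun _ v => -t - B.comul t v) n
  have u_succ : ∀ n, u (n + 1) = -t - B.comul t (u n) := fun n => rfl
  have hu : ∀ n, IsBimod ρ (u n) := by
    intro n
    induction n with
    | zero => exact .zero
    | succ n ih => rw [u_succ]; exact ht.neg.sub (ht.comul B ih)
  -- Each `u n` is a polynomial in `t` without constant term, so it commutes with `t`. This makes
  -- the inverse two-sided.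
  have hcomm : ∀ n, B.comul (u n) t = B.comul t (u n) := by
    intro n
    induction n with
    | zero =>
      refine LinearMap.ext fun γ => ?_
      simp [u, comul_apply]
    | succ n ih =>
      rw [u_succ, sub_eq_add_neg, comul_add_left, comul_neg_left, comul_neg_left, comul_add_right,
        comul_neg_right, comul_neg_right, B.comul_assoc t (u n) t ((hu n).balanced ht.left), ih]
  -- If `γ` vanishes on stage `n + 1` of the filtration, then the functional `q ↦ γ(q pᵢ)`, which is
  -- the second tensor factor of the comultiplication paired with `γᵢ`, vanishes on stage `n`,
  -- because right multiplication by `J` raises the stage.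
  have hstep : ∀ n γ, (∀ j, F n j → γ j = 0) → u (n + 1) γ = u n γ := by
    intro n
    induction n with
    | zero =>
      intro γ hγ
      have : γ = 0 := LDual.ext fun j => hγ j (F_zero j)
      rw [this, map_zero, map_zero]
    | succ n ih =>
      intro γ hγ
      rw [u_succ (n + 1), u_succ n, LinearMap.sub_apply, LinearMap.sub_apply, comul_apply,
        comul_apply]
      congr 1
      refine Finset.sum_congr rfl fun i _ => ?_
      rw [← Finset.mul_sum, ← Finset.mul_sum, ← map_sum, ← map_sum, ih]
      intro j hj
      rw [sum_coef_app]
      exact hγ _ (F_succ n j _ hj)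
  have hlast : u (N + 1) = u N := LinearMap.ext fun γ => hstep N γ fun j hj => by
    rw [F_last j hj]
    exact LinearMap.map_zero (show J →ₗ[S] S from γ)
  -- At stage `N` only `0` is left, so every functional vanishes there and the recursion is
  -- stationary. Its fixed point solves `s = -t - t s`.
  have h1 : u N + t + B.comul t (u N) = 0 := by
    have h := u_succ N
    rw [hlast, eq_sub_iff_add_eq] at h
    rw [add_right_comm, h, neg_add_cancel]
  exact ⟨u N, hu N, h1, by rw [hcomm]; exact h1⟩

end DualBasis

end Convolution

end EqPoset

namespace EqPoset

/-! ### Isomorphisms over a Drozd ditalgebra as pairs `(f⁰, a)` -/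

section DrozdIso

open TensorRing

variable {K Λ : Type*} [Field K] [Ring Λ] [Algebra K Λ] {S : Subalgebra K Λ} {J : Ideal Λ}
  [J.IsTwoSided] (B : DualBasis S J)

/-- Two pairs of actions of `S × S` and `*J` on `M` and on `N`, and an isomorphism between them
that is given by `f⁰` and the values `a` of `f¹` on `w₁ *J`. -/
structure RepEquiv {M N : Type*} [AddCommGroup M] [Module K M] [AddCommGroup N] [Module K N]
    (ρM : S × S → Module.End K M) (wM : LDual S J → Module.End K M)
    (ρN : S × S → Module.End K N) (wN : LDual S J → Module.End K N) where
  f₀ : M ≃ₗ[K] N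
  a : LDual S J →ₗ[K] (M →ₗ[K] N)
  map_smul : ∀ r m, f₀ (ρM r m) = ρN r (f₀ m)
  a_left : ∀ (s t : S) γ m, a (s • γ) m = a γ (ρM (s, t) m)
  a_right : ∀ (s t : S) γ m, a (op s • γ) m = ρN (s, t) (a γ m)
  eqn : ∀ γ m, wN γ (f₀ m) + ∑ i, ∑ j, wN (op (B.coef γ i j) • B.γ j) (a (B.γ i) m) =
    f₀ (wM γ m)

/-- `γ ↦ h ∘ x γ ∘ g`. -/
noncomputable def conjMap {M M' N N' : Type*} [AddCommGroup M] [Module K M] [AddCommGroup N]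
    [Module K N] [AddCommGroup M'] [Module K M'] [AddCommGroup N'] [Module K N']
    (g : M →ₗ[K] M') (h : N' →ₗ[K] N) (x : LDual S J →ₗ[K] (M' →ₗ[K] N')) :
    LDual S J →ₗ[K] (M →ₗ[K] N) where
  toFun γ := h ∘ₗ x γ ∘ₗ g
  map_add' γ δ := by rw [map_add, LinearMap.add_comp, LinearMap.comp_add]
  map_smul' c γ := by rw [map_smul, LinearMap.smul_comp, LinearMap.comp_smul, RingHom.id_apply]

variable {M N : Type*} [AddCommGroup M] [Module K M] [AddCommGroup N] [Module K N]
  {ρM : S × S → Module.End K M} {wM : LDual S J →ₗ[K] Module.End K M}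
  {ρN : S × S → Module.End K N} {wN : LDual S J →ₗ[K] Module.End K N}

/-- The inverse of an isomorphism that is given on generators. -/
theorem RepEquiv.exists_symm (E : RepEquiv B ρM wM ρN wN)
    (ρM_mul : ∀ r r' m, ρM (r * r') m = ρM r' (ρM r m))
    (wN_left : ∀ (s t : S) γ m, wN (s • γ) m = wN γ (ρN (s, t) m))
    (F : ℕ → J → Prop) (F_zero : ∀ j, F 0 j)
    (F_succ : ∀ n j (q : J), F n j → F (n + 1) (mulR j (q : Λ))) (n : ℕ)
    (F_last : ∀ j, F n j → j = 0) :
    ∃ E' : RepEquiv B ρN wN ρM wM, E'.f₀ = E.f₀.symm ∧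
      (∀ γ m, E'.a γ (E.f₀ m) + E'.f₀ (E.a γ m) +
        ∑ i, ∑ j, E'.a (op (B.coef γ i j) • B.γ j) (E.a (B.γ i) m) = 0) ∧
      ∀ γ m, E.a γ (E'.f₀ m) + E.f₀ (E'.a γ m) +
        ∑ i, ∑ j, E.a (op (B.coef γ i j) • B.γ j) (E'.a (B.γ i) m) = 0 := by
  -- All data are transported to `M` by `f⁰`: `t` is `(f⁰)⁻¹ a`, `w` is the action of `w₁₂ *J` on
  -- `M`, and `w'` is that on `N`. In the opposite ring the sum of the maps `v(γ²) u(γ¹)` is the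
  -- convolution of `u` and `v`, in this order.
  let o : Module.End K M ≃ₗ[K] (Module.End K M)ᵐᵒᵖ := opLinearEquiv K
  let ρ : S → (Module.End K M)ᵐᵒᵖ := fun s => op (ρM (s, 0))
  let t : LDual S J →ₗ[K] (Module.End K M)ᵐᵒᵖ :=
    o.toLinearMap ∘ₗ conjMap LinearMap.id E.f₀.symm.toLinearMap E.a
  let w : LDual S J →ₗ[K] (Module.End K M)ᵐᵒᵖ := o.toLinearMap ∘ₗ wM
  let w' : LDual S J →ₗ[K] (Module.End K M)ᵐᵒᵖ :=
    o.toLinearMap ∘ₗ conjMap E.f₀.toLinearMap E.f₀.symm.toLinearMap wN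
  have t_app : ∀ γ m, (t γ).unop m = E.f₀.symm (E.a γ m) := fun _ _ => rfl
  have w_app : ∀ γ m, (w γ).unop m = wM γ m := fun _ _ => rfl
  have w'_app : ∀ γ m, (w' γ).unop m = E.f₀.symm (wN γ (E.f₀ m)) := fun _ _ => rfl
  have ρ_app : ∀ s m, (ρ s).unop m = ρM (s, 0) m := fun _ _ => rfl
  have sR : ∀ r m, E.f₀.symm (ρN r m) = ρM r (E.f₀.symm m) := by
    intro r m
    rw [LinearEquiv.symm_apply_eq, E.map_smul, LinearEquiv.apply_symm_apply]
  have ht : DualBasis.IsBimod ρ t := by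
    refine ⟨fun s γ => unop_injective (LinearMap.ext fun m => ?_),
      fun s γ => unop_injective (LinearMap.ext fun m => ?_)⟩
    · rw [unop_mul, Module.End.mul_apply, t_app, t_app, ρ_app, E.a_left s 0]
    · rw [unop_mul, Module.End.mul_apply, ρ_app, t_app, t_app, E.a_right s 0, sR]
  have hw' : ∀ s γ, w' (s • γ) = ρ s * w' γ := by
    refine fun s γ => unop_injective (LinearMap.ext fun m => ?_)
    rw [unop_mul, Module.End.mul_apply, w'_app, w'_app, ρ_app, E.map_smul, wN_left s 0]
  have unop_sum : ∀ (u v : LDual S J →ₗ[K] (Module.End K M)ᵐᵒᵖ) γ m, (B.comul u v γ).unop m =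
      ∑ i, ∑ j, (v (op (B.coef γ i j) • B.γ j)).unop ((u (B.γ i)).unop m) := by
    intro u v γ m
    rw [B.comul_apply, Finset.unop_sum, LinearMap.sum_apply]
    refine Finset.sum_congr rfl fun i _ => ?_
    rw [Finset.unop_sum, LinearMap.sum_apply]
    rfl
  -- The equation of the isomorphism reads `w = (1 + t) w'` for convolution.
  have hE : w' + B.comul t w' = w := by
    refine LinearMap.ext fun γ => unop_injective (LinearMap.ext fun m => ?_)
    rw [LinearMap.add_apply, unop_add, LinearMap.add_apply, w'_app, w_app, unop_sum]
    simp only [w'_app, t_app, LinearEquiv.apply_symm_apply, ← map_sum]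
    rw [← map_add, E.eqn, LinearEquiv.symm_apply_apply]
  obtain ⟨s, hs, h1, h2⟩ := B.exists_convInverse ht F F_zero F_succ n F_last
  -- Multiplication by `1 + s` on the left inverts `hE`: by associativity the difference of the two
  -- sides is `(s + t + s t) w' = 0`.
  have hE' : w + B.comul s w = w' := by
    have h3 := B.comul_assoc s t w' (ht.balanced hw')
    rw [← hE, B.comul_add_right, ← h3]
    have h4 : B.comul (s + t + B.comul s t) w' = 0 := by
      rw [h2]
      exact LinearMap.ext fun γ => by simp [B.comul_apply]
    rw [B.comul_add_left, B.comul_add_left] at h4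
    rw [add_assoc, ← add_assoc (B.comul t w'), add_comm (B.comul t w'), h4, add_zero]
  let b : LDual S J →ₗ[K] (N →ₗ[K] M) :=
    conjMap E.f₀.symm.toLinearMap LinearMap.id (o.symm.toLinearMap ∘ₗ s)
  have b_app : ∀ γ m, b γ m = (s γ).unop (E.f₀.symm m) := fun _ _ => rfl
  refine ⟨⟨E.f₀.symm, b, sR, ?_, ?_, ?_⟩, rfl, ?_, ?_⟩
  · intro c d γ m
    -- The action `ρ` only knows the pairs `(c, 0)`. Since `s γ` absorbs `ρ 1`, the second component
    -- `d` of a pair `(c, d)` is multiplied by `0` and drops out.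
    have e : s γ = ρ 1 * s γ := by rw [← hs.left, one_smul]
    rw [b_app, b_app, sR, hs.left, unop_mul, Module.End.mul_apply, ρ_app, e, unop_mul,
      Module.End.mul_apply, Module.End.mul_apply, ρ_app, ρ_app, ← ρM_mul, ← ρM_mul]
    simp
  · intro c d γ m
    have e : s γ = s γ * ρ 1 := by rw [← hs.right, op_one, one_smul]
    rw [b_app, b_app, hs.right, unop_mul, Module.End.mul_apply, ρ_app, e, unop_mul,
      Module.End.mul_apply, ρ_app, ← ρM_mul, ← ρM_mul]
    simp
  · intro γ m
    have h := congrArg (fun x => (x γ).unop (E.f₀.symm m)) hE'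
    rw [LinearMap.add_apply, unop_add, LinearMap.add_apply, w'_app, w_app, unop_sum,
      LinearEquiv.apply_symm_apply] at h
    exact h
  · intro γ m
    have h := congrArg (fun x => (x γ).unop m) h1
    rw [LinearMap.add_apply, unop_add, LinearMap.add_apply, LinearMap.add_apply, unop_add,
      LinearMap.add_apply, unop_sum, t_app] at h
    simp only [b_app, LinearEquiv.symm_apply_apply]
    exact h
  · intro γ m
    have h := congrArg (fun x => E.f₀ ((x γ).unop (E.f₀.symm m))) h2
    rw [LinearMap.add_apply, unop_add, LinearMap.add_apply, LinearMap.add_apply, unop_add,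
      LinearMap.add_apply, unop_sum, t_app, map_add, map_add, LinearEquiv.apply_symm_apply,
      map_sum] at h
    simp only [t_app, map_sum, LinearEquiv.apply_symm_apply] at h
    rw [add_comm (E.f₀ _)] at h
    simp only [b_app]
    rw [h]
    simp

variable {W₀ W₁ : Type*}
  [AddCommGroup W₀] [Module K W₀] [Module (S × S) W₀] [Module (S × S)ᵐᵒᵖ W₀]
  [AddCommGroup W₁] [Module K W₁] [Module (S × S) W₁] [Module (S × S)ᵐᵒᵖ W₁]

/-- A description of a ditalgebra as the Drozd ditalgebra of `S ⊕ J`, by generators. -/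
structure IsDrozd (D : Ditalgebra K (S × S) W₀ W₁) (w₁₂ : LDual S J →ₗ[K] W₀)
    (w₁ w₂ : LDual S J →ₗ[K] W₁) (pr₁ pr₂ : W₁ →ₗ[K] LDual S J) : Prop where
  surj : Function.Surjective w₁₂
  pr_add : ∀ w, w₁ (pr₁ w) + w₂ (pr₂ w) = w
  pr₁_w₁ : ∀ γ, pr₁ (w₁ γ) = γ
  pr₁_w₂ : ∀ γ, pr₁ (w₂ γ) = 0
  pr₁_left : ∀ (r : S × S) w, pr₁ (r • w) = r.1 • pr₁ w
  pr₁_right : ∀ (r : S × S) w, pr₁ (op r • w) = op r.1 • pr₁ w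
  w₁₂_right : ∀ (r : S × S) γ, w₁₂ (op r.2 • γ) = op r • w₁₂ γ
  w₁_left : ∀ (r : S × S) γ, w₁ (r.1 • γ) = r • w₁ γ
  w₁_right : ∀ (r : S × S) γ, w₁ (op r.1 • γ) = op r • w₁ γ
  w₂_left : ∀ (r : S × S) γ, w₂ (r.2 • γ) = r • w₂ γ
  dZero : ∀ γ, D.dZero (ofWZero K _ _ _ (w₁₂ γ)) = ∑ i, ∑ j,
    (lmul (ofWZero K _ _ _ (w₁₂ (B.γ i))) (ofWOne (w₂ (op (B.coef γ i j) • B.γ j))) -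
      rmul (ofWOne (w₁ (B.γ i))) (ofWZero K _ _ _ (w₁₂ (op (B.coef γ i j) • B.γ j))))
  d₁ : ∀ γ, D.d (ofWOne (K := K) (R := S × S) (W₀ := W₀) (w₁ γ)).1 = -∑ i, ∑ j,
    (ofWOne (w₁ (B.γ i))).1 * (ofWOne (w₁ (op (B.coef γ i j) • B.γ j))).1
  d₂ : ∀ γ, D.d (ofWOne (K := K) (R := S × S) (W₀ := W₀) (w₂ γ)).1 = -∑ i, ∑ j,
    (ofWOne (w₂ (B.γ i))).1 * (ofWOne (w₂ (op (B.coef γ i j) • B.γ j))).1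

namespace TensorRing

variable {R W₀ W₁ : Type*} [Ring R] [Algebra K R]
  [AddCommGroup W₀] [Module K W₀] [Module R W₀] [Module Rᵐᵒᵖ W₀]
  [AddCommGroup W₁] [Module K W₁] [Module R W₁] [Module Rᵐᵒᵖ W₁]

/-- `ofWOne`, as a linear map. -/
noncomputable def ofWOneHom : W₁ →ₗ[K] deg K R W₀ W₁ 1 where
  toFun := ofWOne
  map_add' v w := Subtype.ext (by
    change ofW K R W₀ W₁ (0, v + w) = ofW K R W₀ W₁ (0, v) + ofW K R W₀ W₁ (0, w)
    rw [← map_add, Prod.mk_add_mk, add_zero])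
  map_smul' c w := Subtype.ext (by
    change ofW K R W₀ W₁ (0, c • w) = c • ofW K R W₀ W₁ (0, w)
    rw [← map_smul, Prod.smul_mk, smul_zero])

/-- `ofWZero`, as a linear map. -/
noncomputable def ofWZeroHom : W₀ →ₗ[K] degZero K R W₀ W₁ where
  toFun := ofWZero K R W₀ W₁
  map_add' v w := Subtype.ext (by
    change ofW K R W₀ W₁ (v + w, 0) = ofW K R W₀ W₁ (v, 0) + ofW K R W₀ W₁ (w, 0)
    rw [← map_add, Prod.mk_add_mk, add_zero])
  map_smul' c w := Subtype.ext (by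
    change ofW K R W₀ W₁ (c • w, 0) = c • ofW K R W₀ W₁ (w, 0)
    rw [← map_smul, Prod.smul_mk, smul_zero])

theorem lmul_ofRZero_ofWOne (r : R) (w : W₁) :
    lmul (ofRZero K R W₀ W₁ r) (ofWOne w) = ofWOne (r • w) :=
  Subtype.ext ((ofR_mul_ofW _ _).trans (congrArg _ (Prod.ext (smul_zero _) rfl)))

theorem rmul_ofWOne_ofRZero (r : R) (w : W₁) :
    rmul (ofWOne w) (ofRZero K R W₀ W₁ r) = ofWOne (op r • w) :=
  Subtype.ext ((ofW_mul_ofR _ _).trans (congrArg _ (Prod.ext (smul_zero _) rfl)))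

end TensorRing

variable {D : Ditalgebra K (S × S) W₀ W₁} {w₁₂ : LDual S J →ₗ[K] W₀}
    {w₁ w₂ : LDual S J →ₗ[K] W₁} {pr₁ pr₂ : W₁ →ₗ[K] LDual S J}
  [Module (degZero K (S × S) W₀ W₁)ᵐᵒᵖ M] [IsScalarTower K (degZero K (S × S) W₀ W₁)ᵐᵒᵖ M]
  [Module (degZero K (S × S) W₀ W₁)ᵐᵒᵖ N] [IsScalarTower K (degZero K (S × S) W₀ W₁)ᵐᵒᵖ N]

variable (W₀ W₁ M) in
/-- The action of `R`. -/
noncomputable def repR (r : S × S) : Module.End K M := actZero M (ofRZero K (S × S) W₀ W₁ r)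

variable (W₁ M) in
/-- The action of the elements `w₁₂ γ`. -/
noncomputable def repW (w₁₂ : LDual S J →ₗ[K] W₀) : LDual S J →ₗ[K] Module.End K M :=
  actZero M ∘ₗ (ofWZeroHom : W₀ →ₗ[K] degZero K (S × S) W₀ W₁) ∘ₗ w₁₂

theorem repR_apply (r : S × S) (m : M) :
    repR M W₀ W₁ r m = op (ofRZero K (S × S) W₀ W₁ r) • m := rfl

theorem repW_apply (γ : LDual S J) (m : M) :
    repW M W₁ w₁₂ γ m = op (ofWZero K (S × S) W₀ W₁ (w₁₂ γ)) • m := rfl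

variable {B}

/-- An isomorphism that is given on generators extends to a morphism of `Mod D`. -/
theorem RepEquiv.exists_hom (hD : IsDrozd B D w₁₂ w₁ w₂ pr₁ pr₂)
    (E : RepEquiv B (repR M W₀ W₁) (repW M W₁ w₁₂) (repR N W₀ W₁) (repW N W₁ w₁₂)) :
    ∃ f : D.Hom M N, (∀ m, f.f₀ m = E.f₀ m) ∧ (∀ γ, f.f₁ (ofWOne (w₁ γ)) = E.a γ) ∧
      ∀ γ, f.f₁ (ofWOne (w₂ γ)) = 0 := by
  -- On `W₁ = w₁ *J ⊕ w₂ *J` the map `f¹` is taken to be `a` on the first summand and zero on the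
  -- second.
  obtain ⟨f₁, hl, hr, hφ⟩ := exists_extension (E.a ∘ₗ pr₁)
    (fun r w m => by
      rw [LinearMap.comp_apply, hD.pr₁_left, E.a_left r.1 r.2]; rfl)
    (fun r w m => by
      rw [LinearMap.comp_apply, hD.pr₁_right, E.a_right r.1 r.2]; rfl)
  have hA : ∀ γ, f₁ (ofWOne (w₁ γ)) = E.a γ := fun γ => by
    rw [hφ, LinearMap.comp_apply, hD.pr₁_w₁]
  have hC : ∀ γ, f₁ (ofWOne (w₂ γ)) = 0 := fun γ => by
    rw [hφ, LinearMap.comp_apply, hD.pr₁_w₂, map_zero]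
  refine ⟨⟨E.f₀.toLinearMap, f₁, E.map_smul, hl, hr,
    compat_of_ofWZero D _ _ E.map_smul hl hr ?_⟩, fun _ => rfl, hA, hC⟩
  intro w m
  obtain ⟨γ, rfl⟩ := hD.surj w
  have h := E.eqn γ m
  simp only [repW_apply] at h
  change op _ • E.f₀ m = E.f₀ _ + _
  -- Of the two kinds of terms of `d(w₁₂ γ)`, those ending in `w₂ γ²` are killed by `f¹`, and those
  -- beginning with `w₁ γ¹` give the sum in the equation of `E`. The minus sign of `d` puts that sum
  -- on the other side.
  rw [hD.dZero, ← h]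
  simp only [map_sum, map_sub, LinearMap.sum_apply, LinearMap.sub_apply, hl, hr, hC, hA,
    LinearMap.zero_apply, zero_sub, Finset.sum_neg_distrib]
  exact (add_neg_cancel_right _ _).symm

/-- On `w₁ γ`, where `d(w₁ γ) = -∑ w₁γ¹ w₁γ²`, the composition rule is the convolution identity `s +
t + t s = 0`. On `w₂ γ` all terms vanish. By `isComp_id` these generators are enough. -/
theorem RepEquiv.isComp (hD : IsDrozd B D w₁₂ w₁ w₂ pr₁ pr₂)
    (E : RepEquiv B (repR M W₀ W₁) (repW M W₁ w₁₂) (repR N W₀ W₁) (repW N W₁ w₁₂))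
    (E' : RepEquiv B (repR N W₀ W₁) (repW N W₁ w₁₂) (repR M W₀ W₁) (repW M W₁ w₁₂))
    (h₀ : E'.f₀ = E.f₀.symm) (h : ∀ γ m, E'.a γ (E.f₀ m) + E'.f₀ (E.a γ m) +
        ∑ i, ∑ j, E'.a (op (B.coef γ i j) • B.γ j) (E.a (B.γ i) m) = 0)
    (f : D.Hom M N) (g : D.Hom N M)
    (hf₀ : ∀ m, f.f₀ m = E.f₀ m) (hfA : ∀ γ, f.f₁ (ofWOne (w₁ γ)) = E.a γ)
    (hfC : ∀ γ, f.f₁ (ofWOne (w₂ γ)) = 0) (hg₀ : ∀ m, g.f₀ m = E'.f₀ m)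
    (hgA : ∀ γ, g.f₁ (ofWOne (w₁ γ)) = E'.a γ) (hgC : ∀ γ, g.f₁ (ofWOne (w₂ γ)) = 0) :
    Ditalgebra.IsComp g f (Ditalgebra.Hom.id _ M) := by
  refine Ditalgebra.isComp_id g f (fun m => ?_) fun w => ?_
  · rw [hf₀, hg₀, h₀, LinearEquiv.symm_apply_apply]
  · have h1 : ∑ i, ∑ j, ((ofWOne (w₁ (B.γ i))).1 *
        (ofWOne (w₁ (op (B.coef (pr₁ w) i j) • B.γ j))).1,
        g.f₁ (ofWOne (w₁ (op (B.coef (pr₁ w) i j) • B.γ j))) ∘ₗ f.f₁ (ofWOne (w₁ (B.γ i))))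
        ∈ Ditalgebra.pairSpan g f :=
      sum_mem fun i _ => sum_mem fun j _ => Ditalgebra.mem_pairSpan _ _
    have h2 : ∑ i, ∑ j, ((ofWOne (w₂ (B.γ i))).1 *
        (ofWOne (w₂ (op (B.coef (pr₂ w) i j) • B.γ j))).1,
        g.f₁ (ofWOne (w₂ (op (B.coef (pr₂ w) i j) • B.γ j))) ∘ₗ f.f₁ (ofWOne (w₂ (B.γ i))))
        ∈ Ditalgebra.pairSpan g f :=
      sum_mem fun i _ => sum_mem fun j _ => Ditalgebra.mem_pairSpan _ _
    have e : (ofWOne w : deg K (S × S) W₀ W₁ 1) = ofWOne (w₁ (pr₁ w)) + ofWOne (w₂ (pr₂ w)) := by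
      conv_lhs => rw [← hD.pr_add w]
      exact map_add (ofWOneHom : W₁ →ₗ[K] deg K (S × S) W₀ W₁ 1) _ _
    convert add_mem (neg_mem h1) (neg_mem h2) using 1
    refine Prod.ext ?_ ?_
    · simp only [Prod.fst_add, Prod.fst_neg, Prod.fst_sum]
      rw [e, Submodule.coe_add, map_add, hD.d₁, hD.d₂]
    · simp only [Prod.snd_add, Prod.snd_neg, Prod.snd_sum]
      refine LinearMap.ext fun m => ?_
      have h3 := h (pr₁ w) m
      rw [e, map_add, map_add, hfC, hgC, hfA, hgA]
      simp only [hfC, hfA, hgA, LinearMap.add_apply, LinearMap.neg_apply,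
        LinearMap.sum_apply, LinearMap.comp_apply, hf₀, hg₀, LinearMap.zero_apply, map_zero,
        Finset.sum_const_zero, add_zero, neg_zero]
      exact eq_neg_of_add_eq_zero_left h3

/-- The isomorphisms of modules over the Drozd ditalgebra that are concentrated at an
idempotent `(1 - e, e)` with `e *J = 0`. -/
theorem IsDrozd.isIso_iff (hD : IsDrozd B D w₁₂ w₁ w₂ pr₁ pr₂)
    (w₁₂_left : ∀ (r : S × S) γ, w₁₂ (r.1 • γ) = r • w₁₂ γ)
    (e : S) (he : ∀ γ : LDual S J, e • γ = 0)
    (hM : ∀ m : M, repR M W₀ W₁ (e, 1 - e) m = 0)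
    (F : ℕ → J → Prop) (F_zero : ∀ j, F 0 j)
    (F_succ : ∀ n j (q : J), F n j → F (n + 1) (mulR j (q : Λ))) (n : ℕ)
    (F_last : ∀ j, F n j → j = 0) :
    Ditalgebra.IsIso D M N ↔ Nonempty
      (RepEquiv B (repR M W₀ W₁) (repW M W₁ w₁₂) (repR N W₀ W₁) (repW N W₁ w₁₂)) := by
  constructor
  · rintro ⟨f, g, hgf, hfg⟩
    have h1 : g.f₀ ∘ₗ f.f₀ = LinearMap.id := hgf.1.symm
    have h2 : f.f₀ ∘ₗ g.f₀ = LinearMap.id := hfg.1.symm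
    refine ⟨⟨LinearEquiv.ofLinearMap f.f₀ g.f₀ h2 h1, f.f₁ ∘ₗ ofWOneHom ∘ₗ w₁, f.map_smul,
      ?_, ?_, ?_⟩⟩
    · intro s t γ m
      change f.f₁ (ofWOne (w₁ (s • γ))) m = f.f₁ (ofWOne (w₁ γ)) _
      rw [hD.w₁_left (s, t), ← lmul_ofRZero_ofWOne, f.map_lmul]
      rfl
    · intro s t γ m
      change f.f₁ (ofWOne (w₁ (op s • γ))) m = op (ofRZero K (S × S) W₀ W₁ (s, t)) • f.f₁ (ofWOne (w₁ γ)) m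
      rw [hD.w₁_right (s, t), ← rmul_ofWOne_ofRZero, f.map_rmul]
    · intro γ m
      have h3 := f.compat (ofWZero K (S × S) W₀ W₁ (w₁₂ γ)) m
      -- The vector `x = m w₁₂δ` is fixed by `(e, 1)`, since `w₁₂` sees only the second component on
      -- the right. As `M (e, 1 - e) = 0`, it is also fixed by `(e, e)`. This factor moves into
      -- `f¹`, as `f¹(w₂ (e γ))(x)`, and `e γ = 0`.
      have hC : ∀ γ δ (m : M), f.f₁ (ofWOne (w₂ γ)) (op (ofWZero K (S × S) W₀ W₁ (w₁₂ δ)) • m) = 0 := by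
        intro γ δ m
        set x := op (ofWZero K (S × S) W₀ W₁ (w₁₂ δ)) • m with hx
        have e1 : op (ofRZero K (S × S) W₀ W₁ (e, 1)) • x = x := by
          rw [hx, op_smul_op_smul, ofWZero_mul_ofRZero, ← hD.w₁₂_right, op_one, one_smul]
        have e2 : op (ofRZero K (S × S) W₀ W₁ (e, 1)) • x =
            op (ofRZero K (S × S) W₀ W₁ (e, e)) • x := by
          rw [← sub_eq_zero, ← sub_smul, ← op_sub, ← map_sub, Prod.mk_sub_mk, sub_self]
          have e3 : ((0 : S), 1 - e) = (0, 1) * (e, 1 - e) := by simp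
          rw [e3, map_mul, op_mul, mul_smul]
          exact hM _
        rw [← e1, e2, ← f.map_lmul, lmul_ofRZero_ofWOne, ← hD.w₂_left]
        change f.f₁ (ofWOneHom (w₂ (e • γ))) _ = 0
        rw [he, map_zero, map_zero, map_zero, LinearMap.zero_apply]
      rw [hD.dZero] at h3
      simp only [map_sum, map_sub, LinearMap.sum_apply, LinearMap.sub_apply, f.map_lmul,
        f.map_rmul, hC, zero_sub, Finset.sum_neg_distrib] at h3
      change op (ofWZero K (S × S) W₀ W₁ (w₁₂ γ)) • f.f₀ m + _ =
        f.f₀ (op (ofWZero K (S × S) W₀ W₁ (w₁₂ γ)) • m)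
      rw [h3]
      exact neg_add_cancel_right _ _
  · rintro ⟨E⟩
    have mM : ∀ (r r' : S × S) (m : M), repR M W₀ W₁ (r * r') m = repR M W₀ W₁ r' (repR M W₀ W₁ r m) := by
      intro r r' m
      rw [repR_apply, repR_apply, repR_apply, op_smul_op_smul, map_mul]
    have wN : ∀ (s t : S) (γ : LDual S J) (m : N), repW N W₁ w₁₂ (s • γ) m =
        repW N W₁ w₁₂ γ (repR N W₀ W₁ (s, t) m) := by
      intro s t γ m
      rw [repW_apply, repW_apply, repR_apply, op_smul_op_smul, ofRZero_mul_ofWZero,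
        ← w₁₂_left (s, t)]
    obtain ⟨E', h₀, h1, h2⟩ := E.exists_symm B mM wN F F_zero F_succ n F_last
    obtain ⟨f, hf₀, hfA, hfC⟩ := E.exists_hom hD
    obtain ⟨g, hg₀, hgA, hgC⟩ := E'.exists_hom hD
    exact ⟨f, g, E.isComp hD E' h₀ h1 f g hf₀ hfA hfC hg₀ hgA hgC,
      E'.isComp hD E (by rw [h₀, LinearEquiv.symm_symm]) h2 g f hg₀ hgA hgC hf₀ hfA hfC⟩

end DrozdIso

end EqPoset

namespace EqPoset

/-! ### The Drozd ditalgebra of `S ⊕ J` fits the description by generators -/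

section DrozdInstance

open TensorRing

variable {K Λ : Type*} [Field K] [Ring Λ] [Algebra K Λ] {S : Subalgebra K Λ} {J : Ideal Λ}
  [J.IsTwoSided] (B : DualBasis S J)

variable (S J) in
/-- The identification of `*J` with `W₀`. -/
def toDrozdW₀ : LDual S J →ₗ[K] DrozdW₀ S J where
  toFun γ := γ
  map_add' _ _ := rfl
  map_smul' _ _ := rfl

variable (S J) in
/-- The first embedding of `*J` into `W₁`. -/
def inlDrozdW₁ : LDual S J →ₗ[K] DrozdW₁ S J where
  toFun γ := (γ, 0)
  map_add' _ _ := Prod.ext rfl (add_zero _).symm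
  map_smul' _ _ := Prod.ext rfl (smul_zero _).symm

variable (S J) in
/-- The second embedding of `*J` into `W₁`. -/
def inrDrozdW₁ : LDual S J →ₗ[K] DrozdW₁ S J where
  toFun γ := (0, γ)
  map_add' _ _ := Prod.ext (add_zero _).symm rfl
  map_smul' _ _ := Prod.ext (smul_zero _).symm rfl

variable (S J) in
/-- The first projection of `W₁` to `*J`. -/
def fstDrozdW₁ : DrozdW₁ S J →ₗ[K] LDual S J where
  toFun w := w.1
  map_add' _ _ := rfl
  map_smul' _ _ := rfl

variable (S J) in
/-- The second projection of `W₁` to `*J`. -/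
def sndDrozdW₁ : DrozdW₁ S J →ₗ[K] LDual S J where
  toFun w := w.2
  map_add' _ _ := rfl
  map_smul' _ _ := rfl

theorem drozdW₁₂_apply (γ : LDual S J) : drozdW₁₂ S J γ =
    ofW K (S × S) (DrozdW₀ S J) (DrozdW₁ S J) ((γ, 0) : DrozdW₀ S J × DrozdW₁ S J) := rfl

theorem drozdW₁₁_apply (γ : LDual S J) : drozdW₁₁ S J γ =
    ofW K (S × S) (DrozdW₀ S J) (DrozdW₁ S J) ((0, (γ, 0)) : DrozdW₀ S J × DrozdW₁ S J) := rfl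

theorem drozdW₂₂_apply (γ : LDual S J) : drozdW₂₂ S J γ =
    ofW K (S × S) (DrozdW₀ S J) (DrozdW₁ S J) ((0, (0, γ)) : DrozdW₀ S J × DrozdW₁ S J) := rfl

theorem drozd_d_drozdW₁₂ (γ : LDual S J) : (EqPoset.drozd B).d (drozdW₁₂ S J γ) =
    B.comul (drozdW₁₂ S J) (drozdW₂₂ S J) γ - B.comul (drozdW₁₁ S J) (drozdW₁₂ S J) γ := by
  have h : drozdDW B (γ, 0) = _ := drozdGen₁₂ B _ _ _ γ
  rw [drozdW₁₂_apply, drozd_d_ofW, h]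

theorem drozd_d_drozdW₁₁ (γ : LDual S J) : (EqPoset.drozd B).d (drozdW₁₁ S J γ) =
    - B.comul (drozdW₁₁ S J) (drozdW₁₁ S J) γ := by
  have h : drozdDW B (0, (γ, 0)) = _ := drozdGen₁₁ B _ _ _ γ
  rw [drozdW₁₁_apply, drozd_d_ofW, h]

theorem drozd_d_drozdW₂₂ (γ : LDual S J) : (EqPoset.drozd B).d (drozdW₂₂ S J γ) =
    - B.comul (drozdW₂₂ S J) (drozdW₂₂ S J) γ := by
  have h : drozdDW B (0, (0, γ)) = _ := drozdGen₂₂ B _ _ _ γ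
  rw [drozdW₂₂_apply, drozd_d_ofW, h]

theorem drozd_dZero (γ : LDual S J) :
    (EqPoset.drozd B).dZero (ofWZero K _ _ _ (toDrozdW₀ S J γ)) = ∑ i, ∑ j,
      (lmul (ofWZero K _ _ _ (toDrozdW₀ S J (B.γ i)))
        (ofWOne (inrDrozdW₁ S J (op (B.coef γ i j) • B.γ j))) -
      rmul (ofWOne (inlDrozdW₁ S J (B.γ i)))
        (ofWZero K _ _ _ (toDrozdW₀ S J (op (B.coef γ i j) • B.γ j)))) := by
  refine Subtype.ext ?_
  have h := drozd_d_drozdW₁₂ B γ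
  rw [B.comul_apply (drozdW₁₂ S J) (drozdW₂₂ S J) γ, B.comul_apply (drozdW₁₁ S J) (drozdW₁₂ S J) γ]
    at h
  refine h.trans ?_
  simp only [AddSubmonoidClass.coe_finsetSum, AddSubgroupClass.coe_sub, Finset.sum_sub_distrib]
  rfl

theorem drozd_isDrozd : IsDrozd B (EqPoset.drozd B) (toDrozdW₀ S J) (inlDrozdW₁ S J)
    (inrDrozdW₁ S J) (fstDrozdW₁ S J) (sndDrozdW₁ S J) where
  surj γ := ⟨γ, rfl⟩
  pr_add w := Prod.ext (add_zero w.1) (zero_add w.2)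
  pr₁_w₁ _ := rfl
  pr₁_w₂ _ := rfl
  pr₁_left _ _ := rfl
  pr₁_right _ _ := rfl
  w₁₂_right _ _ := rfl
  w₁_left _ _ := Prod.ext rfl (smul_zero _).symm
  w₁_right _ _ := Prod.ext rfl (smul_zero _).symm
  w₂_left _ _ := Prod.ext (smul_zero _).symm rfl
  dZero := drozd_dZero B
  d₁ := drozd_d_drozdW₁₁ B
  d₂ := drozd_d_drozdW₂₂ B

end DrozdInstance

namespace AlgEquipment

/-! ### Nilpotency of `J` by height in the poset -/

section Filtration

variable {K L P : Type*} [Field K] [Field L] [Algebra K L] [FiniteDimensional K L]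
  [PartialOrder P] [Fintype P] [DecidableEq P] (E : AlgEquipment K L P)

open scoped Classical in
/-- The number of the points below `x`. -/
noncomputable def height (x : P) : ℕ := (Finset.univ.filter (· < x)).card

theorem height_lt {x y : P} (h : x < y) : height x < height y := by
  classical
  refine Finset.card_lt_card (Finset.ssubset_iff_of_subset ?_ |>.2 ⟨x, ?_, ?_⟩)
  · exact fun z hz => by simpa using ((Finset.mem_filter.1 hz).2.trans h)
  · simpa using h
  · simp

theorem J_apply_eq_zero (j : E.J) {x y : P} (h : ¬ x < y) : (j : E.Lam).1 x y = 0 := by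
  by_cases hxy : x = y
  · subst hxy
    exact j.2 x
  · exact (E.mem_R_of_not_le fun h' => h (lt_of_le_of_ne h' hxy)).1 ((j : E.Lam).2 x y)

theorem Lam.mul_apply (F G : E.Lam) (x y : P) : (F * G).1 x y = ∑ z, F.1 x z * G.1 z y :=
  Matrix.mul_apply

theorem Lam.mul_diag (F : E.Lam) (c : ∀ x, E.fld x) (x y : P) :
    (F * (E.diag c).1).1 x y = F.1 x y * E.phi y (c y) := by
  exact Matrix.mul_diagonal _ _ _ _

theorem Lam.diag_mul (F : E.Lam) (c : ∀ x, E.fld x) (x y : P) :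
    ((E.diag c).1 * F).1 x y = E.phi x (c x) * F.1 x y := by
  exact Matrix.diagonal_mul _ _ _ _

/-- The elements of the powers of `J`. -/
def depth (n : ℕ) (j : E.J) : Prop :=
  ∀ x y, (j : E.Lam).1 x y ≠ 0 → height x + n ≤ height y

theorem depth_zero (j : E.J) : E.depth 0 j := fun x y h => by
  by_contra h'
  exact h (E.J_apply_eq_zero j fun hlt => h' (height_lt hlt).le)

/-- A non-zero entry of `j q` at `(x, y)` passes through some `z` with `j_{xz} ≠ 0` and `z < y`, and
the step from `z` to `y` raises the height by at least one. -/
theorem depth_succ (n : ℕ) (j q : E.J) (h : E.depth n j) :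
    E.depth (n + 1) (mulR j (q : E.Lam)) := by
  intro x y hxy
  change ((j : E.Lam) * (q : E.Lam)).1 x y ≠ 0 at hxy
  rw [Lam.mul_apply] at hxy
  obtain ⟨z, -, hz⟩ := Finset.exists_ne_zero_of_sum_ne_zero hxy
  have h1 := h x z (left_ne_zero_of_mul hz)
  have h2 : z < y := by
    by_contra h'
    exact right_ne_zero_of_mul hz (E.J_apply_eq_zero q h')
  have := height_lt h2
  omega

/-- No height exceeds the number of points, so a non-zero entry would have to end too high. -/
theorem depth_last (j : E.J) (h : E.depth (Fintype.card P + 1) j) : j = 0 := by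
  refine Subtype.ext (Lam.ext fun x y => ?_)
  by_contra h'
  have h1 := h x y h'
  have h2 : height y ≤ Fintype.card P := Finset.card_le_univ _
  omega

end Filtration

/-! ### Reduction of isomorphism in `mod Dᵉ` to pairs `(f⁰, a)` -/

section ModDe

universe u₁ u₂ u₃ w

variable {K : Type u₁} {L : Type u₂} {P : Type u₃} [Field K] [Field L] [Algebra K L]
  [FiniteDimensional K L] [PartialOrder P] [Fintype P] [DecidableEq P] {E : AlgEquipment K L P}

/-- The action of `R` on a module. -/
noncomputable def ModDe.actR (M : ModDe.{u₁, u₂, u₃, w} E) (r : E.ext.S × E.ext.S) :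
    Module.End K M.carrier where
  toFun m := op (E.ext.inR r) • m
  map_add' := smul_add _
  map_smul' _ _ := smul_comm _ _ _

/-- The action of the elements `w₁₂ γ` on a module. -/
noncomputable def ModDe.actW (M : ModDe.{u₁, u₂, u₃, w} E) (γ : LDual E.ext.S E.ext.J) :
    Module.End K M.carrier where
  toFun m := op (E.ext.inW₁₂ γ) • m
  map_add' := smul_add _
  map_smul' _ _ := smul_comm _ _ _

/-- `(e₀ γ)(j) = γ(j e₀)`, and `j e₀ = 0` because the column of `J` at the minimum is empty. This is
what makes the values of `f¹` on `w₂ *J` invisible in `mod Dᵉ`. -/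
theorem idem_bot_smul (γ : LDual E.ext.S E.ext.J) : E.ext.idem ⊥ • γ = 0 := by
  refine LDual.ext fun j => ?_
  have h : mulR j (E.ext.idem ⊥ : E.ext.Lam) = 0 := by
    refine Subtype.ext (Lam.ext fun x y => ?_)
    refine (Lam.mul_diag _ (j : E.ext.Lam) (Pi.single ⊥ 1) x y).trans ?_
    by_cases hy : y = ⊥
    · rw [E.ext.J_apply_eq_zero j (by rw [hy]; exact not_lt_bot), zero_mul]; rfl
    · rw [Pi.single_eq_of_ne hy, phi_zero, mul_zero]; rfl
  rw [LDual.left_smul_app, h]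
  exact LinearMap.map_zero (show E.ext.J →ₗ[E.ext.S] E.ext.S from γ)

theorem ModDe.iso_iff (M N : ModDe.{u₁, u₂, u₃, w} E) :
    M.Iso N ↔ Nonempty (RepEquiv E.ext.dualBasis M.actR M.actW N.actR N.actW) := by
  -- `D₀` is a name for this ring that instance search does not unfold, so the module structures are
  -- declared again.
  let _ : Module (TensorRing.degZero K (E.ext.S × E.ext.S) (DrozdW₀ E.ext.S E.ext.J)
    (DrozdW₁ E.ext.S E.ext.J))ᵐᵒᵖ M.carrier := M.module
  let _ : Module (TensorRing.degZero K (E.ext.S × E.ext.S) (DrozdW₀ E.ext.S E.ext.J)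
    (DrozdW₁ E.ext.S E.ext.J))ᵐᵒᵖ N.carrier := N.module
  have _ : IsScalarTower K (TensorRing.degZero K (E.ext.S × E.ext.S) (DrozdW₀ E.ext.S E.ext.J)
    (DrozdW₁ E.ext.S E.ext.J))ᵐᵒᵖ M.carrier := M.isScalarTower
  have _ : IsScalarTower K (TensorRing.degZero K (E.ext.S × E.ext.S) (DrozdW₀ E.ext.S E.ext.J)
    (DrozdW₁ E.ext.S E.ext.J))ᵐᵒᵖ N.carrier := N.isScalarTower
  exact (drozd_isDrozd E.ext.dualBasis).isIso_iff (M := M.carrier) (N := N.carrier)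
    (fun _ _ => rfl) (E.ext.idem ⊥) idem_bot_smul M.smul_compl E.ext.depth E.ext.depth_zero
    E.ext.depth_succ _ E.ext.depth_last

end ModDe

end AlgEquipment

end EqPoset

namespace EqPoset

namespace AlgEquipment

/-! ### The diagonal algebra `S` as a product of fields -/

section Diagonal

variable {K L P : Type*} [Field K] [Field L] [Algebra K L] [FiniteDimensional K L]
  [PartialOrder P] [Fintype P] [DecidableEq P] (E : AlgEquipment K L P)

/-- The entry of an element of `S` at `x`, as an element of `K(x)`. -/
noncomputable def sval (x : P) : E.S →+* E.fld x :=
  (Pi.evalRingHom (fun x => (E.fld x : Type _)) x).comp E.diagEquiv.symm.toRingHom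

theorem diag_sval (s : E.S) : E.diag (fun x => E.sval x s) = s := E.diag_val s

theorem sval_diag (c : ∀ x, E.fld x) (x : P) : E.sval x (E.diag c) = c x := E.val_diag c x

theorem sval_scal (x : P) (c : E.fld x) : E.sval x (E.scal x c) = c := by
  rw [scal, sval_diag, Pi.single_eq_same]

theorem sval_scal_of_ne {x y : P} (h : x ≠ y) (c : E.fld y) : E.sval x (E.scal y c) = 0 := by
  rw [scal, sval_diag, Pi.single_eq_of_ne h]

theorem mul_scal (s : E.S) (x : P) (c : E.fld x) :
    s * E.scal x c = E.scal x (E.sval x s * c) := by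
  conv_lhs => rw [← E.diag_sval s]
  rw [scal, scal, ← diag_mul]
  congr 1
  funext y
  by_cases h : y = x
  · subst h; simp
  · simp [Pi.single_eq_of_ne h]

theorem scal_mul' (s : E.S) (x : P) (c : E.fld x) :
    E.scal x c * s = E.scal x (c * E.sval x s) := by
  conv_lhs => rw [← E.diag_sval s]
  rw [scal, scal, ← diag_mul]
  congr 1
  funext y
  by_cases h : y = x
  · subst h; simp
  · simp [Pi.single_eq_of_ne h]

theorem scal_smul (k : K) (x : P) (c : E.fld x) : E.scal x (k • c) = k • E.scal x c := by
  rw [scal, scal, ← diag_smul, Pi.single_smul]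

theorem sum_idem : ∑ x, E.idem x = 1 := by
  have h1 : (1 : E.S) = E.diag 1 := (map_one E.diagEquiv).symm
  have h2 : ∀ f : P → ∀ x, E.fld x, E.diag (∑ x, f x) = ∑ x, E.diag (f x) :=
    fun f => map_sum E.diagEquiv f Finset.univ
  rw [h1, ← Finset.univ_sum_single (1 : ∀ x, E.fld x), h2]
  rfl

end Diagonal

/-! ### Decomposition of a module into the spaces `M_x` -/

section ModDe

universe u₁ u₂ u₃ w

variable {K : Type u₁} {L : Type u₂} {P : Type u₃} [Field K] [Field L] [Algebra K L]
  [FiniteDimensional K L] [PartialOrder P] [Fintype P] [DecidableEq P] {E : AlgEquipment K L P}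

namespace ModDe

variable (M : ModDe.{u₁, u₂, u₃, w} E)

theorem actR_mul (r r' : E.ext.S × E.ext.S) (m : M.carrier) :
    M.actR (r * r') m = M.actR r' (M.actR r m) := by
  change op (E.ext.inR (r * r')) • m = op (E.ext.inR r') • op (E.ext.inR r) • m
  rw [op_smul_op_smul, inR_mul]

theorem actR_add (r r' : E.ext.S × E.ext.S) (m : M.carrier) :
    M.actR (r + r') m = M.actR r m + M.actR r' m := by
  change op (E.ext.inR (r + r')) • m = op (E.ext.inR r) • m + op (E.ext.inR r') • m
  rw [inR_add, op_add, add_smul]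

theorem actR_smul (k : K) (r : E.ext.S × E.ext.S) (m : M.carrier) :
    M.actR (k • r) m = k • M.actR r m := by
  change op (E.ext.inR (k • r)) • m = k • op (E.ext.inR r) • m
  rw [map_smul, op_smul, smul_assoc]

theorem actR_one (m : M.carrier) : M.actR 1 m = m := by
  change op (E.ext.inR 1) • m = m
  rw [map_one, op_one, one_smul]

theorem actR_zero (m : M.carrier) : M.actR 0 m = 0 := by
  have h := M.actR_add 0 0 m
  rw [add_zero] at h
  exact left_eq_add.1 h

theorem actR_sum {ι : Type*} (t : Finset ι) (r : ι → E.ext.S × E.ext.S) (m : M.carrier) :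
    M.actR (∑ i ∈ t, r i) m = ∑ i ∈ t, M.actR (r i) m := by
  classical
  induction t using Finset.induction_on with
  | empty => simp [actR_zero]
  | insert i t hi ih => rw [Finset.sum_insert hi, Finset.sum_insert hi, actR_add, ih]

theorem actR_compl (m : M.carrier) : M.actR (E.ext.idem ⊥, 1 - E.ext.idem ⊥) m = 0 :=
  M.smul_compl m

theorem toComp_bot (m : M.carrier) : (M.toComp ⊥ m : M.carrier) = M.actR (0, E.ext.idem ⊥) m := by
  change op (E.ext.inR _) • m = op (E.ext.inR _) • m
  rw [if_pos rfl]
  rfl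

theorem toComp_coe (x : WithTop P) (m : M.carrier) :
    (M.toComp (x : WithBot (WithTop P)) m : M.carrier) = M.actR (E.ext.idem x, 0) m := by
  change op (E.ext.inR _) • m = op (E.ext.inR _) • m
  rw [if_neg (WithBot.coe_ne_bot)]
  rfl

theorem smul_coe (x : WithTop P) (c : E.ext.fld x) (v : M.comp x) :
    ((c • v : M.comp x) : M.carrier) = M.actR (E.ext.scal x c, 0) v := by
  change op (E.ext.inR _) • (v : M.carrier) = op (E.ext.inR _) • (v : M.carrier)
  rw [if_neg (WithBot.coe_ne_bot)]

theorem toComp_self {x : WithBot (WithTop P)} (v : M.comp x) : M.toComp x v = v :=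
  Subtype.ext v.2

theorem toComp_add (x : WithBot (WithTop P)) (m n : M.carrier) :
    M.toComp x (m + n) = M.toComp x m + M.toComp x n :=
  Subtype.ext (smul_add _ _ _)

theorem toComp_smul (x : WithBot (WithTop P)) (k : K) (m : M.carrier) :
    M.toComp x (k • m) = k • M.toComp x m :=
  Subtype.ext (smul_comm _ _ _)

/-- For `x > 0` the space `M_x` is cut out by `w₁ e_x`, so only the first component of `R = S × S`
acts on it, and only through its entry at `x`. -/
theorem toComp_actR_coe (x : WithTop P) (s t : E.ext.S) (m : M.carrier) :
    M.toComp x (M.actR (s, t) m) = E.ext.sval x s • M.toComp x m := by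
  refine Subtype.ext ?_
  rw [smul_coe, toComp_coe, toComp_coe, ← actR_mul, ← actR_mul, Prod.mk_mul_mk, Prod.mk_mul_mk,
    idem, mul_scal, ← scal_mul, mul_one, one_mul, mul_zero, mul_zero]

variable (E) in
/-- The isomorphism of `K(0)` with `K`. -/
noncomputable def toBase : E.ext.fld ⊥ ≃ₐ[K] K := IntermediateField.botEquiv K L

theorem algebraMap_toBase (c : E.ext.fld ⊥) : algebraMap K (E.ext.fld ⊥) (toBase E c) = c :=
  ((toBase E).symm.commutes (toBase E c)).symm.trans ((toBase E).symm_apply_apply c)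

/-- At the minimum the idempotent is `w₂ e₀`, so here the second component acts. Its entry lies in
`K(0)`, the bottom subfield of `L`, and is read in `K` through `toBase`. -/
theorem toComp_actR_bot (s t : E.ext.S) (m : M.carrier) :
    M.toComp ⊥ (M.actR (s, t) m) = toBase E (E.ext.sval ⊥ t) • M.toComp ⊥ m := by
  refine Subtype.ext ?_
  have h : toBase E (E.ext.sval ⊥ t) • ((0 : E.ext.S), E.ext.idem ⊥) =
      (0, E.ext.scal ⊥ (E.ext.sval ⊥ t)) := by
    rw [Prod.smul_mk, smul_zero, idem, ← scal_smul, Algebra.smul_def, mul_one, algebraMap_toBase]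
  rw [Submodule.coe_smul, toComp_bot, toComp_bot, ← actR_mul, ← actR_smul, h, Prod.mk_mul_mk,
    idem, mul_scal, mul_one, mul_zero]

theorem algebraMap_smul (x : WithTop P) (k : K) (v : M.comp x) :
    algebraMap K (E.ext.fld x) k • v = k • v := by
  refine Subtype.ext ?_
  have h : (E.ext.scal x (algebraMap K (E.ext.fld x) k), (0 : E.ext.S)) =
      k • (E.ext.idem (x : WithBot (WithTop P)), (0 : E.ext.S)) := by
    rw [Prod.smul_mk, smul_zero, idem, ← scal_smul, Algebra.algebraMap_eq_smul_one]
  rw [smul_coe, Submodule.coe_smul, h, actR_smul, ← toComp_coe, toComp_self]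

theorem sum_withBot {α A : Type*} [Fintype α] [AddCommMonoid A] (f : WithBot α → A) :
    ∑ x, f x = f ⊥ + ∑ x : α, f x :=
  Fintype.sum_option f

/-- The identity of `R` is `w₂ e₀ + ∑ w₁ e_x + (1 - e)`, the sum being over `x > 0`, and `1 - e`
acts as zero. -/
theorem sum_toComp (m : M.carrier) :
    (M.toComp ⊥ m : M.carrier) + ∑ x : WithTop P, (M.toComp x m : M.carrier) = m := by
  have h : ((0 : E.ext.S), E.ext.idem ⊥) + ∑ x : WithTop P, (E.ext.idem x, (0 : E.ext.S)) +
      (E.ext.idem ⊥, 1 - E.ext.idem ⊥) = 1 := by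
    have h1 := E.ext.sum_idem
    rw [sum_withBot] at h1
    have h2 : ∑ x : WithTop P, (E.ext.idem (x : WithBot (WithTop P)), (0 : E.ext.S)) =
        (∑ x : WithTop P, E.ext.idem (x : WithBot (WithTop P)), 0) :=
      Prod.ext (by simp [Prod.fst_sum]) (by simp [Prod.snd_sum])
    rw [h2]
    refine Prod.ext ?_ ?_
    · change 0 + _ + E.ext.idem ⊥ = 1
      rw [zero_add, add_comm, h1]
    · change E.ext.idem ⊥ + 0 + (1 - E.ext.idem ⊥) = 1
      abel
  conv_rhs => rw [← M.actR_one m, ← h, actR_add, actR_add, actR_sum, actR_compl, add_zero]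
  rw [toComp_bot]
  exact congrArg _ (Finset.sum_congr rfl fun x _ => M.toComp_coe x m)

theorem toComp_bot_coe {x : WithTop P} (v : M.comp x) : M.toComp ⊥ (v : M.carrier) = 0 := by
  rw [← M.toComp_self v, toComp_coe, toComp_actR_bot, map_zero, map_zero, zero_smul]

theorem toComp_coe_bot {x : WithTop P} (v : M.comp ⊥) : M.toComp x (v : M.carrier) = 0 := by
  rw [← M.toComp_self v, toComp_bot, toComp_actR_coe, map_zero, zero_smul]

theorem toComp_coe_ne {x y : WithTop P} (h : x ≠ y) (v : M.comp y) :
    M.toComp x (v : M.carrier) = 0 := by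
  rw [← M.toComp_self v, toComp_coe, toComp_actR_coe, idem,
    sval_scal_of_ne _ (fun h' => h (WithBot.coe_injective h')), zero_smul]

/-- `toComp` as a linear map over `K`. -/
noncomputable def toCompHom (x : WithBot (WithTop P)) : M.carrier →ₗ[K] M.comp x where
  toFun := M.toComp x
  map_add' := M.toComp_add x
  map_smul' := M.toComp_smul x

/-- The decomposition of `M` into the spaces `M_x`. -/
noncomputable def decomp : M.carrier ≃ₗ[K] M.comp ⊥ × (∀ x : WithTop P, M.comp x) where
  toFun m := (M.toComp ⊥ m, fun x => M.toComp x m)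
  invFun v := v.1 + ∑ x, (v.2 x : M.carrier)
  map_add' m n := Prod.ext (M.toComp_add _ _ _) (funext fun _ => M.toComp_add _ _ _)
  map_smul' m n := Prod.ext (M.toComp_smul _ _ _) (funext fun _ => M.toComp_smul _ _ _)
  left_inv m := M.sum_toComp m
  right_inv v := by
    refine Prod.ext ?_ (funext fun x => ?_)
    · change M.toCompHom ⊥ _ = _
      rw [map_add, map_sum]
      change M.toComp ⊥ _ + ∑ x, M.toComp ⊥ _ = _
      rw [toComp_self, Finset.sum_eq_zero fun x _ => M.toComp_bot_coe _, add_zero]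
    · change M.toCompHom x _ = _
      rw [map_add, map_sum]
      change M.toComp x _ + ∑ y : WithTop P, M.toComp x _ = _
      rw [toComp_coe_bot, zero_add, Finset.sum_eq_single x (fun y _ h => M.toComp_coe_ne h.symm _)
        (fun h => absurd (Finset.mem_univ x) h), toComp_self]

theorem ext_toComp {m n : M.carrier} (h₀ : M.toComp ⊥ m = M.toComp ⊥ n)
    (h : ∀ x : WithTop P, M.toComp x m = M.toComp x n) : m = n :=
  M.decomp.injective (Prod.ext h₀ (funext h))

variable {M} {N : ModDe.{u₁, u₂, u₃, w} E}

theorem toComp_map (f : M.carrier →ₗ[K] N.carrier) (hf : ∀ r m, f (M.actR r m) = N.actR r (f m))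
    (x : WithBot (WithTop P)) (m : M.carrier) :
    (N.toComp x (f m) : N.carrier) = f (M.toComp x m) :=
  (hf (if x = ⊥ then (0, E.ext.scal x 1) else (E.ext.scal x 1, 0)) m).symm

theorem symm_actR (f : M.carrier ≃ₗ[K] N.carrier)
    (hf : ∀ r m, f (M.actR r m) = N.actR r (f m)) (r : E.ext.S × E.ext.S) (m : N.carrier) :
    f.symm (N.actR r m) = M.actR r (f.symm m) := by
  rw [LinearEquiv.symm_apply_eq, hf, LinearEquiv.apply_symm_apply]

theorem toComp_symm_toComp (f : M.carrier ≃ₗ[K] N.carrier)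
    (hf : ∀ r m, f (M.actR r m) = N.actR r (f m)) (x : WithBot (WithTop P)) (v : M.comp x) :
    M.toComp x (f.symm (N.toComp x (f v))) = v := by
  have h : (N.toComp x (f v) : N.carrier) = f (M.toComp x v) := toComp_map f.toLinearMap hf x v
  rw [h, LinearEquiv.symm_apply_apply, toComp_self, toComp_self]

/-- The components of an isomorphism of `R`-modules at the points that are not minimal. -/
noncomputable def compEquiv (f : M.carrier ≃ₗ[K] N.carrier)
    (hf : ∀ r m, f (M.actR r m) = N.actR r (f m)) (x : WithTop P) :
    M.comp x ≃ₗ[E.ext.fld x] N.comp x where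
  toFun v := N.toComp x (f v)
  invFun v := M.toComp x (f.symm v)
  map_add' v v' := by rw [Submodule.coe_add, map_add, toComp_add]
  map_smul' c v := by
    rw [smul_coe, hf, toComp_actR_coe, sval_scal]
    rfl
  left_inv := toComp_symm_toComp f hf x
  right_inv := toComp_symm_toComp f.symm (symm_actR f hf) x

/-- The component of an isomorphism of `R`-modules at the minimum. -/
noncomputable def compEquivBot (f : M.carrier ≃ₗ[K] N.carrier)
    (hf : ∀ r m, f (M.actR r m) = N.actR r (f m)) : M.comp ⊥ ≃ₗ[K] N.comp ⊥ where
  toFun v := N.toComp ⊥ (f v)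
  invFun v := M.toComp ⊥ (f.symm v)
  map_add' v v' := by rw [Submodule.coe_add, map_add, toComp_add]
  map_smul' c v := by
    rw [Submodule.coe_smul, map_smul, toComp_smul]
    rfl
  left_inv := toComp_symm_toComp f hf ⊥
  right_inv := toComp_symm_toComp f.symm (symm_actR f hf) ⊥

/-- An isomorphism of `R`-modules is given by its components. -/
theorem exists_equiv (e₀ : M.comp ⊥ ≃ₗ[K] N.comp ⊥)
    (e : ∀ x : WithTop P, M.comp x ≃ₗ[E.ext.fld x] N.comp x) :
    ∃ f : M.carrier ≃ₗ[K] N.carrier, (∀ r m, f (M.actR r m) = N.actR r (f m)) ∧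
      (∀ m, N.toComp ⊥ (f m) = e₀ (M.toComp ⊥ m)) ∧
      ∀ (x : WithTop P) m, N.toComp x (f m) = e x (M.toComp x m) := by
  -- The structure of `M_x` over `K(x)` restricts to the given one over `K`, so the components may
  -- be glued over `K`.
  let eK : ∀ x : WithTop P, M.comp x ≃ₗ[K] N.comp x := fun x =>
    { (e x) with
      map_smul' := fun k v => by
        change e x (k • v) = k • e x v
        rw [← algebraMap_smul, map_smul, algebraMap_smul] }
  let f : M.carrier ≃ₗ[K] N.carrier :=
    M.decomp ≪≫ₗ (e₀.prodCongr (LinearEquiv.piCongrRight eK)) ≪≫ₗ N.decomp.symm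
  have h : ∀ m, N.decomp (f m) = (e₀ (M.toComp ⊥ m), fun x => e x (M.toComp x m)) := by
    intro m
    rw [LinearEquiv.trans_apply, LinearEquiv.trans_apply, LinearEquiv.apply_symm_apply]
    rfl
  have h₀ : ∀ m, N.toComp ⊥ (f m) = e₀ (M.toComp ⊥ m) := fun m => congrArg Prod.fst (h m)
  have h₁ : ∀ (x : WithTop P) m, N.toComp x (f m) = e x (M.toComp x m) :=
    fun x m => congrFun (congrArg Prod.snd (h m)) x
  refine ⟨f, fun r m => N.ext_toComp ?_ fun x => ?_, h₀, h₁⟩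
  · rw [h₀, toComp_actR_bot, toComp_actR_bot, map_smul, h₀]
  · rw [h₁, toComp_actR_coe, toComp_actR_coe, map_smul, h₁]

end ModDe

end ModDe

end AlgEquipment

end EqPoset

namespace EqPoset

namespace AlgEquipment

/-! ### Rows of `J` as functionals on `*J` -/

section Assemble

variable {K L P : Type*} [Field K] [Field L] [Algebra K L] [FiniteDimensional K L]
  [PartialOrder P] [Fintype P] [DecidableEq P] (E : AlgEquipment K L P)

/-- The entry of an element of `J`. -/
noncomputable def entryHom (x y : P) : E.J →+ E.R x y where
  toFun j := (j : E.Lam).entry x y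
  map_zero' := rfl
  map_add' _ _ := rfl

variable {E} in
theorem J_ext {i j : E.J} (h : ∀ x y, E.entryHom x y i = E.entryHom x y j) : i = j :=
  Subtype.ext (Lam.ext fun x y => congrArg Subtype.val (h x y))

theorem entryHom_eq_zero (j : E.J) {x y : P} (h : ¬ x < y) : E.entryHom x y j = 0 :=
  Subtype.ext (E.J_apply_eq_zero j h)

theorem coe_entryHom_scal_smul (x y z : P) (c : E.fld z) (j : E.J) :
    (E.entryHom x y (E.scal z c • j) : Alg K L) =
      E.phi x ((Pi.single z c : ∀ x, E.fld x) x) * (j : E.Lam).1 x y :=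
  Lam.diag_mul E (j : E.Lam) (Pi.single z c) x y

theorem entryHom_scal_smul_of_ne {x y z : P} (h : x ≠ z) (c : E.fld z) (j : E.J) :
    E.entryHom x y (E.scal z c • j) = 0 := by
  refine Subtype.ext ?_
  rw [coe_entryHom_scal_smul, Pi.single_eq_of_ne h, phi_zero, zero_mul]
  rfl

theorem coe_entryHom_scal_smul_self (x y : P) (c : E.fld x) (j : E.J) :
    (E.entryHom x y (E.scal x c • j) : Alg K L) = E.phi x c * (j : E.Lam).1 x y := by
  rw [coe_entryHom_scal_smul, Pi.single_eq_same]

theorem entryHom_mulR_coe (x y : P) (j : E.J) (s : E.S) :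
    E.entryHom x y (mulR j (s : E.Lam)) = E.sval y s • E.entryHom x y j := by
  refine Subtype.ext ?_
  conv_lhs => rw [← E.diag_sval s]
  exact Lam.mul_diag E (j : E.Lam) (fun x => E.sval x s) x y

theorem coe_entryHom_mulR (x y : P) (i j : E.J) :
    (E.entryHom x y (mulR i (j : E.Lam)) : Alg K L) =
      ∑ z, (i : E.Lam).1 x z * (j : E.Lam).1 z y :=
  Lam.mul_apply E _ _ x y

variable {E} (B : DualBasis E.S E.J)

theorem smul_mulR (s : E.S) (j : E.J) (a : E.Lam) : s • mulR j a = mulR (s • j) a :=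
  Subtype.ext (mul_assoc _ _ _).symm

/-- The element of the row of `J` at `y` that corresponds to a functional `f` on `*J` with values
in `K(y)`. -/
noncomputable def assemble (y : P) (f : LDual E.S E.J → E.fld y) : E.J :=
  ∑ k, E.scal y (f (B.γ k)) • B.p k

theorem idem_mul_scal (y : P) (c : E.fld y) : E.idem y * E.scal y c = E.scal y c := by
  rw [idem, ← scal_mul, one_mul]

theorem idem_smul_assemble (y : P) (f : LDual E.S E.J → E.fld y) :
    E.idem y • assemble B y f = assemble B y f := by
  rw [assemble, Finset.smul_sum]
  exact Finset.sum_congr rfl fun k _ => by rw [smul_smul, idem_mul_scal]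

/-- This is reflexivity of `J`: the value of `γ` at `∑ f(γₖ) pₖ` has entry `∑ f(γₖ) γ(pₖ)` at `y`,
which by right linearity is `f(∑ γₖ γ(pₖ)) = f(γ)`. -/
theorem sval_assemble (y : P) (f : LDual E.S E.J → E.fld y) (h₀ : ∀ γ δ, f (γ + δ) = f γ + f δ)
    (h : ∀ (s : E.S) γ, f (op s • γ) = f γ * E.sval y s) (γ : LDual E.S E.J) :
    E.sval y (γ (assemble B y f)) = f γ := by
  rw [assemble, LDual.map_sum, map_sum]
  simp only [LDual.map_smul, map_mul, sval_scal, ← h]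
  have h1 := map_sum (AddMonoidHom.mk' f h₀) (fun k => op (γ (B.p k)) • B.γ k) Finset.univ
  rw [B.dual_sum] at h1
  exact h1.symm

/-- Uniqueness of the representing row follows from `j = ∑ γₖ(j) pₖ`, after multiplication by the
idempotent at `y`. Identities between rows are proved below by comparing the functionals they
represent. -/
theorem eq_assemble (y : P) (f : LDual E.S E.J → E.fld y) (j : E.J) (hj : E.idem y • j = j)
    (h : ∀ γ : LDual E.S E.J, E.sval y (γ j) = f γ) : j = assemble B y f := by
  rw [← hj, ← B.sum_smul j, Finset.smul_sum, assemble]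
  refine Finset.sum_congr rfl fun k _ => ?_
  rw [smul_smul, idem, scal_mul', h, one_mul]

theorem coe_entryHom_assemble (x y : P) (f : LDual E.S E.J → E.fld y) :
    (E.entryHom y x (assemble B y f) : Alg K L) =
      ∑ k, E.phi y (f (B.γ k)) * (B.p k : E.Lam).1 y x := by
  rw [assemble, map_sum, AddSubmonoidClass.coe_finsetSum]
  exact Finset.sum_congr rfl fun k _ => E.coe_entryHom_scal_smul_self y x _ _

theorem entryHom_of_idem_smul {x y z : P} (h : x ≠ z) {j : E.J} (hj : E.idem z • j = j) :
    E.entryHom x y j = 0 := by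
  rw [← hj, idem, entryHom_scal_smul_of_ne _ h]

/-- The element of `J` with a given row. -/
noncomputable def rowJ (y : P) (g : ∀ x, E.R y x) : E.J :=
  haveI := Classical.propDecidable
  ⟨⟨fun z w => if z = y ∧ y < w then (g w : Alg K L) else 0, fun z w => by
    beta_reduce
    by_cases h : z = y ∧ y < w
    · rw [if_pos h, h.1]
      exact (g w).2
    · rw [if_neg h]
      exact zero_mem _⟩, fun z => if_neg fun h => (h.1 ▸ h.2).false⟩

theorem coe_entryHom_rowJ (y : P) (g : ∀ x, E.R y x) (z w : P) :
    (E.entryHom z w (rowJ y g) : Alg K L) =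
      haveI := Classical.propDecidable
      if z = y ∧ y < w then (g w : Alg K L) else 0 := rfl

theorem entryHom_rowJ {y x : P} (g : ∀ x, E.R y x) (h : y < x) :
    E.entryHom y x (rowJ y g) = g x :=
  Subtype.ext ((coe_entryHom_rowJ y g y x).trans (if_pos ⟨rfl, h⟩))

theorem entryHom_rowJ_of_ne {y z : P} (g : ∀ x, E.R y x) (h : z ≠ y) (w : P) :
    E.entryHom z w (rowJ y g) = 0 :=
  Subtype.ext ((coe_entryHom_rowJ y g z w).trans (if_neg fun h' => h h'.1))

theorem idem_smul_rowJ (y : P) (g : ∀ x, E.R y x) : E.idem y • rowJ y g = rowJ y g := by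
  refine J_ext fun z w => ?_
  by_cases h : z = y
  · subst h
    refine Subtype.ext ?_
    rw [idem, coe_entryHom_scal_smul_self, phi_one]
    exact E.eps_mul (E.entryHom z w (rowJ z g)).2
  · rw [idem, entryHom_scal_smul_of_ne _ h, entryHom_rowJ_of_ne g h]

theorem rowJ_add (y : P) (g g' : ∀ x, E.R y x) : rowJ y (g + g') = rowJ y g + rowJ y g' := by
  refine J_ext fun z w => ?_
  rw [map_add]
  by_cases h : z = y
  · subst h
    by_cases hw : z < w
    · rw [entryHom_rowJ _ hw, entryHom_rowJ _ hw, entryHom_rowJ _ hw]; rfl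
    · rw [entryHom_eq_zero _ _ hw, entryHom_eq_zero _ _ hw, entryHom_eq_zero _ _ hw, add_zero]
  · rw [entryHom_rowJ_of_ne _ h, entryHom_rowJ_of_ne _ h, entryHom_rowJ_of_ne _ h, add_zero]

theorem rowJ_smul (y : P) (g : ∀ x, E.R y x) (s : E.S) :
    rowJ y (fun x => E.sval x s • g x) = mulR (rowJ y g) (s : E.Lam) := by
  refine J_ext fun z w => ?_
  rw [entryHom_mulR_coe]
  by_cases h : z = y
  · subst h
    by_cases hw : z < w
    · rw [entryHom_rowJ _ hw, entryHom_rowJ _ hw]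
    · rw [entryHom_eq_zero _ _ hw, entryHom_eq_zero _ _ hw, smul_zero]
  · rw [entryHom_rowJ_of_ne _ h, entryHom_rowJ_of_ne _ h, smul_zero]

theorem sval_smul (y : P) (k : K) (s : E.S) : E.sval y (k • s) = k • E.sval y s := by
  have h := E.diag_smul k (fun x => E.sval x s)
  rw [diag_sval] at h
  rw [← h, sval_diag]
  rfl

end Assemble

/-! ### Values at `1` and the maps `u` -/

section Value

variable {K L P : Type*} [Field K] [Field L] [Algebra K L] [FiniteDimensional K L]
  [PartialOrder P]

theorem val_add (E : AlgEquipment K L P) {x y : P} (f g : E.R x y) :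
    E.val (f + g) = E.val f + E.val g :=
  map_add (proj (E.fld y) E.ξ E.adjoin_ξ) _ _

theorem val_smul (E : AlgEquipment K L P) {x y : P} (c : E.fld y) (f : E.R x y) :
    E.val (c • f) = c * E.val f := by
  refine Subtype.ext ?_
  rw [coe_val, coe_smul_R, unop_mul_apply, unop_phi]
  rfl

/-- The value at `1`, as a linear map. -/
noncomputable def valHom (E : AlgEquipment K L P) (x y : P) : E.R x y →ₗ[E.fld y] E.fld y where
  toFun := E.val
  map_add' := E.val_add
  map_smul' := E.val_smul

theorem val_ksmul (E : AlgEquipment K L P) {x y : P} (k : K) (f : E.R x y) :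
    E.val (k • f) = k • E.val f := by
  refine Subtype.ext ?_
  rw [coe_val]
  change (k • (f : Alg K L)).unop 1 = k • (E.val f : L)
  rw [coe_val]
  rfl

variable {E : AlgEquipment K L P}

theorem eps_bot_mul_apply_one (f : Alg K L) :
    (E.ext.eps (⊥ : WithBot (WithTop P)) * f).unop 1 = f.unop 1 := by
  rw [unop_mul_apply, unop_eps, proj_one]
  rfl

/-- An element of a space `R 0 x` is determined by its value at `1`. -/
theorem val_injective {x : WithBot (WithTop P)} : Function.Injective (E.ext.val (x := ⊥) (y := x)) := by
  intro f g h
  refine Subtype.ext ?_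
  rw [← E.ext.eps_mul f.2, ← E.ext.eps_mul g.2, ext_eps_bot_mul, ext_eps_bot_mul, h]

/-- After the projection onto `K`, an element `f` of `R_{0y}` may be replaced by `φ_y⁻¹(f(1))`,
because both are `K`-linear and agree at `1`. Hence `(f g)(1) = u_g(f(1))`: the maps `u` describe
multiplication by `J` in terms of values at `1`. -/
theorem val_mul {y x : WithBot (WithTop P)} (f : E.ext.R ⊥ y) (g : E.ext.R y x) :
    E.ext.val ⟨(f : Alg K L) * g, E.ext.R_mul f.2 g.2⟩ = E.ext.uMap g (E.ext.val f) := by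
  refine Subtype.ext ?_
  rw [uMap, coe_val, coe_val]
  change ((f : Alg K L) * g).unop 1 = (E.ext.phi y (E.ext.val f) * (g : Alg K L)).unop 1
  conv_lhs => rw [← E.ext.eps_mul f.2, ext_eps_bot_mul, mul_assoc]
  rw [eps_bot_mul_apply_one]

variable (E) in
/-- `uMap` is additive. -/
theorem uMap_add_left {y x : P} (τ τ' : E.R y x) (a : E.fld y) :
    E.uMap (τ + τ') a = E.uMap τ a + E.uMap τ' a := by
  rw [uMap, uMap, uMap, ← val_add]
  exact congrArg _ (Subtype.ext (mul_add _ _ _))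

theorem uMap_smul_left {y x : P} (c : E.fld x) (τ : E.R y x) (a : E.fld y) :
    E.uMap (c • τ) a = c * E.uMap τ a := by
  rw [uMap, uMap, ← val_smul]
  exact congrArg _ (Subtype.ext (mul_assoc _ _ _).symm)

theorem uMap_add {y x : P} (τ : E.R y x) (a b : E.fld y) :
    E.uMap τ (a + b) = E.uMap τ a + E.uMap τ b := by
  rw [uMap, uMap, uMap, ← val_add]
  congr 1
  refine Subtype.ext ?_
  change E.phi y (a + b) * (τ : Alg K L) = E.phi y a * (τ : Alg K L) + E.phi y b * (τ : Alg K L)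
  rw [phi_add, add_mul]

/-- `uMap`, as a linear map in the element of `R y x`. -/
noncomputable def uMapHom (E : AlgEquipment K L P) (y x : P) (a : E.fld y) :
    E.R y x →ₗ[E.fld x] E.fld x where
  toFun τ := E.uMap τ a
  map_add' τ τ' := E.uMap_add_left τ τ' a
  map_smul' c τ := uMap_smul_left c τ a

end Value

end AlgEquipment

end EqPoset

namespace EqPoset

/-! ### The left action of `Λ` on `*J` -/

section Lact

variable {K Λ : Type*} [Field K] [Ring Λ] [Algebra K Λ] {S : Subalgebra K Λ} {J : Ideal Λ}
  [J.IsTwoSided]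

/-- The left action of `Λ` on `*J`: `(a γ)(j) = γ(j a)`. -/
def LDual.lact (a : Λ) (γ : LDual S J) : LDual S J :=
  show J →ₗ[S] S from
    { toFun := fun j => γ (mulR j a)
      map_add' := fun i j => by
        rw [← LDual.map_add]; exact congrArg γ (Subtype.ext (add_mul _ _ _))
      map_smul' := fun c j => by
        change γ _ = c * γ _
        rw [← LDual.map_smul]; exact congrArg γ (Subtype.ext (mul_assoc _ _ _)) }

theorem LDual.lact_app (a : Λ) (γ : LDual S J) (j : J) : LDual.lact a γ j = γ (mulR j a) := rfl

theorem LDual.lact_op_smul (a : Λ) (s : S) (γ : LDual S J) :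
    LDual.lact a (op s • γ) = op s • LDual.lact a γ := rfl

theorem LDual.lact_add (a : Λ) (γ δ : LDual S J) :
    LDual.lact a (γ + δ) = LDual.lact a γ + LDual.lact a δ := rfl

theorem LDual.map_zero (γ : LDual S J) : γ 0 = 0 := LinearMap.map_zero (show J →ₗ[S] S from γ)

/-- `γ ↦ a γ`, for a fixed `γ`. -/
def LDual.lactHom (γ : LDual S J) : J →+ LDual S J where
  toFun h := LDual.lact (h : Λ) γ
  map_zero' := LDual.ext fun j => by
    rw [LDual.lact_app]
    exact (congrArg γ (Subtype.ext (mul_zero _))).trans (LDual.map_zero γ)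
  map_add' h h' := LDual.ext fun j => by
    rw [LDual.add_app, LDual.lact_app, LDual.lact_app, LDual.lact_app, ← LDual.map_add]
    exact congrArg γ (Subtype.ext (mul_add _ _ _))

theorem LDual.smul_lact (s : S) (j : J) (γ : LDual S J) :
    s • LDual.lact (j : Λ) γ = LDual.lact ((s • j : J) : Λ) γ :=
  LDual.ext fun q => by
    rw [LDual.left_smul_app, LDual.lact_app, LDual.lact_app]
    exact congrArg γ (Subtype.ext (mul_assoc _ _ _))

end Lact

namespace AlgEquipment

universe u₁ u₂ u₃ w

variable {K : Type u₁} {L : Type u₂} {P : Type u₃} [Field K] [Field L] [Algebra K L]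
  [FiniteDimensional K L] [PartialOrder P] [Fintype P] [DecidableEq P] {E : AlgEquipment K L P}

open ModDe (toBase algebraMap_toBase)

/-! ### Functionals on `*J` at the minimum and their values -/

section Functional

variable (E) in
/-- The functionals `*J → K` that are linear over the right action of `S` at the minimum. -/
structure RFunc extends LDual E.ext.S E.ext.J →+ K where
  map_op_smul : ∀ s γ, toFun (op s • γ) = toFun γ * toBase E (E.ext.sval ⊥ s)

instance : CoeFun (RFunc E) fun _ => LDual E.ext.S E.ext.J → K := ⟨fun g => g.toFun⟩

/-- The row at the minimum that corresponds to a functional. -/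
noncomputable def RFunc.row (g : RFunc E) : E.ext.J :=
  assemble E.ext.dualBasis ⊥ fun γ => algebraMap K (E.ext.fld ⊥) (g γ)

/-- The value at `1` of the entry at `x` of the row that corresponds to a functional. -/
noncomputable def RFunc.val (g : RFunc E) (x : WithBot (WithTop P)) : E.ext.fld x :=
  ∑ k, g (E.ext.dualBasis.γ k) • E.ext.val ((E.ext.dualBasis.p k : E.ext.Lam).entry ⊥ x)

theorem RFunc.sval_row (g : RFunc E) (γ : LDual E.ext.S E.ext.J) :
    E.ext.sval ⊥ (γ g.row) = algebraMap K (E.ext.fld ⊥) (g γ) :=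
  sval_assemble E.ext.dualBasis ⊥ _
    (fun γ δ => by rw [← map_add]; exact congrArg _ (g.map_add' γ δ))
    (fun s γ => by rw [g.map_op_smul, map_mul, algebraMap_toBase]) γ

/-- The sum over the dual basis that defines a matrix entry is the value at `1` of an actual element
of `R_{0x}`, namely the entry of the representing row. In particular it does not depend on the dual
basis. -/
theorem RFunc.val_row (g : RFunc E) (x : WithBot (WithTop P)) :
    E.ext.val (E.ext.entryHom ⊥ x g.row) = g.val x := by
  have h : E.ext.entryHom ⊥ x g.row = ∑ k, g (E.ext.dualBasis.γ k) •
      ((E.ext.dualBasis.p k : E.ext.Lam).entry ⊥ x) := by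
    refine Subtype.ext ?_
    rw [row, coe_entryHom_assemble, AddSubmonoidClass.coe_finsetSum]
    refine Finset.sum_congr rfl fun k _ => ?_
    rw [Algebra.algebraMap_eq_smul_one, phi_smul, phi_one, smul_mul_assoc]
    exact congrArg (_ • ·) (E.ext.eps_mul ((E.ext.dualBasis.p k : E.ext.Lam).entry ⊥ x).2)
  have h2 := map_sum (E.ext.valHom ⊥ x) (fun k => g (E.ext.dualBasis.γ k) •
      ((E.ext.dualBasis.p k : E.ext.Lam).entry ⊥ x)) Finset.univ
  rw [← h] at h2
  refine h2.trans (Finset.sum_congr rfl fun k _ => ?_)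
  exact E.ext.val_ksmul _ _

theorem RFunc.val_bot (g : RFunc E) : g.val ⊥ = 0 := by
  rw [← g.val_row, entryHom_eq_zero _ _ (lt_irrefl _)]
  exact (E.ext.valHom ⊥ ⊥).map_zero

/-- A functional is determined by its values. -/
theorem RFunc.ext_val {g g' : RFunc E} (h : ∀ x : WithTop P, g.val x = g'.val x)
    (γ : LDual E.ext.S E.ext.J) : g γ = g' γ := by
  -- Both rows are concentrated at the minimum, and there an entry is determined by its value at
  -- `1`.
  have hr : g.row = g'.row := J_ext fun z w => by
    by_cases hz : z = ⊥
    · subst hz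
      refine val_injective ?_
      rw [val_row, val_row]
      induction w using WithBot.recBotCoe with
      | bot => rw [val_bot, val_bot]
      | coe w => exact h w
    · rw [row, row, entryHom_of_idem_smul hz (idem_smul_assemble _ _ _),
        entryHom_of_idem_smul hz (idem_smul_assemble _ _ _)]
  have h1 := g.sval_row γ
  rw [hr, g'.sval_row] at h1
  exact ((algebraMap K (E.ext.fld ⊥)).injective h1).symm

theorem entryHom_mulR (x y : WithBot (WithTop P)) (i j : E.ext.J) :
    E.ext.entryHom x y (mulR i (j : E.ext.Lam)) =
      ∑ z, ⟨(i : E.ext.Lam).1 x z * (E.ext.entryHom z y j : Alg K L),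
        E.ext.R_mul (E.ext.entryHom x z i).2 (E.ext.entryHom z y j).2⟩ := by
  refine Subtype.ext ?_
  rw [coe_entryHom_mulR, AddSubmonoidClass.coe_finsetSum]
  rfl

theorem uMap_zero_right {P : Type*} [PartialOrder P] {E : AlgEquipment K L P} {y x : P}
    (τ : E.R y x) : E.uMap τ 0 = 0 := by
  have h := E.uMap_add τ 0 0
  rw [add_zero] at h
  exact left_eq_add.1 h

/-- The left action of `J` on functionals. -/
theorem RFunc.val_lact (g g' : RFunc E) (h : E.ext.J)
    (hg : ∀ γ, g' γ = g (LDual.lact (h : E.ext.Lam) γ)) (x : WithBot (WithTop P)) :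
    g'.val x = ∑ z : WithTop P, E.ext.uMap (E.ext.entryHom z x h) (g.val z) := by
  -- The functional `γ ↦ g(h γ)` is represented by the product of the row of `g` with `h`, because
  -- `(h γ)(j) = γ(j h)`.
  have hr : mulR g.row (h : E.ext.Lam) = g'.row := by
    refine eq_assemble _ _ _ _ ?_ fun γ => ?_
    · rw [smul_mulR, row, idem_smul_assemble]
    · rw [← LDual.lact_app, sval_row, hg]
  rw [← val_row, ← hr, entryHom_mulR]
  refine (map_sum (E.ext.valHom ⊥ x) _ Finset.univ).trans ?_
  have h1 : ∀ z, E.ext.valHom ⊥ x ⟨(g.row : E.ext.Lam).1 ⊥ z * (E.ext.entryHom z x h : Alg K L),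
        E.ext.R_mul (E.ext.entryHom ⊥ z g.row).2 (E.ext.entryHom z x h).2⟩ =
      E.ext.uMap (E.ext.entryHom z x h) (g.val z) := fun z => by
    rw [← g.val_row]
    exact val_mul (E.ext.entryHom ⊥ z g.row) (E.ext.entryHom z x h)
  simp only [h1]
  -- The intermediate point `0` contributes nothing, since diagonal entries of `J` are zero.
  rw [ModDe.sum_withBot, val_bot, uMap_zero_right, zero_add]

/-- The left action of `S` on functionals. -/
theorem RFunc.val_smul (g g' : RFunc E) (s : E.ext.S)
    (hg : ∀ γ, g' γ = g (s • γ)) (x : WithBot (WithTop P)) :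
    g'.val x = E.ext.sval x s * g.val x := by
  have hr : mulR g.row (s : E.ext.Lam) = g'.row := by
    refine eq_assemble _ _ _ _ ?_ fun γ => ?_
    · rw [smul_mulR, row, idem_smul_assemble]
    · rw [← LDual.left_smul_app, sval_row, hg]
  rw [← val_row, ← hr, entryHom_mulR_coe, AlgEquipment.val_smul, val_row]

end Functional

/-! ### The functionals `γ ↦ φ(n w₁₂γ)` of a module -/

namespace ModDe

variable (M : ModDe.{u₁, u₂, u₃, w} E)

theorem actW_add (γ δ : LDual E.ext.S E.ext.J) (m : M.carrier) :
    M.actW (γ + δ) m = M.actW γ m + M.actW δ m := by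
  have h : E.ext.inW₁₂ (γ + δ) = E.ext.inW₁₂ γ + E.ext.inW₁₂ δ :=
    TensorRing.ofWZeroHom.map_add (M := DrozdW₀ E.ext.S E.ext.J) γ δ
  change op (E.ext.inW₁₂ (γ + δ)) • m = op (E.ext.inW₁₂ γ) • m + op (E.ext.inW₁₂ δ) • m
  rw [h, op_add, add_smul]

theorem actW_left (s t : E.ext.S) (γ : LDual E.ext.S E.ext.J) (m : M.carrier) :
    M.actW (s • γ) m = M.actW γ (M.actR (s, t) m) := by
  have h : E.ext.inR (s, t) * E.ext.inW₁₂ γ = E.ext.inW₁₂ (s • γ) :=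
    TensorRing.ofRZero_mul_ofWZero (s, t) (show DrozdW₀ E.ext.S E.ext.J from γ)
  change op (E.ext.inW₁₂ (s • γ)) • m = op (E.ext.inW₁₂ γ) • op (E.ext.inR (s, t)) • m
  rw [op_smul_op_smul, h]

theorem actW_right (s t : E.ext.S) (γ : LDual E.ext.S E.ext.J) (m : M.carrier) :
    M.actW (op t • γ) m = M.actR (s, t) (M.actW γ m) := by
  have h : E.ext.inW₁₂ γ * E.ext.inR (s, t) = E.ext.inW₁₂ (op t • γ) :=
    TensorRing.ofWZero_mul_ofRZero (show DrozdW₀ E.ext.S E.ext.J from γ) (s, t)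
  change op (E.ext.inW₁₂ (op t • γ)) • m = op (E.ext.inR (s, t)) • op (E.ext.inW₁₂ γ) • m
  rw [op_smul_op_smul, h]

theorem actW_zero (m : M.carrier) : M.actW 0 m = 0 := by
  have h := M.actW_add 0 0 m
  rw [add_zero] at h
  exact left_eq_add.1 h

theorem actW_sum {ι : Type*} (t : Finset ι) (γ : ι → LDual E.ext.S E.ext.J) (m : M.carrier) :
    M.actW (∑ i ∈ t, γ i) m = ∑ i ∈ t, M.actW (γ i) m := by
  classical
  induction t using Finset.induction_on with
  | empty => simp [actW_zero]
  | insert i t hi ih => rw [Finset.sum_insert hi, Finset.sum_insert hi, actW_add, ih]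

/-- From `w₁₂ γ = (w₁₂ γ) w₂` it follows that the image of `w₁₂ γ` lies in `M w₂`, which has no
component at any `x > 0`. -/
theorem toComp_actW (x : WithTop P) (γ : LDual E.ext.S E.ext.J) (m : M.carrier) :
    M.toComp x (M.actW γ m) = 0 := by
  have h := M.actW_right 0 1 γ m
  rw [op_one, one_smul] at h
  rw [h, toComp_actR_coe, map_zero, zero_smul]

theorem actW_toComp_bot (γ : LDual E.ext.S E.ext.J) (m : M.carrier) :
    M.actW γ (M.toComp ⊥ m) = 0 := by
  rw [toComp_bot, ← actW_left, zero_smul, actW_zero]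

/-- The functional `γ ↦ φ(n w₁₂ γ)`. -/
noncomputable def func (φ : M.comp ⊥ →ₗ[K] K) (n : M.carrier) : RFunc E where
  toFun γ := φ (M.toComp ⊥ (M.actW γ n))
  map_zero' := by rw [actW_zero]; exact (φ ∘ₗ M.toCompHom ⊥).map_zero
  map_add' γ δ := by rw [actW_add, toComp_add, map_add]
  map_op_smul s γ := by
    rw [M.actW_right 0 s, toComp_actR_bot, map_smul, smul_eq_mul, mul_comm]

theorem func_apply (φ : M.comp ⊥ →ₗ[K] K) (n : M.carrier) (γ : LDual E.ext.S E.ext.J) :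
    M.func φ n γ = φ (M.toComp ⊥ (M.actW γ n)) := rfl

theorem func_val_add (φ : M.comp ⊥ →ₗ[K] K) (n n' : M.carrier) (x : WithBot (WithTop P)) :
    (M.func φ (n + n')).val x = (M.func φ n).val x + (M.func φ n').val x := by
  simp only [RFunc.val, func_apply, map_add, toComp_add, add_smul, Finset.sum_add_distrib]

theorem func_val_actR (φ : M.comp ⊥ →ₗ[K] K) (s t : E.ext.S) (n : M.carrier)
    (x : WithBot (WithTop P)) :
    (M.func φ (M.actR (s, t) n)).val x = E.ext.sval x s * (M.func φ n).val x :=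
  RFunc.val_smul _ _ s (fun γ => by rw [func_apply, func_apply, ← actW_left]) x

theorem func_val_sum_smul {ι : Type*} [Fintype ι] (c : ι → K) (φ : ι → M.comp ⊥ →ₗ[K] K)
    (n : M.carrier) (x : WithBot (WithTop P)) :
    (M.func (∑ i, c i • φ i) n).val x =
      ∑ i, algebraMap K (E.ext.fld x) (c i) * (M.func (φ i) n).val x := by
  simp only [RFunc.val, func_apply, LinearMap.sum_apply, LinearMap.smul_apply, Finset.sum_smul,
    smul_eq_mul, mul_smul, Finset.mul_sum, ← Algebra.smul_def]
  exact Finset.sum_comm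

/-- By definition. Through this, the representing rows, and with them `val_lact` and `val_smul`,
apply to the matrix representation. -/
theorem LocalBases.matrix_apply {M : ModDe.{u₁, u₂, u₃, w} E} (b : M.LocalBases) (x : WithTop P)
    (j : Fin b.rank₀) (i : Fin (b.rank x)) :
    b.matrix x j i = (M.func (b.basis₀.coord j) (b.basis x i : M.carrier)).val x := rfl

variable {M} in
/-- A map that is compatible with the action at `x` is determined on a basis of `M_x`. -/
theorem LocalBases.eq_sum (b : M.LocalBases) (x : WithTop P) (G : M.carrier →+ E.ext.fld x)
    (hG : ∀ s t m, G (M.actR (s, t) m) = E.ext.sval x s * G m) (m : M.carrier) :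
    G m = ∑ i, (b.basis x).repr (M.toComp x m) i * G (b.basis x i : M.carrier) := by
  have h1 : G m = G (M.toComp x m) := by
    rw [toComp_coe, hG, idem, sval_scal, one_mul]
  have h2 : (M.toComp x m : M.carrier) = ∑ i, M.actR (E.ext.scal x
      ((b.basis x).repr (M.toComp x m) i), 0) (b.basis x i : M.carrier) := by
    conv_lhs => rw [← (b.basis x).sum_repr (M.toComp x m), AddSubmonoidClass.coe_finsetSum]
    exact Finset.sum_congr rfl fun i _ => M.smul_coe x _ _
  rw [h1, h2, map_sum]
  exact Finset.sum_congr rfl fun i _ => by rw [hG, sval_scal]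

variable {M} in
theorem LocalBases.eq_of_basis (b : M.LocalBases) (x : WithTop P) (G G' : M.carrier →+ E.ext.fld x)
    (hG : ∀ s t m, G (M.actR (s, t) m) = E.ext.sval x s * G m)
    (hG' : ∀ s t m, G' (M.actR (s, t) m) = E.ext.sval x s * G' m)
    (h : ∀ i, G (b.basis x i : M.carrier) = G' (b.basis x i : M.carrier)) (m : M.carrier) :
    G m = G' m := by
  rw [b.eq_sum x G hG, b.eq_sum x G' hG']
  simp only [h]

end ModDe

end AlgEquipment

end EqPoset

/-! ### The equation of an isomorphism in terms of matrices -/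

namespace EqPoset

namespace AlgEquipment

universe u₁ u₂ u₃ w

variable {K : Type u₁} {L : Type u₂} {P : Type u₃} [Field K] [Field L] [Algebra K L]
  [FiniteDimensional K L] [PartialOrder P] [Fintype P] [DecidableEq P] {E : AlgEquipment K L P}

/-- The left action of `J` on functionals. -/
noncomputable def RFunc.lact (g : RFunc E) (h : E.ext.J) : RFunc E where
  toFun γ := g (LDual.lact (h : E.ext.Lam) γ)
  map_zero' := g.map_zero'
  map_add' γ δ :=
    (congrArg g.toFun (LDual.lact_add (h : E.ext.Lam) γ δ)).trans (g.map_add' _ _)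
  map_op_smul s γ :=
    (congrArg g.toFun (LDual.lact_op_smul (h : E.ext.Lam) s γ)).trans (g.map_op_smul s _)

theorem RFunc.lact_apply (g : RFunc E) (h : E.ext.J) (γ : LDual E.ext.S E.ext.J) :
    g.lact h γ = g (LDual.lact (h : E.ext.Lam) γ) := rfl

/-- A sum of functionals. -/
noncomputable def RFunc.addSum (g : RFunc E) {ι : Type*} [Fintype ι] (g' : ι → RFunc E) :
    RFunc E where
  toFun γ := g γ + ∑ i, g' i γ
  map_zero' := by
    have h : ∀ g : RFunc E, g 0 = 0 := fun g => g.map_zero'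
    simp [h]
  map_add' γ δ := by
    have h : ∀ g : RFunc E, g (γ + δ) = g γ + g δ := fun g => g.map_add' γ δ
    simp only [h, Finset.sum_add_distrib]
    abel
  map_op_smul s γ := by
    have h : ∀ g : RFunc E, g (op s • γ) = g γ * _ := fun g => g.map_op_smul s γ
    simp only [h, add_mul, Finset.sum_mul]

theorem RFunc.addSum_val (g : RFunc E) {ι : Type*} [Fintype ι] (g' : ι → RFunc E)
    (x : WithBot (WithTop P)) : (g.addSum g').val x = g.val x + ∑ i, (g' i).val x := by
  simp only [val, addSum, add_smul, Finset.sum_smul, Finset.sum_add_distrib]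
  rw [Finset.sum_comm]

namespace ModDe

variable {M N : ModDe.{u₁, u₂, u₃, w} E}

theorem compEquivBot_toComp (f : M.carrier ≃ₗ[K] N.carrier)
    (hf : ∀ r m, f (M.actR r m) = N.actR r (f m)) (m : M.carrier) :
    compEquivBot f hf (M.toComp ⊥ m) = N.toComp ⊥ (f m) := by
  have h : (N.toComp ⊥ (f m) : N.carrier) = f (M.toComp ⊥ m) := toComp_map f.toLinearMap hf ⊥ m
  exact (congrArg (N.toComp ⊥) h.symm).trans (N.toComp_self _)

theorem compEquiv_toComp (f : M.carrier ≃ₗ[K] N.carrier)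
    (hf : ∀ r m, f (M.actR r m) = N.actR r (f m)) (x : WithTop P) (m : M.carrier) :
    compEquiv f hf x (M.toComp x m) = N.toComp x (f m) := by
  have h : (N.toComp x (f m) : N.carrier) = f (M.toComp x m) := toComp_map f.toLinearMap hf x m
  exact (congrArg (N.toComp x) h.symm).trans (N.toComp_self _)

variable (N) in
/-- The values of the functionals `γ ↦ φ(n w₁₂ γ)`, as a morphism of groups in `n`. -/
noncomputable def funcValHom (φ : N.comp ⊥ →ₗ[K] K) (x : WithBot (WithTop P)) :
    N.carrier →+ E.ext.fld x :=
  AddMonoidHom.mk' (fun n => (N.func φ n).val x) fun n n' => N.func_val_add φ n n' x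

/-- The maps `u` need not be linear over `K(y)`, but they are linear over `K`. This is why `L⁰`,
whose entries are in `K`, can be taken out in front of all terms. -/
theorem uMap_sum {y x : WithBot (WithTop P)} (τ : E.ext.R y x) {ι : Type*} [Fintype ι] (c : ι → K)
    (v : ι → E.ext.fld y) : E.ext.uMap τ (∑ i, algebraMap K (E.ext.fld y) (c i) * v i) =
      ∑ i, algebraMap K (E.ext.fld x) (c i) * E.ext.uMap τ (v i) := by
  have h1 := map_sum (AddMonoidHom.mk' (E.ext.uMap τ) (E.ext.uMap_add τ))
    (fun i => algebraMap K (E.ext.fld y) (c i) * v i) Finset.univ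
  refine h1.trans (Finset.sum_congr rfl fun i _ => ?_)
  change E.ext.uMap τ (algebraMap K (E.ext.fld y) (c i) * v i) = _
  rw [uMap, uMap, ← Algebra.smul_def, ← Algebra.smul_def, ← val_ksmul]
  refine congrArg _ (Subtype.ext ?_)
  change E.ext.phi y (c i • v i) * (τ : Alg K L) = c i • (E.ext.phi y (v i) * (τ : Alg K L))
  rw [phi_smul, smul_mul_assoc]

section

variable (bN : N.LocalBases)
  (a : LDual E.ext.S E.ext.J →ₗ[K] (M.carrier →ₗ[K] N.carrier))

/-- The element of the row of `J` at `y` that gives the coordinates of `a γ m` at a basis vector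
of `N_y`. -/
noncomputable def LocalBases.coordJ (y : WithTop P) (q : Fin (bN.rank y)) (m : M.carrier) :
    E.ext.J :=
  assemble E.ext.dualBasis (y : WithBot (WithTop P))
    fun γ => (bN.basis y).repr (N.toComp y (a γ m)) q

/-- The inner sum over `j` collapses to the action of `pᵢ γ` on `a(γᵢ)(m)`. Expanding this vector in
the local basis of `N`, the coordinates at `y` become left factors of the `pᵢ`, and the sum over `i`
then assembles the row `coordJ`. The component in `N_0` is killed by `w₁₂ *J`. -/
theorem LocalBases.sum_actW (γ : LDual E.ext.S E.ext.J) (m : M.carrier) :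
    ∑ i, ∑ j, N.actW (op (E.ext.dualBasis.coef γ i j) • E.ext.dualBasis.γ j)
      (a (E.ext.dualBasis.γ i) m) =
    ∑ y : WithTop P, ∑ q, N.actW (LDual.lact (bN.coordJ a y q m : E.ext.Lam) γ)
      (bN.basis y q : N.carrier) := by
  have h1 : ∀ i, ∑ j, op (E.ext.dualBasis.coef γ i j) • E.ext.dualBasis.γ j =
      LDual.lact (E.ext.dualBasis.p i : E.ext.Lam) γ := fun i =>
    LDual.ext fun q => E.ext.dualBasis.sum_coef_app γ i q
  have h2 : ∀ δ n, N.actW δ n = ∑ y : WithTop P, ∑ q,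
      N.actW (E.ext.scal y ((bN.basis y).repr (N.toComp y n) q) • δ)
        (bN.basis y q : N.carrier) := by
    intro δ n
    conv_lhs => rw [← N.sum_toComp n, map_add, actW_toComp_bot, zero_add, map_sum]
    refine Finset.sum_congr rfl fun y _ => ?_
    conv_lhs => rw [← (bN.basis y).sum_repr (N.toComp y n), AddSubmonoidClass.coe_finsetSum,
      map_sum]
    refine Finset.sum_congr rfl fun q _ => ?_
    rw [N.actW_left _ 0, smul_coe]
  simp only [← actW_sum, h1]
  rw [Finset.sum_congr rfl fun i _ => h2 _ _]
  simp only [LDual.smul_lact]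
  rw [Finset.sum_comm]
  refine Finset.sum_congr rfl fun y _ => ?_
  rw [Finset.sum_comm]
  refine Finset.sum_congr rfl fun q _ => ?_
  rw [← actW_sum]
  exact congrArg (fun δ => N.actW δ (bN.basis y q : N.carrier))
    (map_sum (LDual.lactHom γ) _ _).symm

variable (a_left : ∀ (s t : E.ext.S) γ m, a (s • γ) m = a γ (M.actR (s, t) m))
  (a_right : ∀ (s t : E.ext.S) γ m, a (op s • γ) m = N.actR (s, t) (a γ m))

include a_right in
theorem LocalBases.sval_coordJ (y : WithTop P) (q : Fin (bN.rank y)) (m : M.carrier)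
    (γ : LDual E.ext.S E.ext.J) :
    E.ext.sval y (γ (bN.coordJ a y q m)) = (bN.basis y).repr (N.toComp y (a γ m)) q :=
  sval_assemble E.ext.dualBasis _ _
    (fun γ δ => by rw [map_add, LinearMap.add_apply, toComp_add, map_add]; rfl)
    (fun s γ => by rw [a_right s 0, toComp_actR_coe, map_smul, mul_comm]; rfl) γ

include a_left a_right in
theorem LocalBases.coordJ_actR (y : WithTop P) (q : Fin (bN.rank y)) (s t : E.ext.S)
    (m : M.carrier) :
    bN.coordJ a y q (M.actR (s, t) m) = mulR (bN.coordJ a y q m) (s : E.ext.Lam) := by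
  refine (eq_assemble _ _ _ _ ?_ fun γ => ?_).symm
  · rw [smul_mulR, coordJ, idem_smul_assemble]
  · rw [← LDual.left_smul_app, sval_coordJ bN a a_right, a_left s t]

theorem LocalBases.coordJ_add (y : WithTop P) (q : Fin (bN.rank y)) (m m' : M.carrier) :
    bN.coordJ a y q (m + m') = bN.coordJ a y q m + bN.coordJ a y q m' := by
  simp only [coordJ, assemble, map_add, toComp_add, Finsupp.add_apply, scal_add, add_smul,
    Finset.sum_add_distrib]

end

/-- The rows of `L⁰` arise here, as the coordinate functionals of `M_0` pulled back to `N_0`. -/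
theorem coord_comp_symm {M N : ModDe.{u₁, u₂, u₃, w} E} (bM : M.LocalBases) (bN : N.LocalBases)
    (e : M.comp ⊥ ≃ₗ[K] N.comp ⊥) (j : Fin bM.rank₀) :
    bM.basis₀.coord j ∘ₗ e.symm.toLinearMap =
      ∑ l, LinearMap.toMatrix bN.basis₀ bM.basis₀ e.symm.toLinearMap j l • bN.basis₀.coord l := by
  refine bN.basis₀.ext fun i => ?_
  simp [LinearMap.sum_apply, LinearMap.toMatrix_apply, Finsupp.single_apply]

section

variable (bM : M.LocalBases) (bN : N.LocalBases) (f : M.carrier ≃ₗ[K] N.carrier)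
    (hf : ∀ r m, f (M.actR r m) = N.actR r (f m))
    (a : LDual E.ext.S E.ext.J →ₗ[K] (M.carrier →ₗ[K] N.carrier))
    (a_left : ∀ (s t : E.ext.S) γ m, a (s • γ) m = a γ (M.actR (s, t) m))
    (a_right : ∀ (s t : E.ext.S) γ m, a (op s • γ) m = N.actR (s, t) (a γ m))

/-- The functional that is given by the left hand side of the equation of an isomorphism. -/
noncomputable def lhsFunc (φ : N.comp ⊥ →ₗ[K] K) (m : M.carrier) : RFunc E :=
  (N.func φ (f m)).addSum fun p : Σ y, Fin (bN.rank y) =>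
    (N.func φ (bN.basis p.1 p.2 : N.carrier)).lact (bN.coordJ a p.1 p.2 m)

theorem lhsFunc_apply (φ : N.comp ⊥ →ₗ[K] K) (m : M.carrier) (γ : LDual E.ext.S E.ext.J) :
    lhsFunc bN f a φ m γ = φ (N.toComp ⊥ (N.actW γ (f m) +
      ∑ i, ∑ j, N.actW (op (E.ext.dualBasis.coef γ i j) • E.ext.dualBasis.γ j)
      (a (E.ext.dualBasis.γ i) m))) := by
  rw [bN.sum_actW a]
  change _ + ∑ p : Σ y, Fin (bN.rank y), _ = (φ ∘ₗ N.toCompHom ⊥) _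
  rw [Fintype.sum_sigma, map_add, map_sum]
  simp only [map_sum]
  rfl

theorem lhsFunc_val (φ : N.comp ⊥ →ₗ[K] K) (m : M.carrier) (x : WithBot (WithTop P)) :
    (lhsFunc bN f a φ m).val x = (N.func φ (f m)).val x +
      ∑ y : WithTop P, ∑ q, E.ext.uMap (E.ext.entryHom y x (bN.coordJ a y q m))
        ((N.func φ (bN.basis y q : N.carrier)).val y) := by
  rw [lhsFunc, RFunc.addSum_val, Fintype.sum_sigma]
  refine congrArg _ (Finset.sum_congr rfl fun y _ => Finset.sum_congr rfl fun q _ => ?_)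
  rw [RFunc.val_lact _ _ _ (RFunc.lact_apply _ _)]
  refine Finset.sum_eq_single y (fun z _ hz => ?_) fun h => absurd (Finset.mem_univ y) h
  -- The element `coordJ` at `y` has only the row at `y`, so all other intermediate points drop out.
  rw [LocalBases.coordJ, entryHom_of_idem_smul (fun h => hz (WithBot.coe_injective h))
    (idem_smul_assemble _ _ _)]
  exact (E.ext.uMapHom _ _ _).map_zero

include hf a_left a_right in
-- Both sides of the equation lie in `N_0`, since the image of `w₁₂ *J` does. Applying the inverse
-- of `f⁰` and the coordinates of `M_0` turns them into functionals of `γ`, and such functionals are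
-- determined by their values at the points `x > 0`.
theorem eqn_iff_val :
    (∀ γ m, N.actW γ (f m) +
      ∑ i, ∑ j, N.actW (op (E.ext.dualBasis.coef γ i j) • E.ext.dualBasis.γ j)
      (a (E.ext.dualBasis.γ i) m) = f (M.actW γ m)) ↔
    ∀ (m : M.carrier) (j : Fin bM.rank₀) (x : WithTop P),
      (lhsFunc bN f a (bM.basis₀.coord j ∘ₗ (compEquivBot f hf).symm.toLinearMap) m).val x =
        (M.func (bM.basis₀.coord j) m).val x := by
  have h0 : ∀ j γ m, bM.basis₀.coord j (M.toComp ⊥ (M.actW γ m)) =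
      (bM.basis₀.coord j ∘ₗ (compEquivBot f hf).symm.toLinearMap)
        (N.toComp ⊥ (f (M.actW γ m))) := by
    intro j γ m
    rw [← compEquivBot_toComp f hf, LinearMap.comp_apply, LinearEquiv.coe_coe,
      LinearEquiv.symm_apply_apply]
  constructor
  · intro h m j x
    have h1 : ∀ γ, lhsFunc bN f a (bM.basis₀.coord j ∘ₗ (compEquivBot f hf).symm.toLinearMap) m γ =
        M.func (bM.basis₀.coord j) m γ := by
      intro γ
      rw [lhsFunc_apply, h, func_apply, h0]
    simp only [RFunc.val, h1]
  · intro h γ m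
    refine N.ext_toComp ?_ fun x => ?_
    · refine (compEquivBot f hf).symm.injective (bM.basis₀.ext_elem fun j => ?_)
      have h1 := RFunc.ext_val (h m j) γ
      rw [lhsFunc_apply, func_apply, h0] at h1
      exact h1
    · rw [bN.sum_actW a, ← compEquiv_toComp f hf, toComp_actW, map_zero]
      change N.toCompHom x _ = 0
      rw [map_add, map_sum]
      simp only [map_sum]
      have h1 : ∀ δ n, N.toCompHom x (N.actW δ n) = 0 := N.toComp_actW x
      simp only [h1, Finset.sum_const_zero, add_zero]

include a_left a_right in
/-- The equation of an isomorphism, in terms of matrices. -/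
theorem eqn_iff :
    (∀ γ m, N.actW γ (f m) +
      ∑ i, ∑ j, N.actW (op (E.ext.dualBasis.coef γ i j) • E.ext.dualBasis.γ j)
      (a (E.ext.dualBasis.γ i) m) = f (M.actW γ m)) ↔
    ∀ (x : WithTop P) (j : Fin bM.rank₀) (b : Fin (bM.rank x)), bM.matrix x j b =
      ∑ l, algebraMap K (E.ext.fld x)
        (LinearMap.toMatrix bN.basis₀ bM.basis₀ (compEquivBot f hf).symm.toLinearMap j l) *
        (∑ q, bN.matrix x l q *
            LinearMap.toMatrix (bM.basis x) (bN.basis x) (compEquiv f hf x).toLinearMap q b +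
          ∑ y : WithTop P, ∑ q, E.ext.uMap (E.ext.entryHom y x
            (bN.coordJ a y q (bM.basis x b : M.carrier))) (bN.matrix y l q)) := by
  have key : ∀ (x : WithTop P) (j : Fin bM.rank₀) (b : Fin (bM.rank x)),
      (lhsFunc bN f a (bM.basis₀.coord j ∘ₗ (compEquivBot f hf).symm.toLinearMap)
        (bM.basis x b : M.carrier)).val x =
      ∑ l, algebraMap K (E.ext.fld x)
        (LinearMap.toMatrix bN.basis₀ bM.basis₀ (compEquivBot f hf).symm.toLinearMap j l) *
        (∑ q, bN.matrix x l q *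
            LinearMap.toMatrix (bM.basis x) (bN.basis x) (compEquiv f hf x).toLinearMap q b +
          ∑ y : WithTop P, ∑ q, E.ext.uMap (E.ext.entryHom y x
            (bN.coordJ a y q (bM.basis x b : M.carrier))) (bN.matrix y l q)) := by
    intro x j b
    -- The expansion of `f⁰(m_b)` in the basis of `N_x` gives the term `N_x Lˣ`.
    have h1 : ∀ l, (N.func (bN.basis₀.coord l) (f (bM.basis x b : M.carrier))).val x =
        ∑ q, bN.matrix x l q *
          LinearMap.toMatrix (bM.basis x) (bN.basis x) (compEquiv f hf x).toLinearMap q b := by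
      intro l
      refine (bN.eq_sum x (N.funcValHom (bN.basis₀.coord l) x)
        (fun s t m => N.func_val_actR _ s t m x) _).trans (Finset.sum_congr rfl fun q _ => ?_)
      rw [LinearMap.toMatrix_apply, LinearEquiv.coe_coe, mul_comm,
        ← compEquiv_toComp f hf, toComp_self]
      rfl
    rw [lhsFunc_val, coord_comp_symm bM bN]
    simp only [func_val_sum_smul, uMap_sum, h1, mul_add, Finset.sum_add_distrib,
      ← LocalBases.matrix_apply]
    refine congrArg _ ?_
    simp only [Finset.mul_sum]
    refine Eq.symm ?_
    rw [Finset.sum_comm]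
    exact Finset.sum_congr rfl fun y _ => Finset.sum_comm
  rw [eqn_iff_val bM bN f hf a a_left a_right]
  constructor
  · intro h x j b
    rw [LocalBases.matrix_apply, ← h, key]
  · intro h m j x
    -- At `x` both sides are additive in `m` and transform under `R` through `K(x)`. It is therefore
    -- enough to compare them on the basis of `M_x`.
    refine bM.eq_of_basis x (AddMonoidHom.mk' (fun m => (lhsFunc bN f a (bM.basis₀.coord j ∘ₗ
      (compEquivBot f hf).symm.toLinearMap) m).val x) fun m m' => ?_)
      (M.funcValHom (bM.basis₀.coord j) x) (fun s t m => ?_)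
      (fun s t m => M.func_val_actR _ s t m x) (fun b => ?_) m
    · simp only [lhsFunc_val, map_add, func_val_add, bN.coordJ_add, uMap_add_left,
        Finset.sum_add_distrib]
      abel
    · simp only [AddMonoidHom.mk'_apply, lhsFunc_val, hf, func_val_actR,
        bN.coordJ_actR a a_left a_right, entryHom_mulR_coe, uMap_smul_left, mul_add,
        Finset.mul_sum]
    · exact (key x j b).trans (h x j b).symm

end

end ModDe

end AlgEquipment

end EqPoset

namespace EqPoset

/-! ### Isomorphism in terms of elements of the spaces `R_{yx}` -/

section NonSingular

variable {F V W : Type*} [Field F] [AddCommGroup V] [Module F V] [AddCommGroup W] [Module F W]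
  {m n : ℕ} (b : Module.Basis (Fin m) F V) (c : Module.Basis (Fin n) F W)

theorem nonSingular_toMatrix (e : V ≃ₗ[F] W) :
    NonSingular (LinearMap.toMatrix b c e.toLinearMap) := by
  refine ⟨LinearMap.toMatrix c b e.symm.toLinearMap, ?_, ?_⟩
  · rw [← LinearMap.toMatrix_comp, LinearEquiv.comp_symm, LinearMap.toMatrix_id]
  · rw [← LinearMap.toMatrix_comp, LinearEquiv.symm_comp, LinearMap.toMatrix_id]

theorem NonSingular.exists_equiv {A : Matrix (Fin n) (Fin m) F} (h : NonSingular A) :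
    ∃ e : V ≃ₗ[F] W, LinearMap.toMatrix b c e.toLinearMap = A := by
  obtain ⟨B, hAB, hBA⟩ := h
  refine ⟨LinearEquiv.ofLinearMap (Matrix.toLin b c A) (Matrix.toLin c b B) ?_ ?_, ?_⟩
  · rw [← Matrix.toLin_mul, hAB, Matrix.toLin_one]
  · rw [← Matrix.toLin_mul, hBA, Matrix.toLin_one]
  · exact LinearMap.toMatrix_toLin b c A

end NonSingular

namespace AlgEquipment

universe u₁ u₂ u₃ w

variable {K : Type u₁} {L : Type u₂} {P : Type u₃} [Field K] [Field L] [Algebra K L]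
  [FiniteDimensional K L] [PartialOrder P] [Fintype P] [DecidableEq P] {E : AlgEquipment K L P}

namespace ModDe

variable {M N : ModDe.{u₁, u₂, u₃, w} E}

open scoped Classical in
/-- The equivalence of the matrix representations, for families of elements of the spaces
`R y x`. -/
def FamEquiv (bM : M.LocalBases) (bN : N.LocalBases) : Prop :=
  ∃ (L₀ : Matrix (Fin bM.rank₀) (Fin bN.rank₀) K)
    (L₁ : ∀ x : WithTop P, Matrix (Fin (bN.rank x)) (Fin (bM.rank x)) (E.ext.fld x))
    (H : ∀ y x : WithTop P, Fin (bN.rank y) → Fin (bM.rank x) → E.ext.R y x),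
    NonSingular L₀ ∧ (∀ x, NonSingular (L₁ x)) ∧
    ∀ (x : WithTop P) (j : Fin bM.rank₀) (b : Fin (bM.rank x)), bM.matrix x j b =
      ∑ l, algebraMap K (E.ext.fld x) (L₀ j l) * (∑ q, bN.matrix x l q * L₁ x q b +
        ∑ y with y < x, ∑ q, E.ext.uMap (H y x q b) (bN.matrix y l q))

open scoped Classical in
-- Elements of `J` have zero entries at pairs without `y < x`, so sums over all `y` reduce to `y <
-- x`, and a family `H` is unconstrained at the other pairs.
theorem sum_lt (bN : N.LocalBases) (x : WithTop P) (l : Fin bN.rank₀)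
    (h : ∀ y : WithTop P, Fin (bN.rank y) → E.ext.J)
    (g : ∀ y : WithTop P, Fin (bN.rank y) → E.ext.R y x)
    (hg : ∀ y q, y < x → E.ext.entryHom y x (h y q) = g y q) :
    ∑ y : WithTop P, ∑ q, E.ext.uMap (E.ext.entryHom y x (h y q)) (bN.matrix y l q) =
      ∑ y with y < x, ∑ q, E.ext.uMap (g y q) (bN.matrix y l q) := by
  rw [Finset.sum_filter]
  refine Finset.sum_congr rfl fun y _ => ?_
  by_cases hy : y < x
  · rw [if_pos hy]
    exact Finset.sum_congr rfl fun q _ => by rw [hg y q hy]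
  · rw [if_neg hy]
    refine Finset.sum_eq_zero fun q _ => ?_
    rw [entryHom_eq_zero _ _ fun h => hy (WithBot.coe_lt_coe.1 h)]
    exact (E.ext.uMapHom _ _ _).map_zero

theorem famEquiv_of_repEquiv (bM : M.LocalBases) (bN : N.LocalBases)
    (h : RepEquiv E.ext.dualBasis M.actR M.actW N.actR N.actW) : FamEquiv bM bN := by
  refine ⟨LinearMap.toMatrix bN.basis₀ bM.basis₀ (compEquivBot h.f₀ h.map_smul).symm.toLinearMap,
    fun x => LinearMap.toMatrix (bM.basis x) (bN.basis x)
      (compEquiv h.f₀ h.map_smul x).toLinearMap,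
    fun y x q b => E.ext.entryHom y x (bN.coordJ h.a y q (bM.basis x b : M.carrier)),
    nonSingular_toMatrix _ _ _, fun x => nonSingular_toMatrix _ _ _, fun x j b => ?_⟩
  rw [(eqn_iff bM bN h.f₀ h.map_smul h.a h.a_left h.a_right).1 h.eqn x j b]
  simp only [sum_lt bN x _ (fun y q => bN.coordJ h.a y q (bM.basis x b : M.carrier))
    (fun y q => E.ext.entryHom y x (bN.coordJ h.a y q (bM.basis x b : M.carrier)))
    fun _ _ _ => rfl]

section

variable (bM : M.LocalBases) (bN : N.LocalBases)
  (H : ∀ y x : WithTop P, Fin (bN.rank y) → Fin (bM.rank x) → E.ext.R y x)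

/-- The row that is given at `x` by the coordinates of the component of `m` in `M_x`. -/
noncomputable def famRow (y : WithTop P) (q : Fin (bN.rank y)) (m : M.carrier)
    (x : WithBot (WithTop P)) : E.ext.R y x :=
  -- The value at `⊥` is never used: `rowJ` keeps only the entries at points above `y`.
  WithBot.recBotCoe (C := fun x => E.ext.R y x) 0
    (fun x => ∑ b, (bM.basis x).repr (M.toComp x m) b • H y x q b) x

theorem famRow_coe (y : WithTop P) (q : Fin (bN.rank y)) (m : M.carrier) (x : WithTop P) :
    famRow bM bN H y q m x = ∑ b, (bM.basis x).repr (M.toComp x m) b • H y x q b := rfl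

/-- The element of `J` with the row `famRow`. -/
noncomputable def famJ (y : WithTop P) (q : Fin (bN.rank y)) (m : M.carrier) : E.ext.J :=
  rowJ y (famRow bM bN H y q m)

theorem famJ_add (y : WithTop P) (q : Fin (bN.rank y)) (m m' : M.carrier) :
    famJ bM bN H y q (m + m') = famJ bM bN H y q m + famJ bM bN H y q m' := by
  rw [famJ, famJ, famJ, ← rowJ_add]
  refine congrArg _ (funext fun x => ?_)
  induction x using WithBot.recBotCoe with
  | bot => exact (add_zero _).symm
  | coe x =>
    rw [Pi.add_apply]
    simp only [famRow_coe, toComp_add, map_add, Finsupp.add_apply, add_smul, Finset.sum_add_distrib]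

theorem famJ_actR (y : WithTop P) (q : Fin (bN.rank y)) (s t : E.ext.S) (m : M.carrier) :
    famJ bM bN H y q (M.actR (s, t) m) = mulR (famJ bM bN H y q m) (s : E.ext.Lam) := by
  rw [famJ, famJ, ← rowJ_smul]
  refine congrArg _ (funext fun x => ?_)
  induction x using WithBot.recBotCoe with
  | bot => exact (smul_zero _).symm
  | coe x =>
    simp only [famRow_coe, toComp_actR_coe, map_smul, Finsupp.smul_apply, smul_eq_mul, mul_smul,
      Finset.smul_sum]

theorem apply_famJ_smul (γ : LDual E.ext.S E.ext.J) (y : WithTop P) (q : Fin (bN.rank y)) (k : K)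
    (m : M.carrier) : γ (famJ bM bN H y q (k • m)) = k • γ (famJ bM bN H y q m) := by
  -- Compatibility with `K` is deduced from that with `R`, because `k` acts as an element of `R`
  -- whose two components are central in `Λ`.
  have h1 : k • m = M.actR (k • (1 : E.ext.S), k • (1 : E.ext.S)) m := by
    rw [← Prod.smul_mk, actR_smul]
    exact congrArg _ (M.actR_one m).symm
  have h2 : ∀ j : E.ext.J, mulR j ((k • (1 : E.ext.S) : E.ext.S) : E.ext.Lam) =
      (k • (1 : E.ext.S)) • j := fun j => Subtype.ext (by
    change (j : E.ext.Lam) * (k • 1) = (k • 1) * (j : E.ext.Lam)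
    rw [mul_smul_comm, smul_mul_assoc, mul_one, one_mul])
  rw [h1, famJ_actR, h2, LDual.map_smul, smul_mul_assoc, one_mul]

theorem entryHom_famJ {y x : WithTop P} (h : y < x) (q : Fin (bN.rank y)) (b : Fin (bM.rank x)) :
    E.ext.entryHom y x (famJ bM bN H y q (bM.basis x b : M.carrier)) = H y x q b := by
  rw [famJ, entryHom_rowJ _ (WithBot.coe_lt_coe.2 h), famRow_coe, toComp_self, Module.Basis.repr_self, Finset.sum_eq_single b, Finsupp.single_eq_same, one_smul]
  · intro b' _ hb
    rw [Finsupp.single_eq_of_ne hb, zero_smul]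
  · exact fun h => absurd (Finset.mem_univ _) h

theorem smul_assoc_comp (x : WithTop P) (k : K) (c : E.ext.fld x) (v : N.comp x) :
    (k • c) • v = k • c • v := by
  rw [Algebra.smul_def, mul_smul, algebraMap_smul]

/-- The map `γ ↦ a γ` with the coordinates given by `famJ`. -/
noncomputable def famMap : LDual E.ext.S E.ext.J →ₗ[K] (M.carrier →ₗ[K] N.carrier) :=
  LinearMap.mk₂ K (fun γ m => ∑ y : WithTop P, ∑ q,
      ((E.ext.sval y (γ (famJ bM bN H y q m)) • bN.basis y q : N.comp y) : N.carrier))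
    (fun γ δ m => by
      simp only [LDual.add_app, map_add, add_smul, Submodule.coe_add, Finset.sum_add_distrib])
    (fun k γ m => by
      simp only [LDual.smul_app, sval_smul, smul_assoc_comp, Submodule.coe_smul, Finset.smul_sum])
    (fun γ m m' => by
      simp only [famJ_add, LDual.map_add, map_add, add_smul, Submodule.coe_add,
        Finset.sum_add_distrib])
    (fun k γ m => by
      simp only [apply_famJ_smul, sval_smul, smul_assoc_comp, Submodule.coe_smul,
        Finset.smul_sum])

theorem famMap_apply (γ : LDual E.ext.S E.ext.J) (m : M.carrier) :
    famMap bM bN H γ m = ∑ y : WithTop P, ∑ q,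
      ((E.ext.sval y (γ (famJ bM bN H y q m)) • bN.basis y q : N.comp y) : N.carrier) := rfl

theorem toComp_famMap (γ : LDual E.ext.S E.ext.J) (m : M.carrier) (x : WithTop P) :
    N.toComp x (famMap bM bN H γ m) =
      ∑ q, E.ext.sval x (γ (famJ bM bN H x q m)) • bN.basis x q := by
  change N.toCompHom x _ = _
  rw [famMap_apply, map_sum, Finset.sum_eq_single x, map_sum]
  · exact Finset.sum_congr rfl fun q _ => N.toComp_self _
  · intro y _ hy
    rw [map_sum]
    exact Finset.sum_eq_zero fun q _ => N.toComp_coe_ne hy.symm _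
  · exact fun h => absurd (Finset.mem_univ _) h

theorem toComp_bot_famMap (γ : LDual E.ext.S E.ext.J) (m : M.carrier) :
    N.toComp ⊥ (famMap bM bN H γ m) = 0 := by
  change N.toCompHom ⊥ _ = _
  rw [famMap_apply]
  simp only [map_sum]
  exact Finset.sum_eq_zero fun y _ => Finset.sum_eq_zero fun q _ => N.toComp_bot_coe _

theorem famMap_left (s t : E.ext.S) (γ : LDual E.ext.S E.ext.J) (m : M.carrier) :
    famMap bM bN H (s • γ) m = famMap bM bN H γ (M.actR (s, t) m) := by
  simp only [famMap_apply, famJ_actR, LDual.left_smul_app]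

theorem famMap_right (s t : E.ext.S) (γ : LDual E.ext.S E.ext.J) (m : M.carrier) :
    famMap bM bN H (op s • γ) m = N.actR (s, t) (famMap bM bN H γ m) := by
  refine N.ext_toComp ?_ fun x => ?_
  · rw [toComp_actR_bot, toComp_bot_famMap, toComp_bot_famMap, smul_zero]
  · rw [toComp_actR_coe, toComp_famMap, toComp_famMap, Finset.smul_sum]
    refine Finset.sum_congr rfl fun q _ => ?_
    rw [LDual.op_smul_app, map_mul, mul_comm, mul_smul]

/-- The coordinate of `famMap` at a basis vector of `N_y` is evaluation at the row `famJ`, and a row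
is determined by the functional it represents. So every family `H` occurs as the family of entries
of some `a`. -/
theorem coordJ_famMap (y : WithTop P) (q : Fin (bN.rank y)) (m : M.carrier) :
    bN.coordJ (famMap bM bN H) y q m = famJ bM bN H y q m := by
  refine (eq_assemble _ _ _ _ (idem_smul_rowJ _ _) fun γ => ?_).symm
  rw [toComp_famMap, Module.Basis.repr_sum_self]
  rfl

end

theorem nonempty_repEquiv_iff (bM : M.LocalBases) (bN : N.LocalBases) :
    Nonempty (RepEquiv E.ext.dualBasis M.actR M.actW N.actR N.actW) ↔ FamEquiv bM bN := by
  refine ⟨fun ⟨h⟩ => famEquiv_of_repEquiv bM bN h, fun ⟨L₀, L₁, H, h₀, h₁, h⟩ => ?_⟩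
  -- `L⁰` stands on the side of the matrices of `N`, so it is the matrix of a map `N_0 → M_0`, and
  -- `f⁰` is its inverse at `0`.
  obtain ⟨e₀, he₀⟩ := h₀.exists_equiv bN.basis₀ bM.basis₀
  choose e he using fun x => (h₁ x).exists_equiv (bM.basis x) (bN.basis x)
  obtain ⟨f, hf, hf₀, hf₁⟩ := exists_equiv e₀.symm e
  have k₀ : (compEquivBot f hf).symm = e₀ := by
    rw [← LinearEquiv.symm_symm e₀]
    refine congrArg _ (LinearEquiv.ext fun v => ?_)
    rw [← M.toComp_self v, compEquivBot_toComp, hf₀]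
  have k₁ : ∀ x, compEquiv f hf x = e x := fun x => LinearEquiv.ext fun v => by
    rw [← M.toComp_self v, compEquiv_toComp, hf₁]
  refine ⟨⟨f, famMap bM bN H, hf, famMap_left bM bN H, famMap_right bM bN H,
    (eqn_iff bM bN f hf _ (famMap_left bM bN H) (famMap_right bM bN H)).2 fun x j b => ?_⟩⟩
  rw [h, k₀, k₁, he₀, he]
  simp only [coordJ_famMap]
  simp only [sum_lt bN x _ (fun y q => famJ bM bN H y q (bM.basis x b : M.carrier))
    (fun y q => H y x q b) fun y q hy => entryHom_famJ bM bN H hy q b]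

theorem iso_iff_famEquiv (bM : M.LocalBases) (bN : N.LocalBases) :
    M.Iso N ↔ FamEquiv bM bN :=
  (iso_iff M N).trans (nonempty_repEquiv_iff bM bN)

end ModDe

end AlgEquipment

end EqPoset

/-! ### Coordinates in bases of the spaces `R_{yx}` -/

namespace EqPoset

namespace AlgEquipment

universe u₁ u₂ u₃ w

variable {K : Type u₁} {L : Type u₂} {P : Type u₃} [Field K] [Field L] [Algebra K L]
  [FiniteDimensional K L] [PartialOrder P] [Fintype P] [DecidableEq P] {E : AlgEquipment K L P}

namespace ModDe

variable {M N : ModDe.{u₁, u₂, u₃, w} E}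

open scoped Classical in
-- The map `u_h` depends `K(x)`-linearly on `h`, so the coordinates of `H` in the basis `τ` become
-- the entries of the matrices `Lᵢ`.
theorem basis_sum_apply (τ : E.RBases) (bN : N.LocalBases) {n : ℕ} (x : WithTop P)
    (L₂ : ∀ y : WithTop P, Fin (τ.rank y x) → Matrix (Fin (bN.rank y)) (Fin n) (E.ext.fld x))
    (H : ∀ y : WithTop P, Fin (bN.rank y) → Fin n → E.ext.R y x)
    (h : ∀ y q b, H y q b = ∑ i, L₂ y i q b • τ.basis y x i) (l : Fin bN.rank₀) (b : Fin n) :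
    (∑ y with y < x, ∑ i, (bN.matrix y).map (E.ext.uMap (τ.basis y x i)) * L₂ y i) l b =
      ∑ y with y < x, ∑ q, E.ext.uMap (H y q b) (bN.matrix y l q) := by
  rw [Matrix.sum_apply]
  refine Finset.sum_congr rfl fun y _ => ?_
  rw [Matrix.sum_apply]
  simp only [Matrix.mul_apply, Matrix.map_apply]
  rw [Finset.sum_comm]
  refine Finset.sum_congr rfl fun q _ => ?_
  rw [h]
  refine Eq.symm ((map_sum (E.ext.uMapHom y x (bN.matrix y l q)) _ _).trans ?_)
  refine Finset.sum_congr rfl fun i _ => ?_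
  rw [map_smul, smul_eq_mul, mul_comm]
  rfl

theorem famEquiv_iff_matrixEquiv (τ : E.RBases) (bM : M.LocalBases) (bN : N.LocalBases) :
    FamEquiv bM bN ↔ MatrixEquiv τ bM bN := by
  constructor
  · rintro ⟨L₀, L₁, H, h₀, h₁, h⟩
    refine ⟨L₀, L₁, fun y x i => Matrix.of fun q b => (τ.basis y x).repr (H y x q b) i, h₀, h₁,
      fun x => Matrix.ext fun j b => ?_⟩
    rw [h, Matrix.mul_apply]
    refine Finset.sum_congr rfl fun l _ => ?_
    rw [Matrix.map_apply, Matrix.add_apply, Matrix.mul_apply]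
    refine congrArg (_ * ·) (congrArg (_ + ·) (Eq.symm ?_))
    exact basis_sum_apply τ bN x _ (fun y => H y x)
      (fun y q b => ((τ.basis y x).sum_repr (H y x q b)).symm) l b
  · rintro ⟨L₀, L₁, L₂, h₀, h₁, h⟩
    refine ⟨L₀, L₁, fun y x q b => ∑ i, L₂ y x i q b • τ.basis y x i, h₀, h₁, fun x j b => ?_⟩
    rw [h, Matrix.mul_apply]
    refine Finset.sum_congr rfl fun l _ => ?_
    rw [Matrix.map_apply, Matrix.add_apply, Matrix.mul_apply]
    refine congrArg (_ * ·) (congrArg (_ + ·) ?_)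
    exact basis_sum_apply τ bN x (fun y => L₂ y x) _ (fun y q b => rfl) l b

end ModDe

end AlgEquipment

end EqPoset

/-! ### The maps `u` for a `p`-equipped poset -/

namespace EqPoset

theorem NonSingular.map {m n A B : Type*} [Fintype m] [Fintype n] [DecidableEq m] [DecidableEq n]
    [CommRing A] [CommRing B] {X : Matrix m n A} (h : NonSingular X) (f : A →+* B) :
    NonSingular (X.map f) := by
  obtain ⟨Y, h₁, h₂⟩ := h
  refine ⟨Y.map f, ?_, ?_⟩
  · rw [← Matrix.map_mul, h₁, Matrix.map_one _ (map_zero f) (map_one f)]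
  · rw [← Matrix.map_mul, h₂, Matrix.map_one _ (map_zero f) (map_one f)]

section

variable {K L : Type*} [Field K] [Field L] [Algebra K L] [FiniteDimensional K L]

theorem proj_congr {F F' : IntermediateField K L} (hF : F = F') (ξ : L)
    (h : IntermediateField.adjoin K {ξ} = ⊤) (b : L) :
    (proj F ξ h b : L) = (proj F' ξ h b : L) := by
  subst hF
  rfl

theorem proj_of_eq_top {F : IntermediateField K L} (hF : F = ⊤) (ξ : L)
    (h : IntermediateField.adjoin K {ξ} = ⊤) (b : L) : (proj F ξ h b : L) = b :=
  congrArg Subtype.val (proj_coe F ξ h ⟨b, hF ▸ IntermediateField.mem_top⟩)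

theorem exists_algebraMap_eq {F : IntermediateField K L} (hF : F = ⊥) (a : F) :
    ∃ k, algebraMap K L k = a := by
  subst hF
  exact IntermediateField.mem_bot.1 a.2

namespace AlgEquipment

variable {P : Type*} [PartialOrder P] (E : AlgEquipment K L P)

/-- `φ_y⁻¹(a)` maps `1` to `a`, so `u_h` is the restriction of `h` itself to `K(y)`. -/
theorem coe_uMap {y x : P} (h : E.R y x) (a : E.fld y) :
    (E.uMap h a : L) = (h : Alg K L).unop a := by
  rw [uMap, coe_val, unop_mul_apply, unop_phi, proj_one]
  exact congrArg _ (mul_one _)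

/-- Writing `h = ε_y t ε_x` and using that `ε_y` fixes `K(y)`, the map `u_h` is `t` followed by the
projection onto `K(x)`. With the converse below, the possible `u_h` can be read off from `T_{yx}`.
-/
theorem exists_mem_T {y x : P} (hyx : y ≤ x) (h : E.R y x) :
    ∃ t ∈ E.T y x, ∀ a : E.fld y,
      (E.uMap h a : L) = proj (E.fld x) E.ξ E.adjoin_ξ (t.unop a) := by
  obtain ⟨t, ht, he⟩ := (E.mem_R_of_le hyx).1 h.2
  refine ⟨t, ht, fun a => ?_⟩
  rw [coe_uMap, ← he, unop_mul_apply, unop_mul_apply, unop_eps, unop_eps, proj_coe]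

theorem exists_of_mem_T {y x : P} (hyx : y ≤ x) {t : Alg K L} (ht : t ∈ E.T y x) :
    ∃ h : E.R y x, ∀ a : E.fld y,
      (E.uMap h a : L) = proj (E.fld x) E.ξ E.adjoin_ξ (t.unop a) := by
  refine ⟨⟨E.eps y * (t * E.eps x), (E.mem_R_of_le hyx).2 ⟨t, ht, rfl⟩⟩, fun a => ?_⟩
  rw [coe_uMap, unop_mul_apply, unop_mul_apply, unop_eps, unop_eps, proj_coe]

end AlgEquipment

namespace PExtension

variable {p : ℕ} [Fact p.Prime] (X : PExtension p K L)

/-- `constCoeff` as a linear map. -/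
noncomputable def constHom : L →ₗ[K] (⊥ : IntermediateField K L) :=
  (proj (⊥ : IntermediateField K L) X.ξ X.adjoin_ξ).restrictScalars K

theorem coe_constHom (b : L) : (X.constHom b : L) = X.constCoeff b := rfl

theorem constCoeff_sum {ι : Type*} [Fintype ι] (f : ι → L) :
    X.constCoeff (∑ i, f i) = ∑ i, X.constCoeff (f i) := by
  simp only [← coe_constHom, map_sum, AddSubmonoidClass.coe_finsetSum]

theorem constCoeff_algebraMap_mul (k : K) (b : L) :
    X.constCoeff (algebraMap K L k * b) = algebraMap K L k * X.constCoeff b := by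
  rw [← Algebra.smul_def, ← coe_constHom, map_smul, ← Algebra.smul_def]
  rfl

theorem exists_constCoeff (b : L) : ∃ k : K, X.constCoeff b = algebraMap K L k := by
  obtain ⟨k, hk⟩ := IntermediateField.mem_bot.1 (X.constHom b).2
  exact ⟨k, hk.symm⟩

/-- The bilinear form `(a, b) ↦ constCoeff (a b)` is not degenerate. -/
theorem exists_constCoeff_mul (t : Module.End K L) :
    ∃ b, ∀ a, X.constCoeff (t a) = X.constCoeff (a * b) := by

  let e : (⊥ : IntermediateField K L) ≃ₗ[K] K := (IntermediateField.botEquiv K L).toLinearEquiv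
  -- `Φ b` is the functional `a ↦ R(b a)`. For `b ≠ 0` it takes the value `R(1) = 1` at `b⁻¹`, so
  -- `Φ` is injective; the dimensions agree, so it is surjective, and in particular reaches `a ↦
  -- R(t(a))`.
  let Φ : L →ₗ[K] Module.Dual K L :=
    (LinearMap.llcomp K L L K (e.toLinearMap ∘ₗ X.constHom)) ∘ₗ LinearMap.mul K L
  have hΦ : ∀ b a, Φ b a = e (X.constHom (b * a)) := fun _ _ => rfl
  have hinj : Function.Injective Φ := by
    rw [injective_iff_map_eq_zero]
    intro b hb
    by_contra hb0
    have h1 := LinearMap.congr_fun hb b⁻¹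
    rw [hΦ, mul_inv_cancel₀ hb0, LinearMap.zero_apply, map_eq_zero_iff _ e.injective] at h1
    exact one_ne_zero ((proj_one ⊥ X.ξ X.adjoin_ξ).symm.trans h1)
  have hsurj : Function.Surjective Φ :=
    (LinearMap.injective_iff_surjective_of_finrank_eq_finrank
      (Subspace.dual_finrank_eq (K := K) (V := L)).symm).1 hinj
  obtain ⟨b, hb⟩ := hsurj (e.toLinearMap ∘ₗ X.constHom ∘ₗ t)
  refine ⟨b, fun a => ?_⟩
  have h1 := LinearMap.congr_fun hb a
  rw [hΦ, mul_comm] at h1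
  exact (congrArg Subtype.val (e.injective h1)).symm

theorem exists_coeff {l : ℕ} {f : Alg K L} (hf : f ∈ X.T l) :
    ∃ c : ℕ → L, ∀ b, f.unop b = ∑ i ∈ Finset.range l, (X.θ ^ i) b * c i := by
  induction hf using Submodule.span_induction with
  | zero => exact ⟨0, fun b => by simp⟩
  | add f g _ _ hf hg =>
    obtain ⟨c, hc⟩ := hf
    obtain ⟨d, hd⟩ := hg
    refine ⟨c + d, fun b => ?_⟩
    rw [unop_add, LinearMap.add_apply, hc, hd, ← Finset.sum_add_distrib]
    exact Finset.sum_congr rfl fun i _ => (mul_add _ _ _).symm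
  | smul k f _ hf =>
    obtain ⟨c, hc⟩ := hf
    refine ⟨k • c, fun b => ?_⟩
    rw [unop_smul, LinearMap.smul_apply, hc, Finset.smul_sum]
    exact Finset.sum_congr rfl fun i _ => (mul_smul_comm _ _ _).symm
  | mem f hf =>
    obtain ⟨a, i, hi, rfl⟩ := hf
    refine ⟨Pi.single i a, fun b => ?_⟩
    rw [Finset.sum_eq_single_of_mem i (Finset.mem_range.2 hi), Pi.single_eq_same, muComp_apply,
      mul_comm]
    intro j _ hj
    rw [Pi.single_eq_of_ne hj, mul_zero]

theorem exists_of_coeff (l : ℕ) (c : ℕ → L) :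
    ∃ f ∈ X.T l, ∀ b, f.unop b = ∑ i ∈ Finset.range l, (X.θ ^ i) b * c i := by
  refine ⟨∑ i ∈ Finset.range l, muComp (c i) (X.θ ^ i), sum_mem fun i hi =>
    Submodule.subset_span ⟨_, i, Finset.mem_range.1 hi, rfl⟩, fun b => ?_⟩
  rw [← MulOpposite.coe_opLinearEquiv_symm (R := K), map_sum, LinearMap.sum_apply]
  exact Finset.sum_congr rfl fun i _ => mul_comm _ _

theorem mulLeft_mem_T {l : ℕ} (hl : 1 ≤ l) (c : L) :
    (op (LinearMap.mulLeft K c) : Alg K L) ∈ X.T l :=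
  Submodule.subset_span ⟨c, 0, hl, rfl⟩

end PExtension

namespace PEquipped

variable {p : ℕ} [Fact p.Prime] {P : Type*} [PartialOrder P] (Q : PEquipped p P)

theorem one_le_lev' {y x : WithTop P} (h : y ≤ x) : 1 ≤ Q.lev' y x := by
  have hp : 1 ≤ p := (Fact.out : p.Prime).one_le
  match y, x with
  | some y, some x => exact Q.one_le (WithTop.coe_le_coe.1 h)
  | none, _ => exact hp
  | some _, none => exact hp

variable (X : PExtension p K L)

/-- Relations that involve `m` carry the level `p`, and the powers of `ϑ` below `p` span all of `A`
over `L`. So `m` needs no separate treatment. -/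
theorem ext_T (y x : WithTop P) : (Q.toAlg X).ext.T y x = X.T (Q.lev' y x) := by
  match y, x with
  | some y, some x => rfl
  | none, _ => exact X.T_p.symm
  | some _, none => exact X.T_p.symm

theorem ext_fld_of_strong {x : WithTop P} (h : Q.Strong' x) : (Q.toAlg X).ext.fld x = ⊥ := by
  match x with
  | none => rfl
  | some x => exact if_pos h

theorem ext_fld_of_not_strong {x : WithTop P} (h : ¬ Q.Strong' x) :
    (Q.toAlg X).ext.fld x = ⊤ := by
  match x with
  | none => exact absurd rfl h
  | some x => exact if_neg h

section

variable {Q} {y x : WithTop P} (hyx : y ≤ x)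

include hyx

/-- On `K` a `K`-linear map `t` is multiplication by `t(1)`, and the projection onto `K(x) = K`
keeps the constant coefficient of `t(1)`. -/
theorem exists_of_strong_strong (hy : Q.Strong' y) (hx : Q.Strong' x) (h : (Q.toAlg X).ext.R y x) :
    ∃ c : K, ∀ a : (Q.toAlg X).ext.fld y,
      ((Q.toAlg X).ext.uMap h a : L) = (a : L) * algebraMap K L c := by
  obtain ⟨t, -, ht⟩ := (Q.toAlg X).ext.exists_mem_T (WithBot.coe_le_coe.2 hyx) h
  obtain ⟨c, hc⟩ := X.exists_constCoeff (t.unop 1)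
  refine ⟨c, fun a => ?_⟩
  obtain ⟨k, hk⟩ := exists_algebraMap_eq (Q.ext_fld_of_strong X hy) a
  rw [ht, proj_congr (Q.ext_fld_of_strong X hx), ← hk, ← hc, ← X.constCoeff_algebraMap_mul,
    Algebra.algebraMap_eq_smul_one, map_smul, smul_mul_assoc, one_mul]
  rfl

theorem exists_strong_strong (hy : Q.Strong' y) (hx : Q.Strong' x) (c : K) :
    ∃ h : (Q.toAlg X).ext.R y x, ∀ a : (Q.toAlg X).ext.fld y,
      ((Q.toAlg X).ext.uMap h a : L) = (a : L) * algebraMap K L c := by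
  have hm := X.mulLeft_mem_T (Q.one_le_lev' hyx) (algebraMap K L c)
  rw [← Q.ext_T X] at hm
  obtain ⟨h, hh⟩ := (Q.toAlg X).ext.exists_of_mem_T (WithBot.coe_le_coe.2 hyx) hm
  refine ⟨h, fun a => ?_⟩
  obtain ⟨k, hk⟩ := exists_algebraMap_eq (Q.ext_fld_of_strong X hy) a
  rw [hh, proj_congr (Q.ext_fld_of_strong X hx), ← hk, unop_op, LinearMap.mulLeft_apply, ← map_mul,
    mul_comm, ← map_mul]
  exact congrArg Subtype.val (proj_coe ⊥ X.ξ X.adjoin_ξ (algebraMap K _ (k * c)))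

/-- Followed by the projection onto `K`, any `t` can be replaced by a multiplication, since the form
`R(a b)` is not degenerate. This is why the level of the relation does not matter when `x` is
strong. -/
theorem exists_of_weak_strong (hx : Q.Strong' x) (h : (Q.toAlg X).ext.R y x) :
    ∃ c : L, ∀ a : (Q.toAlg X).ext.fld y,
      ((Q.toAlg X).ext.uMap h a : L) = X.constCoeff ((a : L) * c) := by
  obtain ⟨t, -, ht⟩ := (Q.toAlg X).ext.exists_mem_T (WithBot.coe_le_coe.2 hyx) h
  obtain ⟨c, hc⟩ := X.exists_constCoeff_mul t.unop
  refine ⟨c, fun a => ?_⟩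
  rw [ht, proj_congr (Q.ext_fld_of_strong X hx), ← hc]
  rfl

/-- Levels are at least one, so every multiplication `μ_c` lies in `T_{yx}`. -/
theorem exists_weak_strong (hx : Q.Strong' x) (c : L) :
    ∃ h : (Q.toAlg X).ext.R y x, ∀ a : (Q.toAlg X).ext.fld y,
      ((Q.toAlg X).ext.uMap h a : L) = X.constCoeff ((a : L) * c) := by
  have hm := X.mulLeft_mem_T (Q.one_le_lev' hyx) c
  rw [← Q.ext_T X] at hm
  obtain ⟨h, hh⟩ := (Q.toAlg X).ext.exists_of_mem_T (WithBot.coe_le_coe.2 hyx) hm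
  refine ⟨h, fun a => ?_⟩
  rw [hh, proj_congr (Q.ext_fld_of_strong X hx), unop_op, LinearMap.mulLeft_apply, mul_comm]
  rfl

theorem exists_of_strong_weak (hy : Q.Strong' y) (hx : ¬ Q.Strong' x)
    (h : (Q.toAlg X).ext.R y x) :
    ∃ c : L, ∀ a : (Q.toAlg X).ext.fld y, ((Q.toAlg X).ext.uMap h a : L) = (a : L) * c := by
  obtain ⟨t, -, ht⟩ := (Q.toAlg X).ext.exists_mem_T (WithBot.coe_le_coe.2 hyx) h
  refine ⟨t.unop 1, fun a => ?_⟩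
  obtain ⟨k, hk⟩ := exists_algebraMap_eq (Q.ext_fld_of_strong X hy) a
  rw [ht, proj_of_eq_top (Q.ext_fld_of_not_strong X hx), ← hk, Algebra.algebraMap_eq_smul_one,
    map_smul, smul_mul_assoc, one_mul]

theorem exists_strong_weak (hx : ¬ Q.Strong' x) (c : L) :
    ∃ h : (Q.toAlg X).ext.R y x, ∀ a : (Q.toAlg X).ext.fld y,
      ((Q.toAlg X).ext.uMap h a : L) = (a : L) * c := by
  have hm := X.mulLeft_mem_T (Q.one_le_lev' hyx) c
  rw [← Q.ext_T X] at hm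
  obtain ⟨h, hh⟩ := (Q.toAlg X).ext.exists_of_mem_T (WithBot.coe_le_coe.2 hyx) hm
  refine ⟨h, fun a => ?_⟩
  rw [hh, proj_of_eq_top (Q.ext_fld_of_not_strong X hx), unop_op, LinearMap.mulLeft_apply, mul_comm]

/-- With `K(x) = L` there is no projection, so `u_h` is the restriction of `t` itself, and the
spanning set of `T_{yx}` gives its form. -/
theorem exists_of_weak_weak (hx : ¬ Q.Strong' x) (h : (Q.toAlg X).ext.R y x) :
    ∃ c : ℕ → L, ∀ a : (Q.toAlg X).ext.fld y, ((Q.toAlg X).ext.uMap h a : L) =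
      ∑ i ∈ Finset.range (Q.lev' y x), (X.θ ^ i) (a : L) * c i := by
  obtain ⟨t, hm, ht⟩ := (Q.toAlg X).ext.exists_mem_T (WithBot.coe_le_coe.2 hyx) h
  rw [Q.ext_T X] at hm
  obtain ⟨c, hc⟩ := X.exists_coeff hm
  exact ⟨c, fun a => by rw [ht, proj_of_eq_top (Q.ext_fld_of_not_strong X hx), hc]⟩

theorem exists_weak_weak (hx : ¬ Q.Strong' x) (c : ℕ → L) :
    ∃ h : (Q.toAlg X).ext.R y x, ∀ a : (Q.toAlg X).ext.fld y,
      ((Q.toAlg X).ext.uMap h a : L) =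
        ∑ i ∈ Finset.range (Q.lev' y x), (X.θ ^ i) (a : L) * c i := by
  obtain ⟨t, hm, ht⟩ := X.exists_of_coeff (Q.lev' y x) c
  rw [← Q.ext_T X] at hm
  obtain ⟨h, hh⟩ := (Q.toAlg X).ext.exists_of_mem_T (WithBot.coe_le_coe.2 hyx) hm
  exact ⟨h, fun a => by rw [hh, proj_of_eq_top (Q.ext_fld_of_not_strong X hx), ht]⟩

end

end PEquipped

end

end EqPoset

/-! ### The explicit matrix equations for a `p`-equipped poset -/

namespace EqPoset

open AlgEquipment ModDe

universe u₁ u₂ u₃ w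

variable {K : Type u₁} {L : Type u₂} {P : Type u₃} [Field K] [Field L] [Algebra K L]
  [FiniteDimensional K L] [PartialOrder P] [Fintype P] [DecidableEq P]

namespace AlgEquipment

variable {E : AlgEquipment K L P} {M N : ModDe.{u₁, u₂, u₃, w} E}

/-- The matrix over `L` that is given by elements of `R y x`. -/
noncomputable def ModDe.LocalBases.famMat (bN : N.LocalBases) (y x : WithTop P) {n : ℕ}
    (H : Fin (bN.rank y) → Fin n → E.ext.R y x) : Matrix (Fin bN.rank₀) (Fin n) L :=
  Matrix.of fun l b => ∑ q, (E.ext.uMap (H q b) (bN.matrix y l q) : L)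

theorem ModDe.LocalBases.famMat_apply (bN : N.LocalBases) (y x : WithTop P) {n : ℕ}
    (H : Fin (bN.rank y) → Fin n → E.ext.R y x) (l : Fin bN.rank₀) (b : Fin n) :
    bN.famMat y x H l b = ∑ q, (E.ext.uMap (H q b) (bN.matrix y l q) : L) := rfl

open scoped Classical in
-- The fields `K(x)` vary with `x`; passing to entries in `L` loses nothing, since `K(x)` is a
-- subfield, and puts strong and weak points on the same footing.
theorem eqn_iff_matrixL (bM : M.LocalBases) (bN : N.LocalBases) (x : WithTop P)
    (L₀ : Matrix (Fin bM.rank₀) (Fin bN.rank₀) K)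
    (L₁ : Matrix (Fin (bN.rank x)) (Fin (bM.rank x)) (E.ext.fld x))
    (H : ∀ y : WithTop P, Fin (bN.rank y) → Fin (bM.rank x) → E.ext.R y x) :
    (∀ (j : Fin bM.rank₀) (b : Fin (bM.rank x)), bM.matrix x j b =
      ∑ l, algebraMap K (E.ext.fld x) (L₀ j l) * (∑ q, bN.matrix x l q * L₁ q b +
        ∑ y with y < x, ∑ q, E.ext.uMap (H y q b) (bN.matrix y l q))) ↔
    matrixL bM x = L₀.map (algebraMap K L) * (matrixL bN x * L₁.map (fun c => (c : L)) +
      ∑ y with y < x, bN.famMat y x (H y)) := by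
  rw [← Matrix.ext_iff]
  refine forall_congr' fun j => forall_congr' fun b => ?_
  rw [← Subtype.coe_inj]
  have h : ((∑ l, algebraMap K (E.ext.fld x) (L₀ j l) * (∑ q, bN.matrix x l q * L₁ q b +
        ∑ y with y < x, ∑ q, E.ext.uMap (H y q b) (bN.matrix y l q)) : E.ext.fld x) : L) =
      (L₀.map (algebraMap K L) * (matrixL bN x * L₁.map (fun c => (c : L)) +
      ∑ y with y < x, bN.famMat y x (H y))) j b := by
    rw [Matrix.mul_apply, AddSubmonoidClass.coe_finsetSum]
    refine Finset.sum_congr rfl fun l _ => ?_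
    rw [Matrix.add_apply, Matrix.mul_apply, Matrix.sum_apply]
    simp only [ModDe.LocalBases.famMat, matrixL, Matrix.map_apply, Matrix.of_apply]
    push_cast
    rfl
  rw [h]
  rfl

end AlgEquipment

theorem exists_map_nonSingular {F F' : Type*} [Field F] [Field F'] (e : F ≃+* F')
    {m n : ℕ} {X : Matrix (Fin m) (Fin n) F'} (h : NonSingular X) :
    ∃ Y : Matrix (Fin m) (Fin n) F, NonSingular Y ∧ Y.map e = X :=
  ⟨X.map e.symm, h.map e.symm.toRingHom, Matrix.ext fun _ _ => e.apply_symm_apply _⟩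

namespace PEquipped

variable {p : ℕ} [Fact p.Prime] (Q : PEquipped p P) (X : PExtension p K L)

/-- The field of a strong point. -/
noncomputable def strongEquiv {x : WithTop P} (h : Q.Strong' x) : (Q.toAlg X).ext.fld x ≃ₐ[K] K :=
  (IntermediateField.equivOfEq (Q.ext_fld_of_strong X h)).trans (IntermediateField.botEquiv K L)

theorem algebraMap_strongEquiv {x : WithTop P} (h : Q.Strong' x) (c : (Q.toAlg X).ext.fld x) :
    algebraMap K L (Q.strongEquiv X h c) = c := by
  obtain ⟨k, hk⟩ := exists_algebraMap_eq (Q.ext_fld_of_strong X h) c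
  have h1 : c = algebraMap K _ k := Subtype.ext hk.symm
  rw [h1, AlgEquiv.commutes]
  rfl

/-- The field of a weak point. -/
noncomputable def weakEquiv {x : WithTop P} (h : ¬ Q.Strong' x) :
    (Q.toAlg X).ext.fld x ≃ₐ[K] L :=
  (IntermediateField.equivOfEq (Q.ext_fld_of_not_strong X h)).trans IntermediateField.topEquiv

variable {Q X} {M N : ModDe.{u₁, u₂, u₃, w} (Q.toAlg X)} (bM : M.LocalBases) (bN : N.LocalBases)

section

variable {y x : WithTop P} (hyx : y < x) {n : ℕ}

include hyx

theorem exists_famMat_of_strong_strong (hy : Q.Strong' y) (hx : Q.Strong' x)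
    (H : Fin (bN.rank y) → Fin n → (Q.toAlg X).ext.R y x) :
    ∃ A : Matrix (Fin (bN.rank y)) (Fin n) K,
      bN.famMat y x H = matrixL bN y * A.map (algebraMap K L) := by
  choose c hc using fun q b => exists_of_strong_strong X hyx.le hy hx (H q b)
  exact ⟨Matrix.of c, Matrix.ext fun l b => by
    rw [LocalBases.famMat_apply, Matrix.mul_apply]
    exact Finset.sum_congr rfl fun q _ => hc q b (bN.matrix y l q)⟩

theorem exists_famMat_strong_strong (hy : Q.Strong' y) (hx : Q.Strong' x)
    (A : Matrix (Fin (bN.rank y)) (Fin n) K) :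
    ∃ H : Fin (bN.rank y) → Fin n → (Q.toAlg X).ext.R y x,
      bN.famMat y x H = matrixL bN y * A.map (algebraMap K L) := by
  choose c hc using fun q b => exists_strong_strong X hyx.le hy hx (A q b)
  exact ⟨c, Matrix.ext fun l b => by
    rw [LocalBases.famMat_apply, Matrix.mul_apply]
    exact Finset.sum_congr rfl fun q _ => hc q b (bN.matrix y l q)⟩

theorem exists_famMat_of_weak_strong (hx : Q.Strong' x)
    (H : Fin (bN.rank y) → Fin n → (Q.toAlg X).ext.R y x) :
    ∃ B : Matrix (Fin (bN.rank y)) (Fin n) L,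
      bN.famMat y x H = (matrixL bN y * B).map X.constCoeff := by
  choose c hc using fun q b => exists_of_weak_strong X hyx.le hx (H q b)
  exact ⟨Matrix.of c, Matrix.ext fun l b => (Finset.sum_congr rfl fun q _ => hc q b _).trans
    (X.constCoeff_sum _).symm⟩

theorem exists_famMat_weak_strong (hx : Q.Strong' x) (B : Matrix (Fin (bN.rank y)) (Fin n) L) :
    ∃ H : Fin (bN.rank y) → Fin n → (Q.toAlg X).ext.R y x,
      bN.famMat y x H = (matrixL bN y * B).map X.constCoeff := by
  choose c hc using fun q b => exists_weak_strong X hyx.le hx (B q b)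
  exact ⟨c, Matrix.ext fun l b => (Finset.sum_congr rfl fun q _ => hc q b _).trans
    (X.constCoeff_sum _).symm⟩

theorem exists_famMat_of_strong_weak (hy : Q.Strong' y) (hx : ¬ Q.Strong' x)
    (H : Fin (bN.rank y) → Fin n → (Q.toAlg X).ext.R y x) :
    ∃ A : Matrix (Fin (bN.rank y)) (Fin n) L, bN.famMat y x H = matrixL bN y * A := by
  choose c hc using fun q b => exists_of_strong_weak X hyx.le hy hx (H q b)
  exact ⟨Matrix.of c, Matrix.ext fun l b => by
    rw [LocalBases.famMat_apply, Matrix.mul_apply]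
    exact Finset.sum_congr rfl fun q _ => hc q b (bN.matrix y l q)⟩

theorem exists_famMat_strong_weak (hx : ¬ Q.Strong' x) (A : Matrix (Fin (bN.rank y)) (Fin n) L) :
    ∃ H : Fin (bN.rank y) → Fin n → (Q.toAlg X).ext.R y x,
      bN.famMat y x H = matrixL bN y * A := by
  choose c hc using fun q b => exists_strong_weak X hyx.le hx (A q b)
  exact ⟨c, Matrix.ext fun l b => by
    rw [LocalBases.famMat_apply, Matrix.mul_apply]
    exact Finset.sum_congr rfl fun q _ => hc q b (bN.matrix y l q)⟩

omit hyx in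
theorem sum_theta_apply (B : ℕ → Matrix (Fin (bN.rank y)) (Fin n) L) (k : ℕ)
    (l : Fin bN.rank₀) (b : Fin n) :
    (∑ i ∈ Finset.range k, (matrixL bN y).map (X.θ ^ i) * B i) l b =
      ∑ q, ∑ i ∈ Finset.range k, (X.θ ^ i) (bN.matrix y l q : L) * B i q b := by
  rw [Matrix.sum_apply, Finset.sum_comm]
  rfl

theorem exists_famMat_of_weak_weak (hx : ¬ Q.Strong' x)
    (H : Fin (bN.rank y) → Fin n → (Q.toAlg X).ext.R y x) :
    ∃ B : ℕ → Matrix (Fin (bN.rank y)) (Fin n) L, bN.famMat y x H =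
      ∑ i ∈ Finset.range (Q.lev' y x), (matrixL bN y).map (X.θ ^ i) * B i := by
  choose c hc using fun q b => exists_of_weak_weak X hyx.le hx (H q b)
  refine ⟨fun i => Matrix.of fun q b => c q b i, Matrix.ext fun l b => ?_⟩
  rw [sum_theta_apply, LocalBases.famMat_apply]
  exact Finset.sum_congr rfl fun q _ => hc q b (bN.matrix y l q)

theorem exists_famMat_weak_weak (hx : ¬ Q.Strong' x)
    (B : ℕ → Matrix (Fin (bN.rank y)) (Fin n) L) :
    ∃ H : Fin (bN.rank y) → Fin n → (Q.toAlg X).ext.R y x, bN.famMat y x H =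
      ∑ i ∈ Finset.range (Q.lev' y x), (matrixL bN y).map (X.θ ^ i) * B i := by
  choose c hc using fun q b => exists_weak_weak X hyx.le hx fun i => B i q b
  refine ⟨c, Matrix.ext fun l b => ?_⟩
  rw [sum_theta_apply, LocalBases.famMat_apply]
  exact Finset.sum_congr rfl fun q _ => hc q b (bN.matrix y l q)

end

open scoped Classical in
theorem sum_strong_add_sum_weak {A : Type*} [AddCommMonoid A] (x : WithTop P)
    (f g h : WithTop P → A) (hg : ∀ y, Q.Strong' y → y < x → f y = g y)
    (hh : ∀ y, ¬ Q.Strong' y → y < x → f y = h y) :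
    ∑ y with y < x, f y =
      ∑ y with Q.Strong' y ∧ y < x, g y + ∑ y with ¬ Q.Strong' y ∧ y < x, h y := by
  rw [← Finset.sum_filter_add_sum_filter_not _ (fun y => Q.Strong' y), Finset.filter_filter,
    Finset.filter_filter]
  simp only [and_comm (a := _ < x)]
  congr 1
  · exact Finset.sum_congr rfl fun y hy => hg y (Finset.mem_filter.1 hy).2.1
      (Finset.mem_filter.1 hy).2.2
  · exact Finset.sum_congr rfl fun y hy => hh y (Finset.mem_filter.1 hy).2.1
      (Finset.mem_filter.1 hy).2.2

/-- This allows a choice over all `y` at once: where the condition fails, the witness is `0` and is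
not used. -/
theorem exists_imp {α : Type*} [Zero α] {p : α → Prop} {q : Prop} (h : q → ∃ a, p a) :
    ∃ a, q → p a := by
  by_cases hq : q
  · obtain ⟨a, ha⟩ := h hq
    exact ⟨a, fun _ => ha⟩
  · exact ⟨0, fun h => absurd h hq⟩

open scoped Classical in
-- For a fixed `x` and `L⁰`, the descriptions of the maps `u` allow each term with `y < x` to be
-- replaced separately, while `Lˣ` is carried along `K(x) ≅ K`.
theorem exists_iff_of_strong (L₀ : Matrix (Fin bM.rank₀) (Fin bN.rank₀) K) {x : WithTop P}
    (hx : Q.Strong' x) :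
    (∃ (L₁ : Matrix (Fin (bN.rank x)) (Fin (bM.rank x)) ((Q.toAlg X).ext.fld x))
        (H : ∀ y : WithTop P, Fin (bN.rank y) → Fin (bM.rank x) → (Q.toAlg X).ext.R y x),
        NonSingular L₁ ∧ matrixL bM x = L₀.map (algebraMap K L) *
          (matrixL bN x * L₁.map (fun c => (c : L)) + ∑ y with y < x, bN.famMat y x (H y))) ↔
      ∃ (L₁ : Matrix (Fin (bN.rank x)) (Fin (bM.rank x)) K)
        (A : ∀ y : WithTop P, Matrix (Fin (bN.rank y)) (Fin (bM.rank x)) K)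
        (B : ∀ y : WithTop P, Matrix (Fin (bN.rank y)) (Fin (bM.rank x)) L),
        NonSingular L₁ ∧
        matrixL bM x = L₀.map (algebraMap K L) *
          (matrixL bN x * L₁.map (algebraMap K L) +
            ∑ y with Q.Strong' y ∧ y < x, matrixL bN y * (A y).map (algebraMap K L) +
            ∑ y with ¬ Q.Strong' y ∧ y < x, (matrixL bN y * B y).map X.constCoeff) := by
  constructor
  · rintro ⟨L₁, H, h₁, h⟩
    choose A hA using fun y => exists_imp fun hy : Q.Strong' y ∧ y < x =>
      exists_famMat_of_strong_strong bN hy.2 hy.1 hx (H y)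
    choose B hB using fun y => exists_imp fun hy : y < x =>
      exists_famMat_of_weak_strong bN hy hx (H y)
    refine ⟨L₁.map (Q.strongEquiv X hx), A, B,
      h₁.map (Q.strongEquiv X hx).toRingEquiv.toRingHom, ?_⟩
    rw [h, add_assoc, sum_strong_add_sum_weak x _ _ _ (fun y h h' => hA y ⟨h, h'⟩)
      fun y _ h' => hB y h']
    congr 3
    exact Matrix.ext fun q b => (Q.algebraMap_strongEquiv X hx _).symm
  · rintro ⟨L₁, A, B, h₀, h⟩
    obtain ⟨L₁, h₁, rfl⟩ := exists_map_nonSingular (Q.strongEquiv X hx).toRingEquiv h₀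
    -- For each `y` a single family is chosen, from `A y` or from `B y` according to whether `y` is
    -- strong or weak.
    choose H hH using fun y => exists_imp fun hy : y < x =>
      (show ∃ H : Fin (bN.rank y) → Fin (bM.rank x) → (Q.toAlg X).ext.R y x, bN.famMat y x H =
        if Q.Strong' y then matrixL bN y * (A y).map (algebraMap K L)
          else (matrixL bN y * B y).map X.constCoeff by
        split_ifs with hs
        · exact exists_famMat_strong_strong bN hy hs hx (A y)
        · exact exists_famMat_weak_strong bN hy hx (B y))
    refine ⟨L₁, H, h₁, ?_⟩
    rw [h, add_assoc, sum_strong_add_sum_weak x _ _ _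
      (fun y h h' => (hH y h').trans (if_pos h)) fun y h h' => (hH y h').trans (if_neg h)]
    congr 3
    exact Matrix.ext fun q b => Q.algebraMap_strongEquiv X hx _

open scoped Classical in
theorem exists_iff_of_weak (L₀ : Matrix (Fin bM.rank₀) (Fin bN.rank₀) K) {x : WithTop P}
    (hx : ¬ Q.Strong' x) :
    (∃ (L₁ : Matrix (Fin (bN.rank x)) (Fin (bM.rank x)) ((Q.toAlg X).ext.fld x))
        (H : ∀ y : WithTop P, Fin (bN.rank y) → Fin (bM.rank x) → (Q.toAlg X).ext.R y x),
        NonSingular L₁ ∧ matrixL bM x = L₀.map (algebraMap K L) *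
          (matrixL bN x * L₁.map (fun c => (c : L)) + ∑ y with y < x, bN.famMat y x (H y))) ↔
      ∃ (L₁ : Matrix (Fin (bN.rank x)) (Fin (bM.rank x)) L)
        (A : ∀ y : WithTop P, Matrix (Fin (bN.rank y)) (Fin (bM.rank x)) L)
        (B : ∀ y : WithTop P, ℕ → Matrix (Fin (bN.rank y)) (Fin (bM.rank x)) L),
        NonSingular L₁ ∧
        matrixL bM x = L₀.map (algebraMap K L) *
          (matrixL bN x * L₁ +
            ∑ y with Q.Strong' y ∧ y < x, matrixL bN y * A y +
            ∑ y with ¬ Q.Strong' y ∧ y < x, ∑ i ∈ Finset.range (Q.lev' y x),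
              (matrixL bN y).map (X.θ ^ i) * B y i) := by
  constructor
  · rintro ⟨L₁, H, h₁, h⟩
    choose A hA using fun y => exists_imp fun hy : Q.Strong' y ∧ y < x =>
      exists_famMat_of_strong_weak bN hy.2 hy.1 hx (H y)
    choose B hB using fun y => exists_imp fun hy : y < x =>
      exists_famMat_of_weak_weak bN hy hx (H y)
    refine ⟨L₁.map (Q.weakEquiv X hx), A, B,
      h₁.map (Q.weakEquiv X hx).toRingEquiv.toRingHom, ?_⟩
    rw [h, add_assoc, sum_strong_add_sum_weak x _ _ _ (fun y h h' => hA y ⟨h, h'⟩)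
      fun y _ h' => hB y h']
    rfl
  · rintro ⟨L₁, A, B, h₀, h⟩
    obtain ⟨L₁, h₁, rfl⟩ := exists_map_nonSingular (Q.weakEquiv X hx).toRingEquiv h₀
    choose H hH using fun y => exists_imp fun hy : y < x =>
      (show ∃ H : Fin (bN.rank y) → Fin (bM.rank x) → (Q.toAlg X).ext.R y x, bN.famMat y x H =
        if Q.Strong' y then matrixL bN y * A y
          else ∑ i ∈ Finset.range (Q.lev' y x), (matrixL bN y).map (X.θ ^ i) * B y i by
        split_ifs with hs
        · exact exists_famMat_strong_weak bN hy hx (A y)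
        · exact exists_famMat_weak_weak bN hy hx (B y))
    refine ⟨L₁, H, h₁, ?_⟩
    rw [h, add_assoc, sum_strong_add_sum_weak x _ _ _
      (fun y h h' => (hH y h').trans (if_pos h)) fun y h h' => (hH y h').trans (if_neg h)]
    rfl

/-- Only `L⁰` is shared by the equations at different points. The unknowns `Lˣ` and `H` at `x` occur
in no other equation, so each `x` can be treated alone. -/
theorem famEquiv_iff_pMatrixEquiv : FamEquiv bM bN ↔ PMatrixEquiv Q X bM bN := by
  classical
  constructor
  · rintro ⟨L₀, L₁, H, h₀, h₁, h⟩
    have h' := fun x => (eqn_iff_matrixL bM bN x L₀ (L₁ x) (fun y => H y x)).1 (h x)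
    exact ⟨L₀, h₀,
      fun x hx => (exists_iff_of_strong bM bN L₀ hx).1 ⟨L₁ x, fun y => H y x, h₁ x, h' x⟩,
      fun x hx => (exists_iff_of_weak bM bN L₀ hx).1 ⟨L₁ x, fun y => H y x, h₁ x, h' x⟩⟩
  · rintro ⟨L₀, h₀, hs, hw⟩
    have key : ∀ x : WithTop P,
        ∃ (L₁ : Matrix (Fin (bN.rank x)) (Fin (bM.rank x)) ((Q.toAlg X).ext.fld x))
        (H : ∀ y : WithTop P, Fin (bN.rank y) → Fin (bM.rank x) → (Q.toAlg X).ext.R y x),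
        NonSingular L₁ ∧ matrixL bM x = L₀.map (algebraMap K L) *
          (matrixL bN x * L₁.map (fun c => (c : L)) + ∑ y with y < x, bN.famMat y x (H y)) := by
      intro x
      by_cases hx : Q.Strong' x
      · exact (exists_iff_of_strong bM bN L₀ hx).2 (hs x hx)
      · exact (exists_iff_of_weak bM bN L₀ hx).2 (hw x hx)
    choose L₁ H h₁ h using key
    exact ⟨L₀, L₁, fun y x => H x y, h₀, h₁,
      fun x => (eqn_iff_matrixL bM bN x L₀ (L₁ x) (fun y => H x y)).2 (h x)⟩

end PEquipped

end EqPoset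

/-- Both situations enter through their `AlgEquipment` alone in the general criterion. `FamEquiv` is
the common middle term, from which the form with bases `τ` and the explicit form are derived
independently. -/
theorem mainTheorem11 {K L P : Type*} [Field K] [Field L] [Algebra K L] [FiniteDimensional K L]
    [PartialOrder P] [Fintype P] [DecidableEq P] :
    (∀ [IsGalois K L] (G : EqPoset.GenEquipped K L P) (ξ : L)
      (hξ : IntermediateField.adjoin K {ξ} = ⊤) (τ : (G.toAlg ξ hξ).RBases)
      (M N : (G.toAlg ξ hξ).ModDe) (bM : M.LocalBases) (bN : N.LocalBases),
      M.Iso N ↔ EqPoset.MatrixEquiv τ bM bN) ∧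
    ∀ (p : ℕ) [Fact p.Prime] (Q : EqPoset.PEquipped p P) (X : EqPoset.PExtension p K L)
      (M N : (Q.toAlg X).ModDe) (bM : M.LocalBases) (bN : N.LocalBases),
      (∀ τ : (Q.toAlg X).RBases, M.Iso N ↔ EqPoset.MatrixEquiv τ bM bN) ∧
      (M.Iso N ↔ EqPoset.PMatrixEquiv Q X bM bN) :=
  ⟨fun _ _ _ τ _ _ bM bN => (EqPoset.AlgEquipment.ModDe.iso_iff_famEquiv bM bN).trans
      (EqPoset.AlgEquipment.ModDe.famEquiv_iff_matrixEquiv τ bM bN),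
    fun _ _ _ _ _ _ bM bN =>
      ⟨fun τ => (EqPoset.AlgEquipment.ModDe.iso_iff_famEquiv bM bN).trans
        (EqPoset.AlgEquipment.ModDe.famEquiv_iff_matrixEquiv τ bM bN),
      (EqPoset.AlgEquipment.ModDe.iso_iff_famEquiv bM bN).trans
        (EqPoset.PEquipped.famEquiv_iff_pMatrixEquiv bM bN)⟩⟩
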